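/- Let $(E,[\![\cdot,\cdot]\!],\rho)$ be a Lie algebroid over a smooth (Hausdorff, finite-dimensional) manifold $M$: $\tau_E:E\to M$ is a smooth vector bundle of finite rank $n$, $\rho:E\to TM$ a vector bundle map, and $[\![\cdot,\cdot]\!]$ a Lie bracket on $\Gamma(E)$ with $[\![X,fY]\!]=f[\![X,Y]\!]+\rho(X)(f)\,Y$. *Conventions.* For a Lie algebroid $A\to N$ with anchor $\rho_A$ and a smooth map $f:P\to N$, whenever the following fibres form a vector bundle over $P$, the prolongation $\mathcal T^fA\to P$ is the Lie algebroid with fibres $$\mathcal T^f_pA=\{(a,v)\in A_{f(p)}\times T_pP\;:\;\rho_A(a)=T_pf(v)\},$$ anchor $(a,v)\mapsto v$, and bracket given on sections $X=(\sum_i g_i\,(\sigma_i\circ f),U)$ and $Y=(\sum_j h_j\,(\tau_j\circ f),V)$, with $\sigma_i,\tau_j\in\Gamma(A)$ and $g_i,h_j\in C^\infty(P)$, by $$[\![X,Y]\!]=\Big(\sum_{i,j}g_ih_j\,[\![\sigma_i,\tau_j]\!]_A\circ f+\sum_jU(h_j)\,\tau_j\circ f-\sum_iV(g_i)\,\sigma_i\circ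 f,\;[U,V]\Big).$$ The differential $d$ of a Lie algebroid is given on sections of the exterior powers of its dual by the usual Koszul formula, e.g. $d\theta(X,Y)=\rho(X)(\theta(Y))-\rho(Y)(\theta(X))-\theta([\![X,Y]\!])$. A *symplectic section* of a Lie algebroid $A$ is a smooth section $\Omega$ of $\Lambda^2A^*$ which is nondegenerate on every fibre and satisfies $d\Omega=0$. If $\pi:A^*\to N$ is the dual bundle, the canonical symplectic section of $\mathcal T^{\pi}A$ is $\Omega_A=-d\lambda$, where $\lambda(\mu)(a,v)=\langle\mu,a\rangle$. *Setting.* Let $\mathcal T^{\tau_E}E\to E$ be the prolongation of $E$ over $\tau_E$, and let $$E^{(2)}=\{(b,v)\in\mathcal T^{\tau_E}_eE\;:\;e\in E,\ b=e\}\subset\mathcal T^{\tau_E}E.$$ For $e,b$ in the same fibre of $E$ let $b^v_e=\frac{d}{dt}\big|_{t=0}(e+tb)\in T_eE$ be the vertical lift, so that $(0,b^v_e)\in\mathcal T^{\tau_E}_eE$. Let $L:E^{(2)}\to\mathbb R$ be smooth. For $p\in E^{(2)}$ over $e\in E$ and $b,b'\in E_{\tau_E(e)}$ put $$\partial_bL(p)=\tfrac{d}{dt}\Big|_{t=0}L\big(p+t\,(0,b^v_e)\big),\qquad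 \partial_b\partial_{b'}L(p)=\tfrac{d}{ds}\Big|_{s=0}\partial_{b'}L\big(p+s\,(0,b^v_e)\big).$$ If $(x^i,y^A,z^A)$ are the local coordinates on $E^{(2)}$ induced by coordinates $(x^i)$ on $M$ and a local frame $(e_A)$ of $E$, then $\partial_{e_A}L=\partial L/\partial z^A$ and $\partial_{e_A}\partial_{e_B}L=\partial^2L/\partial z^A\partial z^B$. Let $W_0=E^{(2)}\times_E(\mathcal T^{\tau_E}E)^*$, let $\nu:W_0\to E$ and $\pi_2:W_0\to(\mathcal T^{\tau_E}E)^*$ be the projections, and let $$\mathcal T\pi_2=(\mathrm{Id},T\pi_2):\ \mathcal T^\nu\mathcal T^{\tau_E}E\to\mathcal T^{\pi}\mathcal T^{\tau_E}E,\qquad \pi:(\mathcal T^{\tau_E}E)^*\to E.$$ Let $\Omega_0=(\mathcal T\pi_2)^*\Omega$, where $\Omega$ is the canonical symplectic section associated with the Lie algebroid $\mathcal T^{\tau_E}E$. Finally let $$W_1=\{(p,\alpha)\in W_0\;:\;\langle\alpha,(0,b^v_e)\rangle=\partial_bL(p)\ \text{ for all } b\in E_{\tau_E(e)},\ e=\nu(p,\alpha)\},$$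 that is, $\bar p_A=\partial L/\partial z^A$ in local coordinates. It is a submanifold of $W_0$. Let $\nu_1=\nu|_{W_1}:W_1\to E$, and let $\Omega_{W_1}$ be the pullback of $\Omega_0$ to $\mathcal T^{\nu_1}\mathcal T^{\tau_E}E$. **Proposition.** $\Omega_{W_1}$ is a symplectic section of the Lie algebroid $\mathcal T^{\nu_1}\mathcal T^{\tau_E}E$ if and only if the matrix $\left(\dfrac{\partial^2L}{\partial z^A\partial z^B}\right)$ is nondegenerate along $W_1$, i.e. for every $w=(p,\alpha)\in W_1$ and every basis $(e_A)$ of the fibre of $E$ over $\tau_E(\nu(w))$, $\det\big(\partial_{e_A}\partial_{e_B}L(p)\big)\neq0$. -/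

import Mathlib

open Bundle Set Filter
open scoped Manifold Topology ContDiff

/-! ## Algebroid data and prolongations over a smooth map -/

/-- The operations of a Lie algebroid on a family `A` of vector spaces over a manifold `N`: an
anchor and a bracket. The bracket takes arbitrary (set-theoretic) sections; it is meaningful at a
point `x` for sections that are smooth near `x`, and junk otherwise. The laws are *not* part of
this structure: every instance used below is constructed explicitly from a genuine
`LieAlgebroid`. -/
structure AlgebroidData {EN HN N : Type*} [NormedAddCommGroup EN] [NormedSpace ℝ EN]
    [TopologicalSpace HN] [TopologicalSpace N] [ChartedSpace HN N] (I : ModelWithCorners ℝ EN HN)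
    (A : N → Type*) [∀ x, AddCommGroup (A x)] [∀ x, Module ℝ (A x)] where
  anchor : ∀ x, A x →ₗ[ℝ] TangentSpace I x
  bracket : (∀ x, A x) → (∀ x, A x) → ∀ x, A x

/-- The derivative of a vector-valued function `g` at `w` in the direction of the tangent vector `v`. -/
noncomputable def dirDeriv {EW HW W : Type*} [NormedAddCommGroup EW] [NormedSpace ℝ EW]
    [TopologicalSpace HW] [TopologicalSpace W] [ChartedSpace HW W] (J : ModelWithCorners ℝ EW HW)
    {G : Type*} [NormedAddCommGroup G] [NormedSpace ℝ G] (g : W → G) (w : W)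
    (v : TangentSpace J w) : G :=
  mfderiv J 𝓘(ℝ, G) g w v

namespace AlgebroidData

section Prolongation

variable {EN HN N : Type*} [NormedAddCommGroup EN] [NormedSpace ℝ EN]
  [TopologicalSpace HN] [TopologicalSpace N] [ChartedSpace HN N] {I : ModelWithCorners ℝ EN HN}
  {A : N → Type*} [∀ x, AddCommGroup (A x)] [∀ x, Module ℝ (A x)]
  {EW HW W : Type*} [NormedAddCommGroup EW] [NormedSpace ℝ EW]
  [TopologicalSpace HW] [TopologicalSpace W] [ChartedSpace HW W]
  (J : ModelWithCorners ℝ EW HW) (D : AlgebroidData I A) (f : W → N)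

/-- The fibre over `w` of the prolongation `𝒯^f A` of `A` over `f : W → N`:
pairs `(a, v)` in `A_{f w} × T_w W` with `ρ a = (T_w f) v`. -/
noncomputable def prolFiber (w : W) : Submodule ℝ (A (f w) × TangentSpace J w) :=
  LinearMap.eqLocus ((D.anchor (f w)).comp (LinearMap.fst ℝ _ _))
    ((mfderiv J I f w).toLinearMap.comp (LinearMap.snd ℝ _ _))

theorem mem_prolFiber {w : W} (u : A (f w) × TangentSpace J w) :
    u ∈ D.prolFiber J f w ↔ D.anchor (f w) u.1 = mfderiv J I f w u.2 := Iff.rfl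

variable (F : Type*) [NormedAddCommGroup F] [NormedSpace ℝ F] [TopologicalSpace (TotalSpace F A)]
  [∀ x, TopologicalSpace (A x)] [FiberBundle F A]

/-- The local section of `A` which is constant, equal to `c`, in the preferred local
trivialization of `A` around `x₀`. -/
noncomputable def constSection (A : N → Type*) [∀ x, AddCommGroup (A x)] [TopologicalSpace (TotalSpace F A)]
    [∀ x, TopologicalSpace (A x)] [FiberBundle F A] (x₀ : N) (c : F) : ∀ x, A x :=
  fun x => (trivializationAt F A x₀).symm x c

/-- The components of a section `X = (σ, U)` of `𝒯^f A` along `A`, read in the preferred local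
trivialization of `A` around `f w₀`. -/
def components {D : AlgebroidData I A} {J : ModelWithCorners ℝ EW HW} {f : W → N} (w₀ : W)
    (X : ∀ w, D.prolFiber J f w) : W → F :=
  fun w => (trivializationAt F A (f w₀) ⟨f w, (X w).1.1⟩).2

/-- The bracket of two sections `X = (σ, U)` and `Y = (τ, V)` of the prolongation `𝒯^f A`, as an
element of `A_{f w} × T_w W`. The second component is the Lie bracket of vector fields `[U, V]`.
The first one is what the Leibniz rule dictates: if `(e_i)` is a local frame of `A` near `f w`
and `σ = a^i (e_i ∘ f)`, `τ = b^j (e_j ∘ f)`, then it is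
`(U(b^i) - V(a^i)) e_i + a^i b^j ⟦e_i, e_j⟧_A`. -/
noncomputable def prolBracketPair (X Y : ∀ w, D.prolFiber J f w) (w : W) :
    A (f w) × TangentSpace J w :=
  ((trivializationAt F A (f w)).symm (f w)
      (dirDeriv J (components F w Y) w (X w).1.2 - dirDeriv J (components F w X) w (Y w).1.2)
    + D.bracket (constSection F A (f w) (components F w X w))
        (constSection F A (f w) (components F w Y w)) (f w),
    VectorField.mlieBracket J (fun w' => (X w').1.2) (fun w' => (Y w').1.2) w)

open Classical in
/-- The bracket of sections of `𝒯^f A`. (For smooth sections of the prolongation of a Lie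
algebroid the pair `prolBracketPair` always lies in the fibre, because the anchor is compatible
with brackets; the value `0` is only used for sections that are not smooth.) -/
noncomputable def prolBracket (X Y : ∀ w, D.prolFiber J f w) (w : W) : D.prolFiber J f w :=
  if h : D.prolBracketPair J f F X Y w ∈ D.prolFiber J f w
  then ⟨D.prolBracketPair J f F X Y w, h⟩ else 0

/-- The prolongation `𝒯^f A` of `A` over `f : W → N`: its anchor is the projection onto the second
factor. -/
noncomputable def prolongation : AlgebroidData J (fun w => D.prolFiber J f w) where
  anchor w := (LinearMap.snd ℝ _ _).comp (D.prolFiber J f w).subtype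
  bracket := D.prolBracket J f F

/-! ### Sections, differentials, restriction to a subset -/

variable {J f} [IsManifold J ∞ W]

/-- The section `X = (σ, U)` of `𝒯^f A` is smooth on a neighbourhood of `w`. -/
def SmoothNear {D : AlgebroidData I A} (X : ∀ w, D.prolFiber J f w) (w : W) : Prop :=
  ∀ᶠ w' in 𝓝 w,
    ContMDiffAt J (I.prod 𝓘(ℝ, F)) ∞ (fun w => TotalSpace.mk' F (f w) (X w).1.1) w' ∧
    ContMDiffAt J J.tangent ∞ (fun w => (⟨w, (X w).1.2⟩ : TangentBundle J W)) w'

/-- The derivative of a function along a section, `ρ(X)(g)`. -/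
noncomputable def lieDeriv {D : AlgebroidData I A} (X : ∀ w, D.prolFiber J f w) (g : W → ℝ)
    (w : W) : ℝ :=
  dirDeriv J g w (X w).1.2

/-- The differential of a 1-section `θ` of `𝒯^f A` on two sections:
`dθ(X, Y) = ρ(X)(θ(Y)) - ρ(Y)(θ(X)) - θ(⟦X, Y⟧)`. -/
noncomputable def d₁ (θ : ∀ w, D.prolFiber J f w → ℝ) (X Y : ∀ w, D.prolFiber J f w) (w : W) : ℝ :=
  lieDeriv X (fun w' => θ w' (Y w')) w - lieDeriv Y (fun w' => θ w' (X w')) w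
    - θ w (D.prolBracket J f F X Y w)

/-- The differential of a 1-section `θ` of `𝒯^f A` as a pointwise 2-form: `dθ_w(u, v)` is the common
value of `dθ(X, Y)` at `w` for all local smooth sections `X`, `Y` with `X(w) = u`, `Y(w) = v`. -/
noncomputable def d₁At (θ : ∀ w, D.prolFiber J f w → ℝ) (w : W) (u v : D.prolFiber J f w) : ℝ :=
  Classical.epsilon fun r : ℝ => ∀ X Y : ∀ w, D.prolFiber J f w,
    SmoothNear F X w → SmoothNear F Y w → X w = u → Y w = v → D.d₁ F θ X Y w = r

/-- The differential of a 2-section `Ω` of `𝒯^f A` on three sections. -/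
noncomputable def d₂ (Ω : ∀ w, D.prolFiber J f w → D.prolFiber J f w → ℝ)
    (X Y Z : ∀ w, D.prolFiber J f w) (w : W) : ℝ :=
  lieDeriv X (fun w' => Ω w' (Y w') (Z w')) w
    - lieDeriv Y (fun w' => Ω w' (X w') (Z w')) w
    + lieDeriv Z (fun w' => Ω w' (X w') (Y w')) w
    - Ω w (D.prolBracket J f F X Y w) (Z w)
    + Ω w (D.prolBracket J f F X Z w) (Y w)
    - Ω w (D.prolBracket J f F Y Z w) (X w)

/-- The tangent space `T_w S ⊆ T_w W` of a submanifold `S ⊆ W`: spanned by the velocities at `w`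
of the smooth curves in `W` which pass through `w` and lie in `S`. -/
noncomputable def tangentSubspace (J : ModelWithCorners ℝ EW HW) (S : Set W) (w : W) :
    Submodule ℝ (TangentSpace J w) :=
  Submodule.span ℝ {v | ∃ γ : ℝ → W, ContMDiffAt 𝓘(ℝ, ℝ) J ∞ γ 0 ∧ γ 0 = w ∧
    (∀ᶠ t in 𝓝 (0 : ℝ), γ t ∈ S) ∧ (mfderiv 𝓘(ℝ, ℝ) J γ 0 (1 : ℝ) : EW) = v}

/-- The fibre at `w ∈ S` of the prolongation of `A` over the restriction `f|_S : S → N` to a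
submanifold `S ⊆ W`, i.e. `{(a, v) ∈ A_{f w} × T_w S ∣ ρ a = (T_w f) v}`, as a subspace of the fibre
of `𝒯^f A`. It is the fibre of the Lie subalgebroid `ρ^{-1}(TS)` of `𝒯^f A` over `S`. -/
noncomputable def restrictFiber (D : AlgebroidData I A) (J : ModelWithCorners ℝ EW HW) (f : W → N) (S : Set W)
    (w : W) : Submodule ℝ (D.prolFiber J f w) :=
  (tangentSubspace J S w).comap ((LinearMap.snd ℝ _ _).comp (D.prolFiber J f w).subtype)

/-- `X` represents, near the point `w` of `S`, a smooth section of the prolongation of `A` over `f|_S`: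
it is smooth near `w` and, at the points of `S`, takes values in the fibres of that
subalgebroid. -/
def IsLocalSection {D : AlgebroidData I A} (S : Set W) (X : ∀ w, D.prolFiber J f w) (w : W) :
    Prop :=
  SmoothNear F X w ∧ ∀ᶠ w' in 𝓝[S] w, X w' ∈ D.restrictFiber J f S w'

/-- Let `Ω` be a 2-section of `𝒯^f A` and `S ⊆ W` a submanifold. `D.IsSymplecticOn F S Ω` says that the
pullback of `Ω` to `S` is a symplectic section of the prolongation `𝒯^{f|_S} A` of `A` over
`f|_S : S → N`: it is a smooth section of `Λ²(𝒯^{f|_S} A)^*`, nondegenerate on every fibre, and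
closed. The bracket and the differential of `𝒯^{f|_S} A` are computed, as for any Lie subalgebroid,
by means of (local) extensions of sections. -/
structure IsSymplecticOn (S : Set W) (Ω : ∀ w, D.prolFiber J f w → D.prolFiber J f w → ℝ) :
    Prop where
  nondegenerate : ∀ w ∈ S, ∃ β : LinearMap.BilinForm ℝ (D.restrictFiber J f S w),
    (∀ u v, β u v = Ω w u v) ∧ β.IsAlt ∧ β.Nondegenerate
  smooth : ∀ w ∈ S, ∀ X Y : ∀ w, D.prolFiber J f w, IsLocalSection F S X w →
    IsLocalSection F S Y w → ContMDiffWithinAt J 𝓘(ℝ, ℝ) ∞ (fun w' => Ω w' (X w') (Y w')) S w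
  closed : ∀ w ∈ S, ∀ X Y Z : ∀ w, D.prolFiber J f w, IsLocalSection F S X w →
    IsLocalSection F S Y w → IsLocalSection F S Z w → D.d₂ F Ω X Y Z w = 0

end Prolongation

end AlgebroidData

set_option linter.unusedSectionVars false

/-! ## Lie algebroids -/

/-- A Lie algebroid structure on the smooth vector bundle `E → M` (with typical fibre `F`, over a
manifold `M` modelled on `B`): a vector bundle morphism `ρ : E → TM` and a Lie bracket on the space
of smooth sections of `E` satisfying the Leibniz rule `⟦X, g Y⟧ = g ⟦X, Y⟧ + ρ(X)(g) Y`. -/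
structure LieAlgebroid (B F : Type*) {M : Type*} (E : M → Type*)
    [NormedAddCommGroup B] [NormedSpace ℝ B] [NormedAddCommGroup F] [NormedSpace ℝ F]
    [TopologicalSpace M] [ChartedSpace B M] [IsManifold 𝓘(ℝ, B) ∞ M]
    [TopologicalSpace (TotalSpace F E)] [∀ x, TopologicalSpace (E x)]
    [∀ x, AddCommGroup (E x)] [∀ x, Module ℝ (E x)] [FiberBundle F E] [VectorBundle ℝ F E]
    [ContMDiffVectorBundle ∞ F E 𝓘(ℝ, B)] where
  anchor : ∀ x, E x →ₗ[ℝ] TangentSpace 𝓘(ℝ, B) x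
  contMDiff_anchor : ContMDiff (𝓘(ℝ, B).prod 𝓘(ℝ, F)) 𝓘(ℝ, B).tangent ∞
    (fun e : TotalSpace F E => (⟨e.proj, anchor e.proj e.2⟩ : TangentBundle 𝓘(ℝ, B) M))
  bracket : Cₛ^∞⟮𝓘(ℝ, B); F, E⟯ →ₗ[ℝ] Cₛ^∞⟮𝓘(ℝ, B); F, E⟯ →ₗ[ℝ] Cₛ^∞⟮𝓘(ℝ, B); F, E⟯
  bracket_self : ∀ X, bracket X X = 0
  jacobi : ∀ X Y Z,
    bracket X (bracket Y Z) + bracket Z (bracket X Y) + bracket Y (bracket Z X) = 0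
  leibniz : ∀ (X Y Z : Cₛ^∞⟮𝓘(ℝ, B); F, E⟯) (g : C^∞⟮𝓘(ℝ, B), M; ℝ⟯),
    (∀ x, Z x = g x • Y x) → ∀ x, bracket X Z x =
      g x • bracket X Y x + dirDeriv 𝓘(ℝ, B) g x (anchor x (X x)) • Y x

namespace LieAlgebroid

section

variable {B F M : Type*} {E : M → Type*}
  [NormedAddCommGroup B] [NormedSpace ℝ B] [NormedAddCommGroup F] [NormedSpace ℝ F]
  [TopologicalSpace M] [ChartedSpace B M] [IsManifold 𝓘(ℝ, B) ∞ M]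
  [TopologicalSpace (TotalSpace F E)] [∀ x, TopologicalSpace (E x)]
  [∀ x, AddCommGroup (E x)] [∀ x, Module ℝ (E x)] [FiberBundle F E] [VectorBundle ℝ F E]
  [ContMDiffVectorBundle ∞ F E 𝓘(ℝ, B)]
  (A : LieAlgebroid B F E)

/-- The operations of a Lie algebroid. The bracket of two local sections at `x` is the value at `x`
of the bracket of any two global smooth sections which coincide with them near `x` (this does
not depend on the choice of the global sections, since the bracket is a local operator). -/
noncomputable def toData : AlgebroidData 𝓘(ℝ, B) E where
  anchor := A.anchor
  bracket X Y x := Classical.epsilon fun r : E x => ∀ X' Y' : Cₛ^∞⟮𝓘(ℝ, B); F, E⟯,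
    (∀ᶠ y in 𝓝 x, X' y = X y) → (∀ᶠ y in 𝓝 x, Y' y = Y y) → A.bracket X' Y' x = r

/-! ### The `E`-tangent bundle `𝒯^{τ_E} E` as a smooth vector bundle over `E` -/

/-- The fibre at `e ∈ E` of the prolongation `𝒯^{τ_E} E` of `E` over its own projection
`τ_E : E → M`: pairs `(b, v)` with `b ∈ E_{τ(e)}`, `v ∈ T_e E` and `ρ b = (T_e τ_E) v`. -/
def Tan (e : TotalSpace F E) : Type _ :=
  A.toData.prolFiber (𝓘(ℝ, B).prod 𝓘(ℝ, F)) (TotalSpace.proj : TotalSpace F E → M) e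

noncomputable instance (e : TotalSpace F E) : AddCommGroup (A.Tan e) :=
  inferInstanceAs (AddCommGroup (A.toData.prolFiber (𝓘(ℝ, B).prod 𝓘(ℝ, F)) TotalSpace.proj e))

noncomputable instance (e : TotalSpace F E) : Module ℝ (A.Tan e) :=
  inferInstanceAs (Module ℝ (A.toData.prolFiber (𝓘(ℝ, B).prod 𝓘(ℝ, F)) TotalSpace.proj e))

instance (e : TotalSpace F E) : TopologicalSpace (A.Tan e) :=
  inferInstanceAs
    (TopologicalSpace (A.toData.prolFiber (𝓘(ℝ, B).prod 𝓘(ℝ, F)) TotalSpace.proj e))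

instance [∀ x, IsTopologicalAddGroup (E x)] (e : TotalSpace F E) :
    IsTopologicalAddGroup (A.Tan e) :=
  inferInstanceAs
    (IsTopologicalAddGroup (A.toData.prolFiber (𝓘(ℝ, B).prod 𝓘(ℝ, F)) TotalSpace.proj e))

instance [∀ x, ContinuousSMul ℝ (E x)] (e : TotalSpace F E) : ContinuousSMul ℝ (A.Tan e) :=
  inferInstanceAs
    (ContinuousSMul ℝ (A.toData.prolFiber (𝓘(ℝ, B).prod 𝓘(ℝ, F)) TotalSpace.proj e))

theorem Tan.anchor_fst {e : TotalSpace F E} (u : A.Tan e) :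
    A.anchor e.proj u.1.1 =
      mfderiv (𝓘(ℝ, B).prod 𝓘(ℝ, F)) 𝓘(ℝ, B) (TotalSpace.proj : TotalSpace F E → M) e u.1.2 := u.2

/-! Local coordinates. A local trivialization `e` of `E` (that is, a local frame `(e_A)` of `E`)
induces the local frame `(e_A^{(1)}, e_A^{(2)})` of `𝒯^{τ_E} E`; we write down the coordinates with
respect to it, and check that they define a smooth vector bundle. -/

variable (e : Trivialization F (π F E)) [MemTrivializationAtlas e]

/-- Fibre coordinate of `E` in the trivialization `e`. -/
def fibCoord (p : TotalSpace F E) : F := (e p).2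

theorem contMDiffOn_fibCoord :
    ContMDiffOn (𝓘(ℝ, B).prod 𝓘(ℝ, F)) 𝓘(ℝ, F) ∞ (fibCoord e) e.source :=
  contMDiff_snd.comp_contMDiffOn (e.contMDiffOn (n := ∞) (IB := 𝓘(ℝ, B)))

/-- Coordinates `(z^A, v^A)` of an element `(b, v)` of `𝒯^{τ_E} E`. -/
noncomputable def Tan.coords (a : TotalSpace F E) : A.Tan a →ₗ[ℝ] F × F :=
  LinearMap.prod
    ((e.linearMapAt ℝ a.proj).comp ((LinearMap.fst ℝ _ _).comp (Submodule.subtype _)))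
    ((mfderiv (𝓘(ℝ, B).prod 𝓘(ℝ, F)) 𝓘(ℝ, F) (fibCoord e) a).toLinearMap.comp
      ((LinearMap.snd ℝ _ _).comp (Submodule.subtype _)))

theorem Tan.coords_fst (a : TotalSpace F E) (u : A.Tan a) :
    (Tan.coords A e a u).1 = e.linearMapAt ℝ a.proj u.1.1 := rfl

theorem Tan.coords_snd (a : TotalSpace F E) (u : A.Tan a) :
    (Tan.coords A e a u).2 = dirDeriv (𝓘(ℝ, B).prod 𝓘(ℝ, F)) (fibCoord e) a u.1.2 := rfl

/-- The tangent vector at `a` with base component `ρ(e^{-1} c.1)` and fibre component `c.2`. -/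
noncomputable def liftVec (a : TotalSpace F E) (c : F × F) :
    TangentSpace (𝓘(ℝ, B).prod 𝓘(ℝ, F)) a :=
  (mfderiv (𝓘(ℝ, B).prod 𝓘(ℝ, F)) (𝓘(ℝ, B).prod 𝓘(ℝ, F)) e.toOpenPartialHomeomorph.symm (e a)
    ((A.anchor a.proj (e.symm a.proj c.1), c.2) : B × F) : B × F)

theorem mfderiv_triv {a : TotalSpace F E} (ha : a ∈ e.source) (v : B × F) :
    (mfderiv (𝓘(ℝ, B).prod 𝓘(ℝ, F)) (𝓘(ℝ, B).prod 𝓘(ℝ, F)) e a v : B × F) =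
      ((mfderiv (𝓘(ℝ, B).prod 𝓘(ℝ, F)) 𝓘(ℝ, B) (TotalSpace.proj : TotalSpace F E → M) a v : B),
        (mfderiv (𝓘(ℝ, B).prod 𝓘(ℝ, F)) 𝓘(ℝ, F) (fibCoord e) a v : F)) := by
  have h1 : MDifferentiableAt (𝓘(ℝ, B).prod 𝓘(ℝ, F)) 𝓘(ℝ, B)
      (TotalSpace.proj : TotalSpace F E → M) a :=
    (Bundle.contMDiff_proj (n := ∞) E).mdifferentiable (by simp) a
  have h2 : MDifferentiableAt (𝓘(ℝ, B).prod 𝓘(ℝ, F)) 𝓘(ℝ, F) (fibCoord e) a :=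
    ((contMDiffOn_fibCoord e).contMDiffAt (e.open_source.mem_nhds ha)).mdifferentiableAt (by simp)
  have h3 : (fun p : TotalSpace F E => (p.proj, fibCoord e p)) =ᶠ[𝓝 a] e := by
    filter_upwards [e.open_source.mem_nhds ha] with p hp
    exact e.mk_proj_snd hp
  rw [← h3.mfderiv_eq, mfderiv_prodMk h1 h2]
  rfl


theorem liftVec_spec {a : TotalSpace F E} (ha : a ∈ e.source) (c : F × F) :
    (mfderiv (𝓘(ℝ, B).prod 𝓘(ℝ, F)) 𝓘(ℝ, B) (TotalSpace.proj : TotalSpace F E → M) a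
        (liftVec A e a c) : B) = A.anchor a.proj (e.symm a.proj c.1) ∧
      dirDeriv (𝓘(ℝ, B).prod 𝓘(ℝ, F)) (fibCoord e) a (liftVec A e a c) = c.2 := by
  have hM := e.mdifferentiable (I := 𝓘(ℝ, B))
  have h := (hM.mfderiv ha).apply_symm_apply
    ((A.anchor a.proj (e.symm a.proj c.1), c.2) : B × F)
  have h2 := mfderiv_triv (B := B) e ha (liftVec A e a c)
  have h3 := h2.symm.trans h
  exact ⟨congrArg Prod.fst h3, congrArg Prod.snd h3⟩

/-- The element of the fibre of `𝒯^{τ_E} E` at `a` with given coordinates. -/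
noncomputable def Tan.ofCoords (a : TotalSpace F E) (ha : a ∈ e.source) (c : F × F) : A.Tan a :=
  ⟨(e.symm a.proj c.1, liftVec A e a c), ((liftVec_spec A e ha c).1).symm⟩

theorem Tan.coords_ofCoords (a : TotalSpace F E) (ha : a ∈ e.source) (c : F × F) :
    Tan.coords A e a (Tan.ofCoords A e a ha c) = c := by
  have hb : a.proj ∈ e.baseSet := e.mem_source.1 ha
  refine Prod.ext ?_ (liftVec_spec A e ha c).2
  rw [Tan.coords_fst, Trivialization.coe_linearMapAt_of_mem _ hb]
  exact congrArg Prod.snd (e.apply_mk_symm hb c.1)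

theorem Tan.coords_injective {a : TotalSpace F E} (ha : a ∈ e.source) :
    Function.Injective (Tan.coords A e a) := by
  have hb : a.proj ∈ e.baseSet := e.mem_source.1 ha
  rw [injective_iff_map_eq_zero]
  intro u hu
  have h1 : u.1.1 = 0 := by
    have h := congrArg Prod.fst hu
    rw [Tan.coords_fst] at h
    have h' := e.symmₗ_linearMapAt (R := ℝ) hb u.1.1
    rw [h] at h'
    simpa using h'.symm
  have h2 : u.1.2 = 0 := by
    have hM := e.mdifferentiable (I := 𝓘(ℝ, B))
    apply (hM.mfderiv ha).injective
    rw [map_zero]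
    refine (mfderiv_triv (B := B) e ha u.1.2).trans ?_
    have h5 := congrArg Prod.snd hu
    rw [Tan.coords_snd] at h5
    refine Prod.ext ?_ h5
    have h := Tan.anchor_fst A u
    rw [h1, map_zero] at h
    exact h.symm
  exact Subtype.ext (Prod.ext h1 h2)

open Classical in
/-- The local trivialization of `𝒯^{τ_E} E` induced by a local trivialization of `E`. -/
noncomputable def Tan.pretriv : Pretrivialization (F × F) (π (F × F) A.Tan) where
  toFun p := (p.1, Tan.coords A e p.1 p.2)
  invFun q := ⟨q.1, if h : q.1 ∈ e.source then Tan.ofCoords A e q.1 h q.2 else 0⟩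
  source := TotalSpace.proj ⁻¹' e.source
  target := e.source ×ˢ univ
  map_source' p hp := ⟨hp, mem_univ _⟩
  map_target' q hq := hq.1
  left_inv' := by
    rintro ⟨a, u⟩ (ha : a ∈ e.source)
    dsimp only
    rw [dif_pos ha]
    congr 1
    apply Tan.coords_injective A e ha
    rw [Tan.coords_ofCoords]
  right_inv' := by
    rintro ⟨a, c⟩ ⟨ha, -⟩
    dsimp only
    rw [dif_pos ha, Tan.coords_ofCoords]
  open_target := e.open_source.prod isOpen_univ
  baseSet := e.source
  open_baseSet := e.open_source
  source_eq := rfl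
  target_eq := rfl
  proj_toFun _ _ := rfl

theorem Tan.pretriv_symm {a : TotalSpace F E} (ha : a ∈ e.source) (c : F × F) :
    (Tan.pretriv A e).symm a c = Tan.ofCoords A e a ha c := by
  apply Tan.coords_injective A e ha
  rw [Tan.coords_ofCoords]
  exact congrArg Prod.snd ((Tan.pretriv A e).apply_mk_symm (b := a) ha c)

instance : (Tan.pretriv A e).IsLinear ℝ where
  linear a _ := (Tan.coords A e a).isLinear

variable [FiniteDimensional ℝ B] [FiniteDimensional ℝ F]

theorem Tan.contMDiffOn_coords_ofCoords (e' : Trivialization F (π F E))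
    [MemTrivializationAtlas e'] (c : F × F) :
    ContMDiffOn (𝓘(ℝ, B).prod 𝓘(ℝ, F)) 𝓘(ℝ, F × F) ∞
      (fun a => ((e' ⟨a.proj, e.symm a.proj c.1⟩).2,
        dirDeriv (𝓘(ℝ, B).prod 𝓘(ℝ, F)) (fibCoord e') a (liftVec A e a c)))
      (e.source ∩ e'.source) := by
  have hx : ContMDiffOn (𝓘(ℝ, B).prod 𝓘(ℝ, F)) 𝓘(ℝ, B) ∞
      (TotalSpace.proj : TotalSpace F E → M) (e.source ∩ e'.source) :=
    Bundle.contMDiffOn_proj (n := ∞) E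
  have hsec : ContMDiffOn (𝓘(ℝ, B).prod 𝓘(ℝ, F)) (𝓘(ℝ, B).prod 𝓘(ℝ, F)) ∞
      (fun a : TotalSpace F E => (⟨a.proj, e.symm a.proj c.1⟩ : TotalSpace F E))
      (e.source ∩ e'.source) := by
    have h : ContMDiffOn (𝓘(ℝ, B).prod 𝓘(ℝ, F)) (𝓘(ℝ, B).prod 𝓘(ℝ, F)) ∞
        (fun a : TotalSpace F E => e.toOpenPartialHomeomorph.symm (a.proj, c.1))
        (e.source ∩ e'.source) :=
      (e.contMDiffOn_symm (n := ∞) (IB := 𝓘(ℝ, B))).comp (hx.prodMk contMDiffOn_const)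
        fun a ha => e.mem_target.2 (e.mem_source.1 ha.1)
    exact h.congr fun a ha => e.mk_symm (e.mem_source.1 ha.1) c.1
  have hfst : ContMDiffOn (𝓘(ℝ, B).prod 𝓘(ℝ, F)) 𝓘(ℝ, F) ∞
      (fun a : TotalSpace F E => (e' ⟨a.proj, e.symm a.proj c.1⟩).2) (e.source ∩ e'.source) :=
    (contMDiffOn_fibCoord (B := B) e').comp hsec
      fun a ha => e'.mem_source.2 (show a.proj ∈ e'.baseSet from e'.mem_source.1 ha.2)
  have hS1 : ContMDiffOn (𝓘(ℝ, B).prod 𝓘(ℝ, F)) 𝓘(ℝ, B).tangent ∞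
      (fun a : TotalSpace F E => (⟨a.proj, A.anchor a.proj (e.symm a.proj c.1)⟩ :
        TangentBundle 𝓘(ℝ, B) M)) (e.source ∩ e'.source) :=
    A.contMDiff_anchor.comp_contMDiffOn hsec
  have hS2 : ContMDiffOn (𝓘(ℝ, B).prod 𝓘(ℝ, F)) 𝓘(ℝ, F).tangent ∞
      (fun a : TotalSpace F E => (⟨fibCoord e a, c.2⟩ : TangentBundle 𝓘(ℝ, F) F))
      (e.source ∩ e'.source) :=
    ((contMDiff_vectorSpace_iff_contDiff (V := fun _ : F => c.2)).2
      contDiff_const).comp_contMDiffOn ((contMDiffOn_fibCoord (B := B) e).mono inter_subset_left)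
  have hS := (contMDiff_equivTangentBundleProd_symm (n := ∞) (I := 𝓘(ℝ, B)) (M := M)
    (I' := 𝓘(ℝ, F)) (M' := F)).comp_contMDiffOn (hS1.prodMk hS2)
  have hV := ((e.contMDiffOn_symm (n := ∞) (IB := 𝓘(ℝ, B))).contMDiffOn_tangentMapWithin
    (m := ∞) (by simp) e.open_target.uniqueMDiffOn).comp hS ?_
  have hT := ((contMDiffOn_fibCoord (B := B) e').contMDiffOn_tangentMapWithin
    (m := ∞) (by simp) e'.open_source.uniqueMDiffOn).comp hV ?_
  have hsnd := (contMDiff_snd_tangentBundle_modelSpace F 𝓘(ℝ, F) (n := ∞)).comp_contMDiffOn hT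
  · refine hfst.prodMk_space (hsnd.congr fun a ha => ?_)
    have hea : e a = (a.proj, fibCoord e a) := (e.mk_proj_snd ha.1).symm
    have h1 : mfderivWithin (𝓘(ℝ, B).prod 𝓘(ℝ, F)) (𝓘(ℝ, B).prod 𝓘(ℝ, F))
        e.toOpenPartialHomeomorph.symm e.target (e a) =
        mfderiv (𝓘(ℝ, B).prod 𝓘(ℝ, F)) (𝓘(ℝ, B).prod 𝓘(ℝ, F))
          e.toOpenPartialHomeomorph.symm (e a) :=
      mfderivWithin_of_isOpen e.open_target (e.map_source ha.1)
    have key : ∀ (q : M × F) (a' : TotalSpace F E), q = e a → a' = a → ∀ v : B × F,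
        (mfderivWithin (𝓘(ℝ, B).prod 𝓘(ℝ, F)) 𝓘(ℝ, F) (fibCoord e') e'.source a'
          (mfderivWithin (𝓘(ℝ, B).prod 𝓘(ℝ, F)) (𝓘(ℝ, B).prod 𝓘(ℝ, F))
            e.toOpenPartialHomeomorph.symm e.target q v : B × F) : F) =
        (mfderiv (𝓘(ℝ, B).prod 𝓘(ℝ, F)) 𝓘(ℝ, F) (fibCoord e') a
          (mfderiv (𝓘(ℝ, B).prod 𝓘(ℝ, F)) (𝓘(ℝ, B).prod 𝓘(ℝ, F))
            e.toOpenPartialHomeomorph.symm (e a) v : B × F) : F) := by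
      rintro _ _ rfl rfl v
      rw [h1, mfderivWithin_of_isOpen e'.open_source ha.2]
    refine (key (a.proj, fibCoord e a) (e.toOpenPartialHomeomorph.symm (a.proj, fibCoord e a))
      hea.symm ?_ ((A.anchor a.proj (e.symm a.proj c.1), c.2) : B × F)).symm
    rw [← hea]
    exact e.symm_apply_apply ha.1
  · intro a ha
    change e.toOpenPartialHomeomorph.symm (a.proj, fibCoord e a) ∈ e'.source
    rw [e'.mem_source, e.proj_symm_apply (e.mem_target.2 (e.mem_source.1 ha.1))]
    exact e'.mem_source.1 ha.2
  · intro a ha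
    change (a.proj, fibCoord e a) ∈ e.target
    exact e.mem_target.2 (e.mem_source.1 ha.1)

/-- The change of coordinates between two of these trivializations. -/
noncomputable def Tan.coordChange (e' : Trivialization F (π F E)) [MemTrivializationAtlas e']
    (a : TotalSpace F E) : F × F →L[ℝ] F × F :=
  LinearMap.toContinuousLinearMap
    ((Tan.coords A e' a).comp ((Tan.pretriv A e).symmₗ ℝ a))

theorem Tan.coordChange_apply (e' : Trivialization F (π F E)) [MemTrivializationAtlas e']
    {a : TotalSpace F E} (ha : a ∈ e.source) (c : F × F) :
    Tan.coordChange A e e' a c = Tan.coords A e' a (Tan.ofCoords A e a ha c) := by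
  rw [← Tan.pretriv_symm, ← Pretrivialization.symmₗ_apply (R := ℝ) _ ha]
  rfl

/-- A family of linear maps is smooth as soon as it is pointwise smooth. -/
theorem contMDiffOn_clm_of_apply {E₁ H₁ N G : Type*} [NormedAddCommGroup E₁] [NormedSpace ℝ E₁]
    [TopologicalSpace H₁] [TopologicalSpace N] [ChartedSpace H₁ N]
    {I : ModelWithCorners ℝ E₁ H₁} [NormedAddCommGroup G] [NormedSpace ℝ G]
    [FiniteDimensional ℝ G] {φ : N → G →L[ℝ] G} {s : Set N}
    (h : ∀ c, ContMDiffOn I 𝓘(ℝ, G) ∞ (fun a => φ a c) s) :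
    ContMDiffOn I 𝓘(ℝ, G →L[ℝ] G) ∞ φ s := by
  let b := Module.finBasis ℝ G
  have h1 : φ = fun a => ∑ i, (ContinuousLinearMap.smulRightL ℝ G G
      (LinearMap.toContinuousLinearMap (b.coord i))) (φ a (b i)) := by
    funext a
    ext c
    conv_lhs => rw [← b.sum_repr c, map_sum]
    simp
  rw [h1]
  refine contMDiffOn_finsetSum fun i _ => ?_
  exact (ContinuousLinearMap.contMDiff _).comp_contMDiffOn (h (b i))

theorem Tan.contMDiffOn_coordChange (e' : Trivialization F (π F E)) [MemTrivializationAtlas e'] :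
    ContMDiffOn (𝓘(ℝ, B).prod 𝓘(ℝ, F)) 𝓘(ℝ, F × F →L[ℝ] F × F) ∞
      (Tan.coordChange A e e') (e.source ∩ e'.source) := by
  refine contMDiffOn_clm_of_apply fun c => ?_
  refine (Tan.contMDiffOn_coords_ofCoords A e e' c).congr fun a ha => ?_
  rw [Tan.coordChange_apply A e e' ha.1]
  refine Prod.ext ?_ rfl
  rw [Tan.coords_fst, Trivialization.coe_linearMapAt_of_mem _ (e'.mem_source.1 ha.2)]
  rfl

theorem Tan.isInducing [∀ x, IsTopologicalAddGroup (E x)] [∀ x, ContinuousSMul ℝ (E x)]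
    {a : TotalSpace F E} (ha : a ∈ e.source) :
    Topology.IsInducing (Tan.coords A e a) := by
  have hb : a.proj ∈ e.baseSet := e.mem_source.1 ha
  have h1 : Continuous (Tan.coords A e a) := by
    refine Continuous.prodMk ?_ ?_
    · exact (e.continuousLinearMapAt ℝ a.proj).continuous.comp
        (continuous_fst.comp continuous_subtype_val)
    · exact (mfderiv (𝓘(ℝ, B).prod 𝓘(ℝ, F)) 𝓘(ℝ, F) (fibCoord e) a).continuous.comp
        (continuous_snd.comp continuous_subtype_val)
  let L : (F × F) ≃ₗ[ℝ] A.Tan a := (LinearEquiv.ofBijective (Tan.coords A e a)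
    ⟨Tan.coords_injective A e ha, fun c => ⟨_, Tan.coords_ofCoords A e a ha c⟩⟩).symm
  have h2 : Continuous L := L.toLinearMap.continuous_of_finiteDimensional
  exact (Homeomorph.mk L.toEquiv.symm h1 h2).isInducing

section bundle

variable [∀ x, IsTopologicalAddGroup (E x)] [∀ x, ContinuousSMul ℝ (E x)]

/-- The local trivializations of `𝒯^{τ_E} E` induced by those of `E` make it a vector bundle. -/
noncomputable def Tan.vectorPrebundle : VectorPrebundle ℝ (F × F) A.Tan where
  pretrivializationAtlas :=
    {e₁ | ∃ (e : Trivialization F (π F E)) (_ : MemTrivializationAtlas e), e₁ = Tan.pretriv A e}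
  pretrivialization_linear' := by
    rintro _ ⟨e, he, rfl⟩
    infer_instance
  pretrivializationAt a := Tan.pretriv A (trivializationAt F E a.proj)
  mem_base_pretrivializationAt a := FiberBundle.mem_trivializationAt_proj_source
  pretrivialization_mem_atlas a := ⟨trivializationAt F E a.proj, inferInstance, rfl⟩
  exists_coordChange := by
    rintro _ ⟨e, he, rfl⟩ _ ⟨e', he', rfl⟩
    refine ⟨Tan.coordChange A e e', (Tan.contMDiffOn_coordChange A e e').continuousOn, ?_⟩
    rintro a ⟨ha, -⟩ c
    rw [Tan.coordChange_apply A e e' ha, Tan.pretriv_symm A e ha]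
    rfl
  totalSpaceMk_isInducing a :=
    Topology.isInducing_const_prod.mpr (Tan.isInducing A _ FiberBundle.mem_trivializationAt_proj_source)

instance : (Tan.vectorPrebundle A).IsContMDiff (𝓘(ℝ, B).prod 𝓘(ℝ, F)) ∞ where
  exists_contMDiffCoordChange := by
    rintro _ ⟨e, he, rfl⟩ _ ⟨e', he', rfl⟩
    refine ⟨Tan.coordChange A e e', Tan.contMDiffOn_coordChange A e e', ?_⟩
    rintro a ⟨ha, -⟩ c
    rw [Tan.coordChange_apply A e e' ha, Tan.pretriv_symm A e ha]
    rfl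

noncomputable instance : TopologicalSpace (TotalSpace (F × F) A.Tan) :=
  (Tan.vectorPrebundle A).totalSpaceTopology

noncomputable instance : FiberBundle (F × F) A.Tan := (Tan.vectorPrebundle A).toFiberBundle

instance : VectorBundle ℝ (F × F) A.Tan := (Tan.vectorPrebundle A).toVectorBundle

instance : ContMDiffVectorBundle ∞ (F × F) A.Tan (𝓘(ℝ, B).prod 𝓘(ℝ, F)) :=
  (Tan.vectorPrebundle A).contMDiffVectorBundle (𝓘(ℝ, B).prod 𝓘(ℝ, F))

end bundle

end

end LieAlgebroid

/-! ## The canonical symplectic section and the Pontryagin bundle of an algebroid -/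

namespace AlgebroidData

section Dual

variable {EN HN N : Type*} [NormedAddCommGroup EN] [NormedSpace ℝ EN]
  [TopologicalSpace HN] [TopologicalSpace N] [ChartedSpace HN N] {I : ModelWithCorners ℝ EN HN}
  [IsManifold I ∞ N]
  (F : Type*) [NormedAddCommGroup F] [NormedSpace ℝ F]
  (A : N → Type*) [∀ x, AddCommGroup (A x)] [∀ x, Module ℝ (A x)]
  [TopologicalSpace (TotalSpace F A)] [∀ x, TopologicalSpace (A x)]
  [FiberBundle F A] [VectorBundle ℝ F A] [ContMDiffVectorBundle ∞ F A I]

/-- The fibres of the dual bundle `A^*`. -/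
abbrev DualFiber (x : N) : Type _ := A x →L[ℝ] Bundle.Trivial N ℝ x

/-- The total space of the dual bundle `A^*`. -/
abbrev Dual : Type _ := TotalSpace (F →L[ℝ] ℝ) (DualFiber A)

/-- The total space of `A ×_N A^*`. -/
abbrev Pontryagin : Type _ :=
  TotalSpace (F × (F →L[ℝ] ℝ)) (fun x => A x × DualFiber A x)

variable {F A}

/-- The projection `pr₁ : A ×_N A^* → A`. -/
def pr₁ (w : Pontryagin F A) : TotalSpace F A := ⟨w.proj, w.2.1⟩

/-- The projection `pr₂ : A ×_N A^* → A^*`. -/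
def pr₂ (w : Pontryagin F A) : Dual F A := ⟨w.proj, w.2.2⟩

variable (F A) (I)

/-- The model with corners of the total space of `A^*`. -/
noncomputable abbrev dualModel :
    ModelWithCorners ℝ (EN × (F →L[ℝ] ℝ)) (ModelProd HN (F →L[ℝ] ℝ)) :=
  I.prod 𝓘(ℝ, F →L[ℝ] ℝ)

/-- The model with corners of the total space of `A ×_N A^*`. -/
noncomputable abbrev pontryaginModel :
    ModelWithCorners ℝ (EN × (F × (F →L[ℝ] ℝ))) (ModelProd HN (F × (F →L[ℝ] ℝ))) :=
  I.prod 𝓘(ℝ, F × (F →L[ℝ] ℝ))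

theorem contMDiff_pr₂ :
    ContMDiff (pontryaginModel I F) (dualModel I F) ∞ (pr₂ : Pontryagin F A → Dual F A) := by
  intro w
  have hid : ContMDiffAt (pontryaginModel I F) (pontryaginModel I F) ∞
    (id : Pontryagin F A → Pontryagin F A) w := contMDiffAt_id
  rw [contMDiffAt_totalSpace] at hid
  rw [contMDiffAt_totalSpace]
  refine ⟨hid.1, ?_⟩
  exact (ContinuousLinearMap.snd ℝ F (F →L[ℝ] ℝ)).contMDiff.contMDiffAt.comp w hid.2

variable {I} (D : AlgebroidData I A)

/-- The fibre at `μ ∈ A^*` of the prolongation `𝒯^{π} A` of `A` over the projection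
`π : A^* → N` of the dual bundle. -/
noncomputable abbrev dualProl (μ : Dual F A) :=
  D.prolFiber (dualModel I F) (TotalSpace.proj : Dual F A → N) μ

/-- The fibre at `w ∈ A ×_N A^*` of the prolongation `𝒯^ν A` of `A` over the projection
`ν : A ×_N A^* → N`. -/
noncomputable abbrev pontryaginProl (w : Pontryagin F A) :=
  D.prolFiber (pontryaginModel I F) (TotalSpace.proj : Pontryagin F A → N) w

/-- The Liouville section `λ` of `(𝒯^{π} A)^*`: `λ(μ)(a, v) = ⟨μ, a⟩`. -/
noncomputable def liouville (μ : Dual F A) (u : D.dualProl F A μ) : ℝ := μ.2 u.1.1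

/-- The canonical symplectic section `Ω_A = -dλ` of `𝒯^{π} A`. -/
noncomputable def canonicalSection (μ : Dual F A) (u v : D.dualProl F A μ) : ℝ :=
  -D.d₁At F (J := dualModel I F) (D.liouville F A) μ u v

/-- The map `𝒯pr₂ = (Id, T pr₂) : 𝒯^ν A → 𝒯^{π} A`, `(a, v) ↦ (a, T pr₂ (v))`. -/
noncomputable def prolPr₂ (w : Pontryagin F A) (u : D.pontryaginProl F A w) :
    D.dualProl F A (pr₂ w) :=
  ⟨(u.1.1, mfderiv (pontryaginModel I F) (dualModel I F)
      (pr₂ : Pontryagin F A → Dual F A) w u.1.2), by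
    have h1 : MDifferentiableAt (pontryaginModel I F) (dualModel I F)
        (pr₂ : Pontryagin F A → Dual F A) w :=
      (contMDiff_pr₂ I F A).mdifferentiable (by simp) w
    have h2 : MDifferentiableAt (dualModel I F) I (TotalSpace.proj : Dual F A → N) (pr₂ w) :=
      (Bundle.contMDiff_proj (n := ∞) (DualFiber A)).mdifferentiable (by simp) _
    have h3 := mfderiv_comp w h2 h1
    rw [mem_prolFiber]
    exact u.2.trans (congrArg (fun l => l u.1.2) h3)⟩

/-- The pullback `(𝒯pr₂)^* Ω_A` of the canonical symplectic section to `𝒯^ν A`. -/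
noncomputable def pontryaginSection (w : Pontryagin F A) (u v : D.pontryaginProl F A w) : ℝ :=
  D.canonicalSection F A (pr₂ w) (D.prolPr₂ F A w u) (D.prolPr₂ F A w v)

end Dual

end AlgebroidData

/-! ## The second-order problem -/

namespace LieAlgebroid

section Vertical

variable {B F M : Type*} {E : M → Type*}
  [NormedAddCommGroup B] [NormedSpace ℝ B] [NormedAddCommGroup F] [NormedSpace ℝ F]
  [TopologicalSpace M] [ChartedSpace B M] [IsManifold 𝓘(ℝ, B) ∞ M]
  [TopologicalSpace (TotalSpace F E)] [∀ x, TopologicalSpace (E x)]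
  [∀ x, AddCommGroup (E x)] [∀ x, Module ℝ (E x)] [FiberBundle F E] [VectorBundle ℝ F E]
  [ContMDiffVectorBundle ∞ F E 𝓘(ℝ, B)]

/-- The vertical lift `b^v = d/dt|_{t = 0} (e + t b) ∈ T_e E` of `b` at `e`. -/
noncomputable def verticalLift (e : TotalSpace F E) (b : E e.proj) :
    TangentSpace (𝓘(ℝ, B).prod 𝓘(ℝ, F)) e :=
  (mfderiv 𝓘(ℝ, ℝ) (𝓘(ℝ, B).prod 𝓘(ℝ, F))
    (fun t : ℝ => (⟨e.proj, e.2 + t • b⟩ : TotalSpace F E)) 0 (1 : ℝ) : B × F)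

theorem mfderiv_proj_verticalLift (e : TotalSpace F E) (b : E e.proj) :
    (mfderiv (𝓘(ℝ, B).prod 𝓘(ℝ, F)) 𝓘(ℝ, B) (TotalSpace.proj : TotalSpace F E → M) e
      (verticalLift e b) : B) = 0 := by
  by_cases h : MDifferentiableAt 𝓘(ℝ, ℝ) (𝓘(ℝ, B).prod 𝓘(ℝ, F))
      (fun t : ℝ => (⟨e.proj, e.2 + t • b⟩ : TotalSpace F E)) 0
  · have h2 : MDifferentiableAt (𝓘(ℝ, B).prod 𝓘(ℝ, F)) 𝓘(ℝ, B)
        (TotalSpace.proj : TotalSpace F E → M)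
        ((fun t : ℝ => (⟨e.proj, e.2 + t • b⟩ : TotalSpace F E)) 0) :=
      (Bundle.contMDiff_proj (n := ∞) E).mdifferentiable (by simp) _
    have h3 := mfderiv_comp (0 : ℝ) h2 h
    have h4 : (TotalSpace.proj : TotalSpace F E → M) ∘
        (fun t : ℝ => (⟨e.proj, e.2 + t • b⟩ : TotalSpace F E)) = fun _ => e.proj := rfl
    rw [h4, mfderiv_const] at h3
    have h5 : (⟨e.proj, e.2 + (0 : ℝ) • b⟩ : TotalSpace F E) = e := by simp
    have h6 := congrArg (fun l => l (1 : ℝ)) h3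
    have key : ∀ a : TotalSpace F E, a = e → ∀ v : B × F,
        (mfderiv (𝓘(ℝ, B).prod 𝓘(ℝ, F)) 𝓘(ℝ, B) (TotalSpace.proj : TotalSpace F E → M) a v : B) =
        mfderiv (𝓘(ℝ, B).prod 𝓘(ℝ, F)) 𝓘(ℝ, B) (TotalSpace.proj : TotalSpace F E → M) e v := by
      rintro _ rfl v
      rfl
    exact (key _ h5 _).symm.trans h6.symm
  · rw [verticalLift, mfderiv_zero_of_not_mdifferentiableAt h]
    exact map_zero _

end Vertical

section SecondOrder

variable {B F M : Type*} {E : M → Type*}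
  [NormedAddCommGroup B] [NormedSpace ℝ B] [NormedAddCommGroup F] [NormedSpace ℝ F]
  [TopologicalSpace M] [ChartedSpace B M] [IsManifold 𝓘(ℝ, B) ∞ M]
  [TopologicalSpace (TotalSpace F E)] [∀ x, TopologicalSpace (E x)]
  [∀ x, AddCommGroup (E x)] [∀ x, Module ℝ (E x)] [FiberBundle F E] [VectorBundle ℝ F E]
  [ContMDiffVectorBundle ∞ F E 𝓘(ℝ, B)] [FiniteDimensional ℝ B] [FiniteDimensional ℝ F]
  [∀ x, IsTopologicalAddGroup (E x)] [∀ x, ContinuousSMul ℝ (E x)]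
  (A : LieAlgebroid B F E)

/-- The Lie algebroid `𝒯^{τ_E} E → E`. -/
noncomputable def tanData : AlgebroidData (𝓘(ℝ, B).prod 𝓘(ℝ, F)) A.Tan :=
  A.toData.prolongation (𝓘(ℝ, B).prod 𝓘(ℝ, F)) (TotalSpace.proj : TotalSpace F E → M) F

/-- The total space of `𝒯^{τ_E} E`. -/
abbrev TanTotal : Type _ := TotalSpace (F × F) A.Tan

/-- The submanifold `E^{(2)} ⊆ 𝒯^{τ_E} E` of admissible elements: those `(b, v)` at `e ∈ E` with
`b = e`. -/
def E2 : Set A.TanTotal := {p | p.2.1.1 = p.1.2}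

/-- The vertical element `(0, b^v)` of `𝒯^{τ_E} E` at `e`. -/
noncomputable def vert (e : TotalSpace F E) (b : E e.proj) : A.Tan e :=
  ⟨(0, verticalLift e b), by
    rw [AlgebroidData.mem_prolFiber, map_zero]
    exact (mfderiv_proj_verticalLift e b).symm⟩

/-- The Pontryagin bundle `𝒯^{τ_E} E ×_E (𝒯^{τ_E} E)^*` of the Lie algebroid `𝒯^{τ_E} E`. -/
abbrev Pont : Type _ := AlgebroidData.Pontryagin (F × F) A.Tan

/-- `W₀ = E^{(2)} ×_E (𝒯^{τ_E} E)^*`. -/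
def W0 : Set A.Pont := AlgebroidData.pr₁ ⁻¹' A.E2

/-- The derivative of `L` at `p ∈ 𝒯^{τ_E} E` along the fibre, in the direction `(0, b^v)`. These
directions are tangent to the fibres of `E^{(2)} → E`, so for `p ∈ E^{(2)}` only the values of `L` on
`E^{(2)}` are used. In local coordinates it is `b^A ∂L/∂z^A`. -/
noncomputable def dz (L : A.TanTotal → ℝ) (p : A.TanTotal) (b : E p.proj.proj) : ℝ :=
  deriv (fun t : ℝ => L ⟨p.proj, p.2 + t • A.vert p.proj b⟩) 0

/-- The second derivative of `L` at `p` along the fibre, in the directions `(0, b^v)` and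
`(0, b'^v)`. In local coordinates it is `b^A b'^B ∂²L/∂z^A∂z^B`. -/
noncomputable def hess (L : A.TanTotal → ℝ) (p : A.TanTotal) (b b' : E p.proj.proj) : ℝ :=
  deriv (fun t : ℝ => A.dz L ⟨p.proj, p.2 + t • A.vert p.proj b⟩ b') 0

/-- The first constraint submanifold `W₁ ⊆ W₀`: the points `(p, α)` at which
`⟨α, (0, b^v)⟩` is the derivative of `L` in the direction `(0, b^v)`, for all `b`; in local
coordinates, `p̄_A = ∂L/∂z^A`. -/
def W1 (L : A.TanTotal → ℝ) : Set A.Pont :=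
  {w | w ∈ A.W0 ∧ ∀ b, w.2.2 (A.vert w.proj b) = A.dz L (AlgebroidData.pr₁ w) b}

/-- `(𝒯pr₂)^* Ω`, where `Ω` is the canonical symplectic section associated with the Lie algebroid
`𝒯^{τ_E} E`. Its pullback to `W₀` is `Ω₀`. -/
noncomputable def Omega (w : A.Pont) (u v : A.tanData.pontryaginProl (F × F) A.Tan w) : ℝ :=
  A.tanData.pontryaginSection (F × F) A.Tan w u v

end SecondOrder

end LieAlgebroid

/-! Use local coordinates (x, y; z, v; p, p̄) on the Pontryagin bundle of 𝒯E: (x, y) on E, (z, v)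
along the fibres of 𝒯E, (p, p̄) along those of its dual. The equation of E^(2) is z = y, so L
becomes a function of (x, y, v); here v plays the role of the z^A of the statement. The submanifold
W₁ is then the graph z = y, p̄ = ∂L/∂v (`mem_W1_iff`), with x, y, v, p free.

Smoothness and closedness hold for every L. The pullback of Ω = -dλ to the whole Pontryagin bundle
is -dθ, with θ(p, α)(a, U) = ⟨α, a⟩, and its differential vanishes by d² = 0 already before
restriction to W₁. Being symplectic on W₁ therefore means having no kernel
(`isSymplecticOn_pontryagin_iff`). The identity d² = 0 rests on the Jacobi identity and on the
compatibility of anchor and bracket in 𝒯^ν 𝒯E, a prolongation of a prolongation. For this reason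
`IsLie` records the algebroid laws for local sections: `isLie_toData` deduces them from the global
axioms by bump functions, and `IsLie.prolongation` passes them to a prolongation, where the bracket
is computed with structure functions in a local frame.

Nondegeneracy is linear algebra. By `pontryaginSection_apply`, Ω((a, U), (a', U')) = δ'(a) - δ(a') +
⟨α, C(a, a')⟩, where δ, δ' are the derivatives of (p, p̄) along U, U' and C is the bracket of frame
sections. Tangency to W₁ says that δz is the second component of a and that δp̄ is the derivative of
∂L/∂v along (ρ(a), δv); a, δv and δp are arbitrary (`exists_mem_constraintFiber`). When a = 0 this
reduces to δz = 0 and δp̄ = H δv, with H the fibre Hessian. If H δv = 0, the element with a = 0, δp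
= 0 and this δv lies in the kernel. Conversely, let H be nondegenerate and (a, U) in the kernel.
Pairing with the elements having a' = 0 gives δp'(a₁) + H(δv', a₂) = 0 for all δp', δv', so a = 0;
pairing with arbitrary a' then gives δ = 0, hence H δv = 0 and δv = 0. This is `kernel_Omega_iff`;
the determinant is that of H in the given basis.

Smoothness is required throughout on a neighbourhood. At order ∞, smoothness at a single point only
provides C^n neighbourhoods depending on n, whereas the iterated derivatives below need smoothness
at all nearby points. -/

/-! ## Maps which are smooth near a point -/

/-- The map `f` is smooth on a neighbourhood of `x`. -/
def ContMDiffNear {E H M E' H' M' : Type*} [NormedAddCommGroup E] [NormedSpace ℝ E]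
    [TopologicalSpace H] [TopologicalSpace M] [ChartedSpace H M]
    [NormedAddCommGroup E'] [NormedSpace ℝ E'] [TopologicalSpace H'] [TopologicalSpace M']
    [ChartedSpace H' M'] (I : ModelWithCorners ℝ E H) (I' : ModelWithCorners ℝ E' H')
    (f : M → M') (x : M) : Prop :=
  ∀ᶠ y in 𝓝 x, ContMDiffAt I I' ∞ f y

namespace ContMDiffNear

variable {E H M E' H' M' E'' H'' M'' G : Type*} [NormedAddCommGroup E] [NormedSpace ℝ E]
  [TopologicalSpace H] [TopologicalSpace M] [ChartedSpace H M]
  [NormedAddCommGroup E'] [NormedSpace ℝ E'] [TopologicalSpace H'] [TopologicalSpace M']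
  [ChartedSpace H' M']
  [NormedAddCommGroup E''] [NormedSpace ℝ E''] [TopologicalSpace H''] [TopologicalSpace M'']
  [ChartedSpace H'' M''] [NormedAddCommGroup G] [NormedSpace ℝ G]
  {I : ModelWithCorners ℝ E H} {I' : ModelWithCorners ℝ E' H'} {I'' : ModelWithCorners ℝ E'' H''}
  {f f₁ : M → M'} {x : M} {g g' : M → G}

theorem contMDiffAt (h : ContMDiffNear I I' f x) : ContMDiffAt I I' ∞ f x := h.self_of_nhds

theorem continuousAt (h : ContMDiffNear I I' f x) : ContinuousAt f x := h.contMDiffAt.continuousAt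

theorem mdifferentiableAt (h : ContMDiffNear I I' f x) : MDifferentiableAt I I' f x :=
  h.contMDiffAt.mdifferentiableAt (by simp)

theorem eventually (h : ContMDiffNear I I' f x) : ∀ᶠ y in 𝓝 x, ContMDiffNear I I' f y :=
  eventually_eventually_nhds.2 h

theorem congr (h : ContMDiffNear I I' f x) (hf : f₁ =ᶠ[𝓝 x] f) : ContMDiffNear I I' f₁ x := by
  filter_upwards [h, eventually_eventually_nhds.2 hf] with y hy hy'
  exact hy.congr_of_eventuallyEq hy'

theorem comp {k : M' → M''} (hk : ContMDiffNear I' I'' k (f x)) (hf : ContMDiffNear I I' f x) :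
    ContMDiffNear I I'' (fun y => k (f y)) x := by
  filter_upwards [hf, hf.continuousAt.eventually hk] with y hy hy'
  exact hy'.comp y hy

theorem of_contMDiff (h : ContMDiff I I' ∞ f) : ContMDiffNear I I' f x := .of_forall h

theorem of_contMDiffOn {s : Set M} (h : ContMDiffOn I I' ∞ f s) (hs : IsOpen s) (hx : x ∈ s) :
    ContMDiffNear I I' f x := by
  filter_upwards [hs.mem_nhds hx] with y hy
  exact h.contMDiffAt (hs.mem_nhds hy)

theorem exists_open (h : ContMDiffNear I I' f x) :
    ∃ s : Set M, IsOpen s ∧ x ∈ s ∧ ContMDiffOn I I' ∞ f s := by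
  obtain ⟨s, hs, hso, hxs⟩ := eventually_nhds_iff.1 h
  exact ⟨s, hso, hxs, fun y hy => (hs y hy).contMDiffWithinAt⟩

theorem const (c : M') : ContMDiffNear I I' (fun _ : M => c) x := of_contMDiff contMDiff_const

theorem prodMk {k : M → M''} (hf : ContMDiffNear I I' f x) (hk : ContMDiffNear I I'' k x) :
    ContMDiffNear I (I'.prod I'') (fun y => (f y, k y)) x := by
  filter_upwards [hf, hk] with y h h'
  exact h.prodMk h'

theorem prodMk_space {G' : Type*} [NormedAddCommGroup G'] [NormedSpace ℝ G'] {k : M → G'}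
    (hg : ContMDiffNear I 𝓘(ℝ, G) g x) (hk : ContMDiffNear I 𝓘(ℝ, G') k x) :
    ContMDiffNear I 𝓘(ℝ, G × G') (fun y => (g y, k y)) x := by
  filter_upwards [hg, hk] with y h h'
  exact h.prodMk_space h'

theorem add (hg : ContMDiffNear I 𝓘(ℝ, G) g x) (hg' : ContMDiffNear I 𝓘(ℝ, G) g' x) :
    ContMDiffNear I 𝓘(ℝ, G) (fun y => g y + g' y) x := by
  filter_upwards [hg, hg'] with y h h'
  exact h.add h'

theorem neg (hg : ContMDiffNear I 𝓘(ℝ, G) g x) :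
    ContMDiffNear I 𝓘(ℝ, G) (fun y => - g y) x := by
  filter_upwards [hg] with y h
  exact h.neg

theorem sub (hg : ContMDiffNear I 𝓘(ℝ, G) g x) (hg' : ContMDiffNear I 𝓘(ℝ, G) g' x) :
    ContMDiffNear I 𝓘(ℝ, G) (fun y => g y - g' y) x := by
  filter_upwards [hg, hg'] with y h h'
  exact h.sub h'

theorem smul {a : M → ℝ} (ha : ContMDiffNear I 𝓘(ℝ, ℝ) a x) (hg : ContMDiffNear I 𝓘(ℝ, G) g x) :
    ContMDiffNear I 𝓘(ℝ, G) (fun y => a y • g y) x := by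
  filter_upwards [ha, hg] with y h h'
  exact h.smul h'

theorem sum {ι : Type*} (s : Finset ι) {k : ι → M → G}
    (h : ∀ i ∈ s, ContMDiffNear I 𝓘(ℝ, G) (k i) x) :
    ContMDiffNear I 𝓘(ℝ, G) (fun y => ∑ i ∈ s, k i y) x := by
  filter_upwards [(Filter.eventually_all_finset s).2 h] with y hy
  exact contMDiffAt_finsetSum hy

theorem clm {G' : Type*} [NormedAddCommGroup G'] [NormedSpace ℝ G'] (l : G →L[ℝ] G')
    (hg : ContMDiffNear I 𝓘(ℝ, G) g x) : ContMDiffNear I 𝓘(ℝ, G') (fun y => l (g y)) x := by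
  filter_upwards [hg] with y h
  exact l.contMDiff.contMDiffAt.comp y h

/-- A family of linear maps on a finite-dimensional space which is pointwise smooth takes smooth
functions to smooth functions. -/
theorem apply_of_isLinearMap {F : Type*} [NormedAddCommGroup F] [NormedSpace ℝ F]
    [FiniteDimensional ℝ F] {K : M → F → G} {b : M → F} (hK : ∀ᶠ y in 𝓝 x, IsLinearMap ℝ (K y))
    (hK' : ∀ c, ContMDiffNear I 𝓘(ℝ, G) (fun y => K y c) x) (hb : ContMDiffNear I 𝓘(ℝ, F) b x) :
    ContMDiffNear I 𝓘(ℝ, G) (fun y => K y (b y)) x := by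
  -- Linearity of `K y` is only known near `x`, and no continuity in the operator norm is given; a
  -- basis reduces everything to the finitely many smooth functions `K y (B i)`.
  let B := Module.finBasis ℝ F
  have h : (fun y => K y (b y)) =ᶠ[𝓝 x]
      fun y => ∑ i, (LinearMap.toContinuousLinearMap (B.coord i)) (b y) • K y (B i) := by
    filter_upwards [hK] with y hy
    conv_lhs => rw [← B.sum_repr (b y)]
    have := map_sum hy.mk' (fun i => B.repr (b y) i • B i) Finset.univ
    simp only [IsLinearMap.mk'_apply] at this
    rw [this]
    simp [hy.map_smul]
  exact (sum _ fun i _ => (hb.clm _).smul (hK' _)).congr h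

end ContMDiffNear

/-! ## Directional derivatives -/

section DirDeriv

variable {EW HW W : Type*} [NormedAddCommGroup EW] [NormedSpace ℝ EW]
  [TopologicalSpace HW] [TopologicalSpace W] [ChartedSpace HW W] {J : ModelWithCorners ℝ EW HW}
  {EN HN N : Type*} [NormedAddCommGroup EN] [NormedSpace ℝ EN]
  [TopologicalSpace HN] [TopologicalSpace N] [ChartedSpace HN N] {I : ModelWithCorners ℝ EN HN}
  {G : Type*} [NormedAddCommGroup G] [NormedSpace ℝ G] {g g' : W → G} {w : W}

theorem dirDeriv_congr (h : g =ᶠ[𝓝 w] g') (v : TangentSpace J w) :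
    dirDeriv J g w v = dirDeriv J g' w v := by
  have h1 := Filter.EventuallyEq.mfderiv_eq (I := J) (I' := 𝓘(ℝ, G)) h
  exact congrArg (fun l : EW →L[ℝ] G => l v) h1

theorem dirDeriv_vadd (g : W → G) (u v : TangentSpace J w) :
    dirDeriv J g w (u + v) = dirDeriv J g w u + dirDeriv J g w v :=
  map_add (mfderiv J 𝓘(ℝ, G) g w) u v

theorem dirDeriv_vsmul (g : W → G) (c : ℝ) (v : TangentSpace J w) :
    dirDeriv J g w (c • v) = c • dirDeriv J g w v :=
  map_smul (mfderiv J 𝓘(ℝ, G) g w) c v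

theorem dirDeriv_vzero (g : W → G) : dirDeriv J g w (0 : TangentSpace J w) = 0 :=
  map_zero (mfderiv J 𝓘(ℝ, G) g w)

theorem dirDeriv_const (c : G) (v : TangentSpace J w) : dirDeriv J (fun _ => c) w v = 0 := by
  unfold dirDeriv
  rw [mfderiv_const]
  rfl

theorem dirDeriv_add (hg : MDifferentiableAt J 𝓘(ℝ, G) g w)
    (hg' : MDifferentiableAt J 𝓘(ℝ, G) g' w) (v : TangentSpace J w) :
    dirDeriv J (fun y => g y + g' y) w v = dirDeriv J g w v + dirDeriv J g' w v := by
  exact DFunLike.congr_fun (hg.hasMFDerivAt.add hg'.hasMFDerivAt).mfderiv v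

theorem dirDeriv_sub (hg : MDifferentiableAt J 𝓘(ℝ, G) g w)
    (hg' : MDifferentiableAt J 𝓘(ℝ, G) g' w) (v : TangentSpace J w) :
    dirDeriv J (fun y => g y - g' y) w v = dirDeriv J g w v - dirDeriv J g' w v := by
  exact DFunLike.congr_fun (hg.hasMFDerivAt.sub hg'.hasMFDerivAt).mfderiv v

theorem dirDeriv_comp {k : N → G} {f : W → N} (hk : MDifferentiableAt I 𝓘(ℝ, G) k (f w))
    (hf : MDifferentiableAt J I f w) (v : TangentSpace J w) :
    dirDeriv J (fun y => k (f y)) w v = dirDeriv I k (f w) (mfderiv J I f w v) :=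
  DFunLike.congr_fun (mfderiv_comp w hk hf) v

theorem dirDeriv_clm {G' : Type*} [NormedAddCommGroup G'] [NormedSpace ℝ G'] (l : G →L[ℝ] G')
    (hg : MDifferentiableAt J 𝓘(ℝ, G) g w) (v : TangentSpace J w) :
    dirDeriv J (fun y => l (g y)) w v = l (dirDeriv J g w v) := by
  refine (dirDeriv_comp (I := 𝓘(ℝ, G)) (k := l) l.mdifferentiableAt hg v).trans ?_
  unfold dirDeriv
  rw [l.mfderiv_eq]
  rfl

theorem dirDeriv_neg (hg : MDifferentiableAt J 𝓘(ℝ, G) g w) (v : TangentSpace J w) :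
    dirDeriv J (fun y => - g y) w v = - dirDeriv J g w v :=
  dirDeriv_clm (-ContinuousLinearMap.id ℝ G) hg v

theorem dirDeriv_smul {a : W → ℝ} (ha : MDifferentiableAt J 𝓘(ℝ, ℝ) a w)
    (hg : MDifferentiableAt J 𝓘(ℝ, G) g w) (v : TangentSpace J w) :
    dirDeriv J (fun y => a y • g y) w v = a w • dirDeriv J g w v + dirDeriv J a w v • g w := by
  let a' : EW →L[ℝ] ℝ := mfderiv J 𝓘(ℝ, ℝ) a w
  let g₁ : EW →L[ℝ] G := mfderiv J 𝓘(ℝ, G) g w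
  -- The derivative is identified in the chart at `w`, where the ordinary product rule for `smul`
  -- applies.
  have h : HasMFDerivAt J 𝓘(ℝ, G) (fun y => a y • g y) w
      (a w • g₁ + a'.smulRight (g w) : EW →L[ℝ] G) :=
    ⟨ha.continuousAt.smul hg.continuousAt, by
      have h1 : HasFDerivWithinAt (writtenInExtChartAt J 𝓘(ℝ, ℝ) w a)
        a' (range J) (extChartAt J w w) := ha.hasMFDerivAt.2
      have h2 : HasFDerivWithinAt (writtenInExtChartAt J 𝓘(ℝ, G) w g)
        g₁ (range J) (extChartAt J w w) := hg.hasMFDerivAt.2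
      have h3 := HasFDerivWithinAt.smul (𝕜' := ℝ) h1 h2
      simpa only [mfld_simps] using! h3⟩
  exact DFunLike.congr_fun h.mfderiv v

theorem dirDeriv_sum {ι : Type*} (s : Finset ι) {k : ι → W → G}
    (h : ∀ i ∈ s, ContMDiffNear J 𝓘(ℝ, G) (k i) w) (v : TangentSpace J w) :
    dirDeriv J (fun y => ∑ i ∈ s, k i y) w v = ∑ i ∈ s, dirDeriv J (k i) w v := by
  classical
  induction s using Finset.induction_on with
  | empty => simpa using dirDeriv_const (J := J) (0 : G) v
  | insert i s hi ih =>
    have h1 := h i (Finset.mem_insert_self i s)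
    have h2 : ∀ j ∈ s, ContMDiffNear J 𝓘(ℝ, G) (k j) w :=
      fun j hj => h j (Finset.mem_insert_of_mem hj)
    simp only [Finset.sum_insert hi]
    rw [dirDeriv_add h1.mdifferentiableAt (ContMDiffNear.sum s h2).mdifferentiableAt, ih h2]

/-- Product rule for a family of linear maps on a finite-dimensional space. -/
theorem dirDeriv_apply_of_isLinearMap {F : Type*} [NormedAddCommGroup F] [NormedSpace ℝ F]
    [FiniteDimensional ℝ F] {K : W → F → G} {b : W → F} (hK : ∀ᶠ y in 𝓝 w, IsLinearMap ℝ (K y))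
    (hK' : ∀ c, ContMDiffNear J 𝓘(ℝ, G) (fun y => K y c) w) (hb : ContMDiffNear J 𝓘(ℝ, F) b w)
    (v : TangentSpace J w) :
    dirDeriv J (fun y => K y (b y)) w v =
      dirDeriv J (fun y => K y (b w)) w v + K w (dirDeriv J b w v) := by
  let B := Module.finBasis ℝ F
  let l : ∀ i, F →L[ℝ] ℝ := fun i => LinearMap.toContinuousLinearMap (B.coord i)
  have h0 : ∀ y, IsLinearMap ℝ (K y) → ∀ c, K y c = ∑ i, l i c • K y (B i) := by
    intro y hy c
    conv_lhs => rw [← B.sum_repr c]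
    have := map_sum hy.mk' (fun i => B.repr c i • B i) Finset.univ
    simp only [IsLinearMap.mk'_apply] at this
    rw [this]
    simp [hy.map_smul, l]
  have h1 : (fun y => K y (b y)) =ᶠ[𝓝 w] fun y => ∑ i, l i (b y) • K y (B i) := by
    filter_upwards [hK] with y hy using h0 y hy _
  have h2 : (fun y => K y (b w)) =ᶠ[𝓝 w] fun y => ∑ i, l i (b w) • K y (B i) := by
    filter_upwards [hK] with y hy using h0 y hy _
  rw [dirDeriv_congr h1, dirDeriv_congr h2,
    dirDeriv_sum _ fun i _ => (hb.clm (l i)).smul (hK' (B i)),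
    dirDeriv_sum _ fun i _ => (ContMDiffNear.const (l i (b w))).smul (hK' (B i)),
    h0 w hK.self_of_nhds, ← Finset.sum_add_distrib]
  refine Finset.sum_congr rfl fun i _ => ?_
  rw [dirDeriv_smul (hb.clm (l i)).mdifferentiableAt (hK' (B i)).mdifferentiableAt,
    dirDeriv_smul (ContMDiffNear.const (l i (b w))).mdifferentiableAt
      (hK' (B i)).mdifferentiableAt, dirDeriv_const, dirDeriv_clm _ hb.mdifferentiableAt,
    zero_smul, add_zero]

variable [IsManifold J ∞ W]

/-- The function is the fibre component of the composite of `V` with the tangent map of `g`. At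
order ∞ no derivative is lost, so the operation can be iterated. -/
theorem ContMDiffNear.dirDeriv {V : ∀ w, TangentSpace J w} (hg : ContMDiffNear J 𝓘(ℝ, G) g w)
    (hV : ContMDiffNear J J.tangent (fun w => (⟨w, V w⟩ : TangentBundle J W)) w) :
    ContMDiffNear J 𝓘(ℝ, G) (fun y => dirDeriv J g y (V y)) w := by
  obtain ⟨s, hs, hws, hgs⟩ := hg.exists_open
  obtain ⟨t, ht, hwt, hVt⟩ := hV.exists_open
  have hT := (hgs.contMDiffOn_tangentMapWithin (m := ∞) (by simp) (IsOpen.uniqueMDiffOn (I := J) hs)).comp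
    (hVt.mono (inter_subset_right (s := s))) (fun y hy => hy.1)
  have h := (contMDiff_snd_tangentBundle_modelSpace G 𝓘(ℝ, G) (n := ∞)).comp_contMDiffOn hT
  refine ContMDiffNear.of_contMDiffOn (h.congr fun y hy => ?_) (hs.inter ht) ⟨hws, hwt⟩
  change mfderiv J 𝓘(ℝ, G) g y (V y) = mfderivWithin J 𝓘(ℝ, G) g s y (V y)
  rw [mfderivWithin_of_isOpen hs hy.1]

/-- Tangent vectors are separated by smooth functions. -/
theorem eq_of_dirDeriv_eq [FiniteDimensional ℝ EW] {u v : TangentSpace J w}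
    (h : ∀ g : W → ℝ, ContMDiffNear J 𝓘(ℝ, ℝ) g w → dirDeriv J g w u = dirDeriv J g w v) :
    u = v := by
  have hφ : ContMDiffNear J 𝓘(ℝ, EW) (extChartAt J w) w :=
    .of_contMDiffOn (contMDiffOn_extChartAt (x := w)) (chartAt HW w).open_source
      (mem_chart_source HW w)
  obtain ⟨L, hL⟩ := isInvertible_mfderiv_extChartAt (I := J) (mem_extChartAt_source (I := J) w)
  -- The test functions are the scalar components of the chart, whose derivative at `w` is
  -- invertible.
  have hinj : dirDeriv J (extChartAt J w) w u = dirDeriv J (extChartAt J w) w v := by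
    let B := Module.finBasis ℝ EW
    refine B.ext_elem fun i => ?_
    have h1 := h _ (hφ.clm (LinearMap.toContinuousLinearMap (B.coord i)))
    rwa [dirDeriv_clm _ hφ.mdifferentiableAt, dirDeriv_clm _ hφ.mdifferentiableAt] at h1
  unfold dirDeriv at hinj
  rw [← hL] at hinj
  exact L.injective hinj

/-- The derivative along `[U, V]` is the commutator of the derivatives along `U` and `V`. -/
theorem dirDeriv_mlieBracket [J.Boundaryless] [CompleteSpace EW] {U V : ∀ w, TangentSpace J w}
    (hg : ContMDiffNear J 𝓘(ℝ, G) g w)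
    (hU : ContMDiffNear J J.tangent (fun w => (⟨w, U w⟩ : TangentBundle J W)) w)
    (hV : ContMDiffNear J J.tangent (fun w => (⟨w, V w⟩ : TangentBundle J W)) w) :
    dirDeriv J g w (VectorField.mlieBracket J U V w) =
      dirDeriv J (fun y => dirDeriv J g y (V y)) w (U w) -
        dirDeriv J (fun y => dirDeriv J g y (U y)) w (V w) := by
  set φ := extChartAt J w with hφ
  -- The expression of a vector field in the chart at `w`, as a function on the model space.
  let pull : (∀ w, TangentSpace J w) → EW → EW := fun X =>
    VectorField.mpullbackWithin 𝓘(ℝ, EW) J φ.symm X (range J)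
  have hmem : ∀ᶠ y in 𝓝 w, y ∈ φ.source := extChartAt_source_mem_nhds (I := J) w
  have hwφ : w ∈ φ.source := mem_extChartAt_source (I := J) w
  have hφd : ∀ y ∈ φ.source, MDifferentiableAt J 𝓘(ℝ, EW) φ y := fun y hy =>
    mdifferentiableAt_extChartAt (by simpa [hφ] using hy)
  have hsymm : ContinuousAt φ.symm (φ w) := continuousAt_extChartAt_symm w
  have hpull : ∀ X : ∀ w, TangentSpace J w, ∀ᶠ y in 𝓝 w,
      (mfderiv J 𝓘(ℝ, EW) φ y (X y) : EW) = pull X (φ y) := by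
    intro X
    have h1 : ∀ᶠ y in 𝓝 w, X y = VectorField.mpullback J 𝓘(ℝ, EW) φ (pull X) y :=
      nhdsWithin_univ w ▸
        VectorField.eventuallyEq_mpullback_mpullbackWithin_extChartAt (I := J) (x := w)
          (s := univ) X
    filter_upwards [h1, hmem] with y hy hy'
    exact (congrArg _ hy).trans
      ((isInvertible_mfderiv_extChartAt (I := J) hy').self_apply_inverse (pull X (φ y)))
  -- the coordinate expression of a derivative along a vector field
  have key : ∀ k : W → G, ContMDiffNear J 𝓘(ℝ, G) k w → ∀ X : ∀ w, TangentSpace J w,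
      ∀ᶠ y in 𝓝 w, dirDeriv J k y (X y) = fderiv ℝ (k ∘ φ.symm) (φ y) (pull X (φ y)) := by
    intro k hk X
    filter_upwards [hk.eventually, hpull X, hmem, hmem.eventually_nhds] with y h1 h2 h3 h4
    have h5 : k =ᶠ[𝓝 y] fun z => (k ∘ φ.symm) (φ z) := by
      filter_upwards [h4] with z hz
      simp [φ.left_inv hz]
    have h6 : MDifferentiableAt 𝓘(ℝ, EW) 𝓘(ℝ, G) (k ∘ φ.symm) (φ y) := by
      have h7 : MDifferentiableAt J 𝓘(ℝ, G) k (φ.symm (φ y)) := by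
        rw [φ.left_inv h3]; exact h1.mdifferentiableAt
      refine h7.comp (φ y) ?_
      have := mdifferentiableWithinAt_extChartAt_symm (I := J) (x := w) (φ.map_source h3)
      rwa [J.range_eq_univ, mdifferentiableWithinAt_univ] at this
    rw [dirDeriv_congr h5, dirDeriv_comp h6 (hφd y h3)]
    unfold dirDeriv
    rw [mfderiv_eq_fderiv]
    exact congrArg _ h2
  -- The same identity as an equality of germs on the model space, so that it can be differentiated
  -- a second time.
  have key' : ∀ k : W → G, ContMDiffNear J 𝓘(ℝ, G) k w → ∀ X : ∀ w, TangentSpace J w,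
      (fun y => dirDeriv J k y (X y)) ∘ φ.symm =ᶠ[𝓝 (φ w)]
        fun z => fderiv ℝ (k ∘ φ.symm) z (pull X z) := by
    intro k hk X
    have h1 : Tendsto φ.symm (𝓝 (φ w)) (𝓝 w) := by
      have := hsymm.tendsto
      rwa [φ.left_inv hwφ] at this
    filter_upwards [h1.eventually (key k hk X),
      (extChartAt_target_mem_nhds (I := J) w : φ.target ∈ 𝓝 (φ w))] with z hz hz'
    rw [φ.right_inv hz'] at hz
    exact hz
  have hdiff : ∀ X : ∀ w, TangentSpace J w,
      ContMDiffNear J J.tangent (fun w => (⟨w, X w⟩ : TangentBundle J W)) w →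
      DifferentiableAt ℝ (pull X) (φ w) := by
    intro X hX
    have h1 := MDifferentiableWithinAt.differentiableWithinAt_mpullbackWithin_vectorField
      (I := J) (V := X) (s := univ) (x := w) hX.mdifferentiableAt.mdifferentiableWithinAt
    have h2 : DifferentiableWithinAt ℝ (pull X) (φ.symm ⁻¹' univ ∩ range J) (φ w) := h1
    rwa [preimage_univ, univ_inter, J.range_eq_univ, differentiableWithinAt_univ] at h2
  have hgd : ContDiffAt ℝ 2 (g ∘ φ.symm) (φ w) := by
    have h1 := (contMDiffAt_iff.1 hg.contMDiffAt).2
    rw [J.range_eq_univ, contDiffWithinAt_univ] at h1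
    exact h1.of_le (by norm_cast)
  have hbr : pull (VectorField.mlieBracket J U V) (φ w) =
      VectorField.lieBracket ℝ (pull U) (pull V) (φ w) := by
    let Z : EW :=
      VectorField.lieBracketWithin ℝ (pull U) (pull V) (φ.symm ⁻¹' univ ∩ range J) (φ w)
    have h1 := (isInvertible_mfderiv_extChartAt (I := J) hwφ).self_apply_inverse Z
    refine ((hpull (VectorField.mlieBracket J U V)).self_of_nhds.symm.trans h1).trans ?_
    change VectorField.lieBracketWithin ℝ (pull U) (pull V) (φ.symm ⁻¹' univ ∩ range J) (φ w) = _
    rw [preimage_univ, univ_inter, J.range_eq_univ, VectorField.lieBracketWithin_univ]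
  have e1 := (key g hg (VectorField.mlieBracket J U V)).self_of_nhds
  have e2 := (key _ (hg.dirDeriv hV) U).self_of_nhds
  have e3 := (key _ (hg.dirDeriv hU) V).self_of_nhds
  -- The identity in the model space, where the second derivatives of `g` cancel by symmetry.
  rw [hbr, VectorField.fderiv_apply_lieBracket hgd (by simp) (hdiff V hV) (hdiff U hU)] at e1
  rw [(key' g hg V).fderiv_eq] at e2
  rw [(key' g hg U).fderiv_eq] at e3
  rw [e1, e2, e3]

end DirDeriv

/-! ## Lie algebroid laws for local sections -/

section SmoothSec

variable {EN HN N : Type*} [NormedAddCommGroup EN] [NormedSpace ℝ EN]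
  [TopologicalSpace HN] [TopologicalSpace N] [ChartedSpace HN N] (I : ModelWithCorners ℝ EN HN)
  (F : Type*) [NormedAddCommGroup F] [NormedSpace ℝ F]
  {A : N → Type*} [∀ x, AddCommGroup (A x)] [∀ x, Module ℝ (A x)]
  [TopologicalSpace (TotalSpace F A)] [∀ x, TopologicalSpace (A x)]
  [FiberBundle F A]

/-- The section `X` of the vector bundle `A` is smooth near `x`. -/
def SmoothSec (X : ∀ x, A x) (x : N) : Prop :=
  ContMDiffNear I (I.prod 𝓘(ℝ, F)) (fun y => TotalSpace.mk' F y (X y)) x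

end SmoothSec

/-- The laws of a Lie algebroid, for local sections; `S X x` says that the section `X` is smooth
near `x`. -/
structure AlgebroidData.IsLie {EN HN N : Type*} [NormedAddCommGroup EN] [NormedSpace ℝ EN]
    [TopologicalSpace HN] [TopologicalSpace N] [ChartedSpace HN N] {I : ModelWithCorners ℝ EN HN}
    [IsManifold I 1 N]
    {A : N → Type*} [∀ x, AddCommGroup (A x)] [∀ x, Module ℝ (A x)] (D : AlgebroidData I A)
    (S : (∀ x, A x) → N → Prop) : Prop where
  anchor_smooth : ∀ {X x}, S X x → ContMDiffNear I I.tangent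
    (fun y => (⟨y, D.anchor y (X y)⟩ : TangentBundle I N)) x
  congr : ∀ {X X' Y Y' : ∀ x, A x} {x : N}, (∀ᶠ y in 𝓝 x, X y = X' y) →
    (∀ᶠ y in 𝓝 x, Y y = Y' y) → D.bracket X Y x = D.bracket X' Y' x
  smooth : ∀ {X Y x}, S X x → S Y x → S (D.bracket X Y) x
  skew : ∀ {X Y x}, S X x → S Y x → D.bracket X Y x = - D.bracket Y X x
  add : ∀ {X Y Z x}, S X x → S Y x → S Z x →
    D.bracket X (fun y => Y y + Z y) x = D.bracket X Y x + D.bracket X Z x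
  leibniz : ∀ {X Y x} {g : N → ℝ}, S X x → S Y x → ContMDiffNear I 𝓘(ℝ, ℝ) g x →
    D.bracket X (fun y => g y • Y y) x =
      g x • D.bracket X Y x + dirDeriv I g x (D.anchor x (X x)) • Y x
  -- Compatibility of anchor and brackets is tested on functions, the form in which it meets second
  -- derivatives of composites `g ∘ f` later.
  anchor_bracket : ∀ {X Y x} {g : N → ℝ}, S X x → S Y x → ContMDiffNear I 𝓘(ℝ, ℝ) g x →
    dirDeriv I g x (D.anchor x (D.bracket X Y x)) =
      dirDeriv I (fun y => dirDeriv I g y (D.anchor y (Y y))) x (D.anchor x (X x)) -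
        dirDeriv I (fun y => dirDeriv I g y (D.anchor y (X y))) x (D.anchor x (Y x))
  jacobi : ∀ {X Y Z x}, S X x → S Y x → S Z x →
    D.bracket (D.bracket X Y) Z x + D.bracket (D.bracket Y Z) X x +
      D.bracket (D.bracket Z X) Y x = 0

section Trivialization

variable {EN HN N : Type*} [NormedAddCommGroup EN] [NormedSpace ℝ EN]
  [TopologicalSpace HN] [TopologicalSpace N] [ChartedSpace HN N] {I : ModelWithCorners ℝ EN HN}
  {F : Type*} [NormedAddCommGroup F] [NormedSpace ℝ F]
  {A : N → Type*} [∀ x, AddCommGroup (A x)] [∀ x, Module ℝ (A x)]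
  [TopologicalSpace (TotalSpace F A)] [∀ x, TopologicalSpace (A x)]
  [FiberBundle F A] [VectorBundle ℝ F A]
  (e : Trivialization F (π F A)) [MemTrivializationAtlas e]

theorem isLinearMap_symm {x : N} (hx : x ∈ e.baseSet) : IsLinearMap ℝ (e.symm x) := by
  rw [← e.coe_symmₗ (R := ℝ) hx]
  exact (e.symmₗ ℝ x).isLinear

theorem isLinearMap_snd {x : N} (hx : x ∈ e.baseSet) :
    IsLinearMap ℝ (fun u : A x => (e ⟨x, u⟩).2) :=
  e.linear ℝ hx

theorem snd_symm {x : N} (hx : x ∈ e.baseSet) (c : F) : (e ⟨x, e.symm x c⟩).2 = c :=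
  congrArg Prod.snd (e.apply_mk_symm hx c)

theorem symm_snd {x : N} (hx : x ∈ e.baseSet) (u : A x) : e.symm x (e ⟨x, u⟩).2 = u :=
  e.symm_apply_apply_mk hx u

theorem snd_injective {x : N} (hx : x ∈ e.baseSet) {u v : A x}
    (h : (e ⟨x, u⟩).2 = (e ⟨x, v⟩).2) : u = v := by
  rw [← symm_snd e hx u, h, symm_snd e hx v]

variable [IsManifold I ∞ N] [ContMDiffVectorBundle ∞ F A I]

theorem SmoothSec.snd {X : ∀ x, A x} {x : N} (hX : SmoothSec I F X x) (hx : x ∈ e.baseSet) :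
    ContMDiffNear I 𝓘(ℝ, F) (fun y => (e ⟨y, X y⟩).2) x := by
  filter_upwards [hX, e.open_baseSet.mem_nhds hx] with y hy hy'
  exact (e.contMDiffAt_section_iff hy').1 hy

theorem SmoothSec.of_snd {X : ∀ x, A x} {x : N} (hx : x ∈ e.baseSet)
    (hX : ContMDiffNear I 𝓘(ℝ, F) (fun y => (e ⟨y, X y⟩).2) x) : SmoothSec I F X x := by
  filter_upwards [hX, e.open_baseSet.mem_nhds hx] with y hy hy'
  exact (e.contMDiffAt_section_iff hy').2 hy

theorem SmoothSec.symm {p : N → F} {x : N} (hx : x ∈ e.baseSet)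
    (hp : ContMDiffNear I 𝓘(ℝ, F) p x) : SmoothSec I F (fun y => e.symm y (p y)) x := by
  refine .of_snd e hx (hp.congr ?_)
  filter_upwards [e.open_baseSet.mem_nhds hx] with y hy using snd_symm e hy _

theorem SmoothSec.congr {X Y : ∀ x, A x} {x : N} (hX : SmoothSec I F X x)
    (h : ∀ᶠ y in 𝓝 x, Y y = X y) : SmoothSec I F Y x :=
  ContMDiffNear.congr hX (by filter_upwards [h] with y hy; rw [hy])

theorem SmoothSec.smul {X : ∀ x, A x} {x : N} {g : N → ℝ} (hg : ContMDiffNear I 𝓘(ℝ, ℝ) g x)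
    (hX : SmoothSec I F X x) : SmoothSec I F (fun y => g y • X y) x := by
  filter_upwards [hg, hX] with y h h'
  exact h.smul_section h'

theorem SmoothSec.sum {ι : Type*} (s : Finset ι) {X : ι → ∀ x, A x} {x : N}
    (h : ∀ i ∈ s, SmoothSec I F (X i) x) : SmoothSec I F (fun y => ∑ i ∈ s, X i y) x := by
  filter_upwards [(Filter.eventually_all_finset s).2 h] with y hy
  exact ContMDiffAt.sum_section hy

end Trivialization

/-! ### Brackets in a local frame: structure functions and their identities. -/

namespace AlgebroidData.IsLie

variable {EN HN N : Type*} [NormedAddCommGroup EN] [NormedSpace ℝ EN]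
  [TopologicalSpace HN] [TopologicalSpace N] [ChartedSpace HN N] {I : ModelWithCorners ℝ EN HN}
  [IsManifold I ∞ N]
  {F : Type*} [NormedAddCommGroup F] [NormedSpace ℝ F] [FiniteDimensional ℝ F]
  {A : N → Type*} [∀ x, AddCommGroup (A x)] [∀ x, Module ℝ (A x)]
  [TopologicalSpace (TotalSpace F A)] [∀ x, TopologicalSpace (A x)]
  [FiberBundle F A] [VectorBundle ℝ F A] [ContMDiffVectorBundle ∞ F A I]
  {D : AlgebroidData I A} (hD : D.IsLie (SmoothSec I F))
/-- The coefficients of the bracket in the local frame given by the trivialization `e`. -/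
noncomputable def _root_.AlgebroidData.frameCoeff (D : AlgebroidData I A)
    (e : Trivialization F (π F A)) (x : N) (p q : F) : F :=
  (e ⟨x, D.bracket (fun y => e.symm y p) (fun y => e.symm y q) x⟩).2

theorem _root_.AlgebroidData.symm_frameCoeff (e : Trivialization F (π F A))
    [MemTrivializationAtlas e] {x : N} (hx : x ∈ e.baseSet) (p q : F) :
    e.symm x (D.frameCoeff e x p q) =
      D.bracket (fun y => e.symm y p) (fun y => e.symm y q) x :=
  symm_snd e hx _

include hD

theorem bracket_sum {ι : Type*} (s : Finset ι) {X : ∀ x, A x} {Y : ι → ∀ x, A x} {a : ι → N → ℝ}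
    {x : N} (hX : SmoothSec I F X x) (hY : ∀ i, SmoothSec I F (Y i) x)
    (ha : ∀ i, ContMDiffNear I 𝓘(ℝ, ℝ) (a i) x) :
    D.bracket X (fun y => ∑ i ∈ s, a i y • Y i y) x =
      ∑ i ∈ s, (a i x • D.bracket X (Y i) x + dirDeriv I (a i) x (D.anchor x (X x)) • Y i x) := by
  classical
  induction s using Finset.induction_on with
  | empty =>
    -- The zero section is written as `0 • X`, so the Leibniz rule shows that its bracket vanishes.
    have h := hD.leibniz (g := fun _ => 0) hX hX (.const 0)
    rw [dirDeriv_const] at h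
    simpa using h
  | insert i s hi ih =>
    simp only [Finset.sum_insert hi]
    rw [hD.add hX (.smul (ha i) (hY i)) (.sum s fun j _ => .smul (ha j) (hY j)),
      hD.leibniz hX (hY i) (ha i), ih]

variable (e : Trivialization F (π F A)) [MemTrivializationAtlas e]

/-- The Leibniz rule for a vector of coefficients. Expanding `q` and its frozen value `q x` in a
basis of `F` gives sums that differ exactly by the terms where a coefficient is differentiated. -/
theorem bracket_frame_right {X : ∀ x, A x} {q : N → F} {x : N} (hx : x ∈ e.baseSet)
    (hX : SmoothSec I F X x) (hq : ContMDiffNear I 𝓘(ℝ, F) q x) :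
    D.bracket X (fun y => e.symm y (q y)) x =
      e.symm x (dirDeriv I q x (D.anchor x (X x))) +
        D.bracket X (fun y => e.symm y (q x)) x := by
  let B := Module.finBasis ℝ F
  let l : ∀ i, F →L[ℝ] ℝ := fun i => LinearMap.toContinuousLinearMap (B.coord i)
  have h0 : ∀ y ∈ e.baseSet, ∀ c, e.symm y c = ∑ i, l i c • e.symm y (B i) := by
    intro y hy c
    conv_lhs => rw [← B.sum_repr c]
    have := map_sum (isLinearMap_symm e hy).mk' (fun i => B.repr c i • B i) Finset.univ
    simp only [IsLinearMap.mk'_apply] at this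
    rw [this]
    simp [(isLinearMap_symm e hy).map_smul, l]
  have hmem := e.open_baseSet.mem_nhds hx
  have hs : ∀ i, SmoothSec I F (fun y => e.symm y (B i)) x := fun i => .symm e hx (.const _)
  have h1 := hD.congr (X := X) (X' := X) (x := x) (.of_forall fun _ => rfl)
    (by filter_upwards [hmem] with y hy using h0 y hy (q y))
  have h2 := hD.congr (X := X) (X' := X) (x := x) (.of_forall fun _ => rfl)
    (by filter_upwards [hmem] with y hy using h0 y hy (q x))
  rw [h1, h2, hD.bracket_sum Finset.univ hX hs (fun i => hq.clm (l i)),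
    hD.bracket_sum Finset.univ hX hs (fun i => .const (l i (q x))), h0 x hx,
    ← Finset.sum_add_distrib]
  refine Finset.sum_congr rfl fun i _ => ?_
  rw [dirDeriv_const, dirDeriv_clm _ hq.mdifferentiableAt, zero_smul, add_zero, add_comm]

/-- Leibniz in each slot in turn, with skew-symmetry to exchange the slots: the bracket splits into
a derivative part and a part depending only on the values of the coefficients at `x`. -/
theorem bracket_frame {p q : N → F} {x : N} (hx : x ∈ e.baseSet)
    (hp : ContMDiffNear I 𝓘(ℝ, F) p x) (hq : ContMDiffNear I 𝓘(ℝ, F) q x) :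
    D.bracket (fun y => e.symm y (p y)) (fun y => e.symm y (q y)) x =
      e.symm x (dirDeriv I q x (D.anchor x (e.symm x (p x))) -
        dirDeriv I p x (D.anchor x (e.symm x (q x)))) +
        D.bracket (fun y => e.symm y (p x)) (fun y => e.symm y (q x)) x := by
  have hP : SmoothSec I F (fun y => e.symm y (p y)) x := .symm e hx hp
  have hc : ∀ c, SmoothSec I F (fun y => e.symm y c) x := fun c => .symm e hx (.const c)
  rw [hD.bracket_frame_right e hx hP hq, hD.skew hP (hc _),
    hD.bracket_frame_right e hx (hc _) hp, hD.skew (hc (q x)) (hc (p x)),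
    (isLinearMap_symm e hx).map_sub]
  abel

/-- Constant coefficients have zero derivative, so the inhomogeneous Leibniz term disappears. -/
theorem isLinearMap_bracket_frame {x : N} (hx : x ∈ e.baseSet) (p : F) :
    IsLinearMap ℝ (fun q => D.bracket (fun y => e.symm y p) (fun y => e.symm y q) x) := by
  have hmem := e.open_baseSet.mem_nhds hx
  have hc : ∀ c, SmoothSec I F (fun y => e.symm y c) x := fun c => .symm e hx (.const c)
  constructor
  · intro q q'
    rw [← hD.add (hc p) (hc q) (hc q')]
    exact hD.congr (.of_forall fun _ => rfl)
      (by filter_upwards [hmem] with y hy using (isLinearMap_symm e hy).map_add q q')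
  · intro c q
    have h := hD.leibniz (g := fun _ => c) (hc p) (hc q) (.const c)
    rw [dirDeriv_const, zero_smul, add_zero] at h
    rw [← h]
    exact hD.congr (.of_forall fun _ => rfl)
      (by filter_upwards [hmem] with y hy using (isLinearMap_symm e hy).map_smul c q)

theorem isLinearMap_frameCoeff_right {x : N} (hx : x ∈ e.baseSet) (p : F) :
    IsLinearMap ℝ (D.frameCoeff e x p) :=
  ((isLinearMap_snd e hx).mk'.comp (hD.isLinearMap_bracket_frame e hx p).mk').isLinear

theorem frameCoeff_skew {x : N} (hx : x ∈ e.baseSet) (p q : F) :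
    D.frameCoeff e x p q = - D.frameCoeff e x q p := by
  have hc : ∀ c, SmoothSec I F (fun y => e.symm y c) x := fun c => .symm e hx (.const c)
  rw [frameCoeff, hD.skew (hc p) (hc q), (isLinearMap_snd e hx).map_neg]
  rfl

theorem isLinearMap_frameCoeff_left {x : N} (hx : x ∈ e.baseSet) (q : F) :
    IsLinearMap ℝ (fun p => D.frameCoeff e x p q) := by
  have h := hD.isLinearMap_frameCoeff_right e hx q
  constructor
  · intro p p'
    rw [hD.frameCoeff_skew e hx, h.map_add, hD.frameCoeff_skew e hx p, hD.frameCoeff_skew e hx p']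
    abel
  · intro c p
    rw [hD.frameCoeff_skew e hx, h.map_smul, hD.frameCoeff_skew e hx p, smul_neg]

theorem contMDiffNear_frameCoeff {x : N} (hx : x ∈ e.baseSet) (p q : F) :
    ContMDiffNear I 𝓘(ℝ, F) (fun y => D.frameCoeff e y p q) x :=
  have hc : ∀ c, SmoothSec I F (fun y => e.symm y c) x := fun c => .symm e hx (.const c)
  (hD.smooth (hc p) (hc q)).snd e hx

/-- Jacobi for three frame sections. The inner bracket has coefficients that vary with the point;
since it stands in the left slot, differentiating them along the anchor of the third section
contributes with a minus sign. -/
theorem frameCoeff_jacobi {x : N} (hx : x ∈ e.baseSet) (a b c : F) :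
    (D.frameCoeff e x (D.frameCoeff e x a b) c -
        dirDeriv I (fun y => D.frameCoeff e y a b) x (D.anchor x (e.symm x c))) +
      (D.frameCoeff e x (D.frameCoeff e x b c) a -
        dirDeriv I (fun y => D.frameCoeff e y b c) x (D.anchor x (e.symm x a))) +
      (D.frameCoeff e x (D.frameCoeff e x c a) b -
        dirDeriv I (fun y => D.frameCoeff e y c a) x (D.anchor x (e.symm x b))) = 0 := by
  have hc : ∀ c, SmoothSec I F (fun y => e.symm y c) x := fun c => .symm e hx (.const c)
  have key : ∀ a b c : F, (e ⟨x, D.bracket (D.bracket (fun y => e.symm y a)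
      (fun y => e.symm y b)) (fun y => e.symm y c) x⟩).2 =
      D.frameCoeff e x (D.frameCoeff e x a b) c -
        dirDeriv I (fun y => D.frameCoeff e y a b) x (D.anchor x (e.symm x c)) := by
    intro a b c
    have h1 : D.bracket (D.bracket (fun y => e.symm y a) (fun y => e.symm y b))
        (fun y => e.symm y c) x =
        D.bracket (fun y => e.symm y (D.frameCoeff e y a b)) (fun y => e.symm y c) x :=
      hD.congr (by filter_upwards [e.open_baseSet.mem_nhds hx] with y hy
                   exact (symm_frameCoeff e hy a b).symm) (.of_forall fun _ => rfl)
    rw [h1, hD.bracket_frame e hx (hD.contMDiffNear_frameCoeff e hx a b) (.const c),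
      dirDeriv_const, (isLinearMap_snd e hx).map_add, snd_symm e hx, zero_sub, neg_add_eq_sub]
    rfl
  rw [← key, ← key, ← key, ← (isLinearMap_snd e hx).map_add, ← (isLinearMap_snd e hx).map_add,
    hD.jacobi (hc a) (hc b) (hc c), (isLinearMap_snd e hx).map_zero]

/-- Change of frame for the bracket of sections with constant coefficients. -/
theorem bracket_frame_change (e' : Trivialization F (π F A)) [MemTrivializationAtlas e'] {x : N}
    (hx : x ∈ e.baseSet) (hx' : x ∈ e'.baseSet) (p q : F) :
    D.bracket (fun y => e.symm y p) (fun y => e.symm y q) x =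
      e'.symm x (dirDeriv I (fun y => (e' ⟨y, e.symm y q⟩).2) x (D.anchor x (e.symm x p)) -
        dirDeriv I (fun y => (e' ⟨y, e.symm y p⟩).2) x (D.anchor x (e.symm x q))) +
        D.bracket (fun y => e'.symm y (e' ⟨x, e.symm x p⟩).2)
          (fun y => e'.symm y (e' ⟨x, e.symm x q⟩).2) x := by
  have hc : ∀ c, ContMDiffNear I 𝓘(ℝ, F) (fun y => (e' ⟨y, e.symm y c⟩).2) x :=
    fun c => (SmoothSec.symm e hx (.const c)).snd e' hx'
  have hcongr : ∀ c, ∀ᶠ y in 𝓝 x, e.symm y c = e'.symm y (e' ⟨y, e.symm y c⟩).2 := by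
    intro c
    filter_upwards [e'.open_baseSet.mem_nhds hx'] with y hy using (symm_snd e' hy _).symm
  rw [hD.congr (hcongr p) (hcongr q), hD.bracket_frame e' hx' (hc p) (hc q), symm_snd e' hx',
    symm_snd e' hx']

end AlgebroidData.IsLie

/-! ## The prolongation of a Lie algebroid -/

namespace AlgebroidData

section Prolongation

variable {EN HN N : Type*} [NormedAddCommGroup EN] [NormedSpace ℝ EN]
  [TopologicalSpace HN] [TopologicalSpace N] [ChartedSpace HN N] {I : ModelWithCorners ℝ EN HN}
  [IsManifold I ∞ N]
  {F : Type*} [NormedAddCommGroup F] [NormedSpace ℝ F]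
  {A : N → Type*} [∀ x, AddCommGroup (A x)] [∀ x, Module ℝ (A x)]
  [TopologicalSpace (TotalSpace F A)] [∀ x, TopologicalSpace (A x)]
  [FiberBundle F A] [VectorBundle ℝ F A] [ContMDiffVectorBundle ∞ F A I]
  {EW HW W : Type*} [NormedAddCommGroup EW] [NormedSpace ℝ EW]
  [TopologicalSpace HW] [TopologicalSpace W] [ChartedSpace HW W] 
  {J : ModelWithCorners ℝ EW HW} [IsManifold J ∞ W] {D : AlgebroidData I A} {f : W → N}

/-- The components along `A` of a section of `𝒯^f A`, in the trivialization `e` of `A`. -/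
def comp (e : Trivialization F (π F A)) (X : ∀ w, D.prolFiber J f w) (w : W) : F :=
  (e ⟨f w, (X w).1.1⟩).2

variable (e : Trivialization F (π F A)) [MemTrivializationAtlas e]

theorem SmoothNear.vectorField {X : ∀ w, D.prolFiber J f w} {w : W} (hX : SmoothNear F X w) :
    ContMDiffNear J J.tangent (fun w => (⟨w, (X w).1.2⟩ : TangentBundle J W)) w :=
  hX.mono fun _ h => h.2

theorem SmoothNear.comp {X : ∀ w, D.prolFiber J f w} {w : W} (hX : SmoothNear F X w)
    (hf : Continuous f) (hw : f w ∈ e.baseSet) :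
    ContMDiffNear J 𝓘(ℝ, F) (AlgebroidData.comp e X) w := by
  filter_upwards [hX, hf.continuousAt.preimage_mem_nhds (e.open_baseSet.mem_nhds hw)] with y hy hy'
  exact ((e.contMDiffAt_iff (f := fun w => TotalSpace.mk' F (f w) (X w).1.1)
    (e.mem_source.2 hy')).1 hy.1).2

theorem SmoothNear.of_comp {X : ∀ w, D.prolFiber J f w} {w : W} (hf : ContMDiff J I ∞ f)
    (hw : f w ∈ e.baseSet) (h : ContMDiffNear J 𝓘(ℝ, F) (AlgebroidData.comp e X) w)
    (h' : ContMDiffNear J J.tangent (fun w => (⟨w, (X w).1.2⟩ : TangentBundle J W)) w) :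
    SmoothNear F X w := by
  filter_upwards [h, h',
    hf.continuous.continuousAt.preimage_mem_nhds (e.open_baseSet.mem_nhds hw)] with y hy hy' hy''
  exact ⟨(e.contMDiffAt_iff (f := fun w => TotalSpace.mk' F (f w) (X w).1.1)
    (e.mem_source.2 hy'')).2 ⟨hf y, hy⟩, hy'⟩

theorem symm_comp {X : ∀ w, D.prolFiber J f w} {w : W} (hw : f w ∈ e.baseSet) :
    e.symm (f w) (comp e X w) = (X w).1.1 :=
  symm_snd e hw _

variable [FiniteDimensional ℝ F] (hD : D.IsLie (SmoothSec I F)) (hf : ContMDiff J I ∞ f)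
include hD hf

/-- The bracket of the prolongation can be computed in any local frame. -/
theorem prolBracketPair_fst {X Y : ∀ w, D.prolFiber J f w} {w : W} (hX : SmoothNear F X w)
    (hY : SmoothNear F Y w) (hw : f w ∈ e.baseSet) :
    (D.prolBracketPair J f F X Y w).1 =
      e.symm (f w) (dirDeriv J (comp e Y) w (X w).1.2 - dirDeriv J (comp e X) w (Y w).1.2 +
        D.frameCoeff e (f w) (comp e X w) (comp e Y w)) := by
  let e' := trivializationAt F A (f w)
  have hw' : f w ∈ e'.baseSet := FiberBundle.mem_baseSet_trivializationAt' (f w)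
  have hlin : ∀ᶠ y in 𝓝 w, IsLinearMap ℝ (fun c => (e' ⟨f y, e.symm (f y) c⟩).2) := by
    filter_upwards [hf.continuous.continuousAt.preimage_mem_nhds (e.open_baseSet.mem_nhds hw),
      hf.continuous.continuousAt.preimage_mem_nhds (e'.open_baseSet.mem_nhds hw')] with y hy hy'
    exact ((isLinearMap_snd e' hy').mk'.comp (isLinearMap_symm e hy).mk').isLinear
  have hT : ∀ c, ContMDiffNear I 𝓘(ℝ, F) (fun y => (e' ⟨y, e.symm y c⟩).2) (f w) :=
    fun c => (SmoothSec.symm e hw (.const c)).snd e' hw'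
  have hTf : ∀ c, ContMDiffNear J 𝓘(ℝ, F) (fun y => (e' ⟨f y, e.symm (f y) c⟩).2) w :=
    fun c => (hT c).comp (.of_contMDiff hf)
  -- Components in the preferred trivialization `e'` are the transition matrix applied to components
  -- in `e`. Since the matrix depends on the base point only, its derivative along `Z` is a
  -- derivative along the image under `T f`, which is the anchor of the first component of `Z`.
  have key : ∀ (Z Y : ∀ w, D.prolFiber J f w), SmoothNear F Y w →
      dirDeriv J (components F w Y) w (Z w).1.2 =
        dirDeriv I (fun y => (e' ⟨y, e.symm y (comp e Y w)⟩).2) (f w)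
          (D.anchor (f w) (Z w).1.1) +
        (e' ⟨f w, e.symm (f w) (dirDeriv J (comp e Y) w (Z w).1.2)⟩).2 := by
    intro Z Y hY
    have h1 : components F w Y =ᶠ[𝓝 w]
        fun y => (e' ⟨f y, e.symm (f y) (comp e Y y)⟩).2 := by
      filter_upwards [hf.continuous.continuousAt.preimage_mem_nhds (e.open_baseSet.mem_nhds hw)]
        with y hy
      rw [symm_comp e hy]
      rfl
    rw [dirDeriv_congr h1, dirDeriv_apply_of_isLinearMap hlin hTf (hY.comp e hf.continuous hw),
      dirDeriv_comp (hT _).mdifferentiableAt (hf.mdifferentiable (by simp) w)]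
    congr 2
    exact (Z w).2.symm
  have hcw : ∀ Z : ∀ w, D.prolFiber J f w, components F w Z w =
      (e' ⟨f w, e.symm (f w) (comp e Z w)⟩).2 := by
    intro Z
    rw [symm_comp e hw]
    rfl
  have hsub := (isLinearMap_symm e' hw').map_sub
  have hadd := (isLinearMap_symm e' hw').map_add
  unfold prolBracketPair
  -- The derivatives of the transition matrix produced by `key` cancel the inhomogeneous terms in
  -- the change of frame for the bracket.
  rw [(isLinearMap_symm e hw).map_add, symm_frameCoeff e hw, hD.bracket_frame_change e e' hw hw',
    symm_comp e hw, symm_comp e hw, key X Y hY, key Y X hX, hcw, hcw, symm_comp e hw,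
    symm_comp e hw, (isLinearMap_symm e hw).map_sub]
  change e'.symm (f w) _ + _ = _
  simp only [hsub, hadd, symm_snd e' hw']
  unfold constSection
  abel

end Prolongation

end AlgebroidData

/-! ### The algebroid laws for the bracket of a prolongation. -/

namespace AlgebroidData

section Prolongation

variable {EN HN N : Type*} [NormedAddCommGroup EN] [NormedSpace ℝ EN] [FiniteDimensional ℝ EN]
  [TopologicalSpace HN] [TopologicalSpace N] [ChartedSpace HN N] {I : ModelWithCorners ℝ EN HN}
  [IsManifold I ∞ N]
  {F : Type*} [NormedAddCommGroup F] [NormedSpace ℝ F]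
  {A : N → Type*} [∀ x, AddCommGroup (A x)] [∀ x, Module ℝ (A x)]
  [TopologicalSpace (TotalSpace F A)] [∀ x, TopologicalSpace (A x)]
  [FiberBundle F A] [VectorBundle ℝ F A] [ContMDiffVectorBundle ∞ F A I]
  {EW HW W : Type*} [NormedAddCommGroup EW] [NormedSpace ℝ EW] [CompleteSpace EW]
  [TopologicalSpace HW] [TopologicalSpace W] [ChartedSpace HW W]
  {J : ModelWithCorners ℝ EW HW} [J.Boundaryless] [IsManifold J ∞ W]
  {D : AlgebroidData I A} {f : W → N}
  (e : Trivialization F (π F A)) [MemTrivializationAtlas e]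

theorem prolFiber_ext {w : W} (hw : f w ∈ e.baseSet) {u v : D.prolFiber J f w}
    (h : (e ⟨f w, u.1.1⟩).2 = (e ⟨f w, v.1.1⟩).2) (h' : u.1.2 = v.1.2) : u = v :=
  Subtype.ext (Prod.ext (snd_injective e hw h) h')

/-- All ingredients of the pair depend on germs only. No smoothness is needed, because the two
brackets take the default value `0` simultaneously. -/
theorem prolBracket_congr {X X' Y Y' : ∀ w, D.prolFiber J f w} {w : W}
    (hX : ∀ᶠ y in 𝓝 w, X y = X' y) (hY : ∀ᶠ y in 𝓝 w, Y y = Y' y) :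
    D.prolBracket J f F X Y w = D.prolBracket J f F X' Y' w := by
  have h : ∀ {X X' : ∀ w, D.prolFiber J f w}, (∀ᶠ y in 𝓝 w, X y = X' y) →
      components F w X =ᶠ[𝓝 w] components F w X' := by
    intro X X' hX
    filter_upwards [hX] with y hy
    unfold components
    rw [hy]
  have h' : ∀ {X X' : ∀ w, D.prolFiber J f w}, (∀ᶠ y in 𝓝 w, X y = X' y) →
      (fun y => (X y).1.2) =ᶠ[𝓝 w] fun y => (X' y).1.2 := by
    intro X X' hX
    filter_upwards [hX] with y hy
    rw [hy]
  have hpair : D.prolBracketPair J f F X Y w = D.prolBracketPair J f F X' Y' w := by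
    unfold prolBracketPair
    rw [dirDeriv_congr (h hX), dirDeriv_congr (h hY), (h hX).self_of_nhds, (h hY).self_of_nhds,
      hX.self_of_nhds, hY.self_of_nhds, (h' hX).mlieBracket_vectorField_eq (h' hY)]
  unfold prolBracket
  by_cases hm : D.prolBracketPair J f F X Y w ∈ D.prolFiber J f w
  · rw [dif_pos hm, dif_pos (hpair ▸ hm)]
    exact Subtype.ext hpair
  · rw [dif_neg hm, dif_neg (hpair ▸ hm)]

variable [FiniteDimensional ℝ F] (hD : D.IsLie (SmoothSec I F)) (hf : ContMDiff J I ∞ f)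
include hD hf

/-- Both tangent vectors at `f w` are tested on functions `g`. Differentiating `g ∘ f` along two
sections differentiates either the coefficients of the second section or the functions (ρ e_i)(g).
After antisymmetrization the former give the derivative part of the bracket, and the latter give its
structure part because the anchor of `A` respects brackets of frame sections. -/
theorem prolBracketPair_mem {X Y : ∀ w, D.prolFiber J f w} {w : W} (hX : SmoothNear F X w)
    (hY : SmoothNear F Y w) : D.prolBracketPair J f F X Y w ∈ D.prolFiber J f w := by
  rw [mem_prolFiber]
  refine eq_of_dirDeriv_eq fun g hg => ?_
  let e := trivializationAt F A (f w)
  have hw : f w ∈ e.baseSet := FiberBundle.mem_baseSet_trivializationAt' (f w)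
  have hmem := hf.continuous.continuousAt.preimage_mem_nhds (e.open_baseSet.mem_nhds hw)
  have hc : ∀ c, SmoothSec I F (fun y => e.symm y c) (f w) := fun c => .symm e hw (.const c)
  -- The derivative of `g` along the anchor of the frame section with constant coefficients `c`.
  let K : N → F → ℝ := fun y c => dirDeriv I g y (D.anchor y (e.symm y c))
  have hK : ∀ y ∈ e.baseSet, IsLinearMap ℝ (K y) := fun y hy =>
    (((mfderiv I 𝓘(ℝ, ℝ) g y).toLinearMap.comp (D.anchor y)).comp
      (isLinearMap_symm e hy).mk').isLinear
  have hKs : ∀ c, ContMDiffNear I 𝓘(ℝ, ℝ) (fun y => K y c) (f w) := fun c =>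
    hg.dirDeriv (hD.anchor_smooth (hc c))
  have hgf : ContMDiffNear J 𝓘(ℝ, ℝ) (fun y => g (f y)) w := hg.comp (.of_contMDiff hf)
  have hfd := hf.mdifferentiable (by simp)
  have key : ∀ X Y : ∀ w, D.prolFiber J f w, SmoothNear F Y w →
      dirDeriv J (fun y => dirDeriv J (fun y => g (f y)) y (Y y).1.2) w (X w).1.2 =
        dirDeriv I (fun y => K y (comp e Y w)) (f w) (D.anchor (f w) (X w).1.1) +
          K (f w) (dirDeriv J (comp e Y) w (X w).1.2) := by
    intro X Y hY
    have h1 : (fun y => dirDeriv J (fun y => g (f y)) y (Y y).1.2) =ᶠ[𝓝 w]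
        fun y => K (f y) (comp e Y y) := by
      filter_upwards [hmem, hf.continuous.continuousAt.eventually hg.eventually] with y hy hy'
      rw [dirDeriv_comp hy'.mdifferentiableAt (hfd y), ← (D.mem_prolFiber J f _).1 (Y y).2]
      simp only [K]
      rw [symm_comp e hy]
    have h2 : ∀ᶠ y in 𝓝 w, IsLinearMap ℝ (K (f y)) := by
      filter_upwards [hmem] with y hy using hK _ hy
    rw [dirDeriv_congr h1, dirDeriv_apply_of_isLinearMap (K := fun y => K (f y)) h2
      (fun c => (hKs c).comp (.of_contMDiff hf)) (hY.comp e hf.continuous hw),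
      dirDeriv_comp (k := fun y => K y (comp e Y w)) (hKs _).mdifferentiableAt (hfd w),
      ← (D.mem_prolFiber J f _).1 (X w).2]
  have hL : dirDeriv I g (f w) (D.anchor (f w) (D.prolBracketPair J f F X Y w).1) =
      K (f w) (dirDeriv J (comp e Y) w (X w).1.2 - dirDeriv J (comp e X) w (Y w).1.2 +
        D.frameCoeff e (f w) (comp e X w) (comp e Y w)) := by
    rw [prolBracketPair_fst e hD hf hX hY hw]
  -- The anchor law for frame sections whose constant coefficients are the values of the components
  -- at `w`.
  have hΓ : K (f w) (D.frameCoeff e (f w) (comp e X w) (comp e Y w)) =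
      dirDeriv I (fun y => K y (comp e Y w)) (f w) (D.anchor (f w) (X w).1.1) -
      dirDeriv I (fun y => K y (comp e X w)) (f w) (D.anchor (f w) (Y w).1.1) := by
    simp only [K]
    rw [symm_frameCoeff e hw, hD.anchor_bracket (hc _) (hc _) hg, symm_comp e hw, symm_comp e hw]
  rw [hL, (hK _ hw).map_add, (hK _ hw).map_sub, hΓ]
  refine Eq.trans ?_ (dirDeriv_comp hg.mdifferentiableAt (hfd w) _)
  change _ = dirDeriv J (fun y => g (f y)) w
    (VectorField.mlieBracket J (fun w' => (X w').1.2) (fun w' => (Y w').1.2) w)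
  rw [dirDeriv_mlieBracket hgf hX.vectorField hY.vectorField, key X Y hY, key Y X hX]
  ring

theorem coe_prolBracket {X Y : ∀ w, D.prolFiber J f w} {w : W} (hX : SmoothNear F X w)
    (hY : SmoothNear F Y w) :
    (D.prolBracket J f F X Y w).1 = D.prolBracketPair J f F X Y w := by
  unfold prolBracket
  rw [dif_pos (prolBracketPair_mem hD hf hX hY)]

theorem comp_prolBracket {X Y : ∀ w, D.prolFiber J f w} {w : W} (hX : SmoothNear F X w)
    (hY : SmoothNear F Y w) (hw : f w ∈ e.baseSet) :
    comp e (D.prolBracket J f F X Y) w =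
      dirDeriv J (comp e Y) w (X w).1.2 - dirDeriv J (comp e X) w (Y w).1.2 +
        D.frameCoeff e (f w) (comp e X w) (comp e Y w) := by
  unfold comp
  rw [coe_prolBracket hD hf hX hY, prolBracketPair_fst e hD hf hX hY hw, snd_symm e hw]
  rfl

theorem prolBracket_snd {X Y : ∀ w, D.prolFiber J f w} {w : W} (hX : SmoothNear F X w)
    (hY : SmoothNear F Y w) :
    (D.prolBracket J f F X Y w).1.2 =
      VectorField.mlieBracket J (fun w' => (X w').1.2) (fun w' => (Y w').1.2) w := by
  rw [coe_prolBracket hD hf hX hY]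
  rfl

omit hD hf in
theorem SmoothNear.eventually {X : ∀ w, D.prolFiber J f w} {w : W}
    (hX : SmoothNear F X w) : ∀ᶠ y in 𝓝 w, SmoothNear F X y :=
  eventually_eventually_nhds.2 hX

omit hD hf in
theorem _root_.ContMDiffNear.mlieBracket {U V : ∀ w, TangentSpace J w} {w : W}
    (hU : ContMDiffNear J J.tangent (fun w => (⟨w, U w⟩ : TangentBundle J W)) w)
    (hV : ContMDiffNear J J.tangent (fun w => (⟨w, V w⟩ : TangentBundle J W)) w) :
    ContMDiffNear J J.tangent
      (fun w => (⟨w, VectorField.mlieBracket J U V w⟩ : TangentBundle J W)) w := by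
  have : IsManifold J (minSmoothness ℝ 2) W := .of_le (n := ∞) (by simp; norm_cast)
  have : IsManifold J ((⊤ : ℕ∞) + 1) W := .of_le (n := ∞) (by norm_cast)
  filter_upwards [hU, hV] with y h h'
  exact ContMDiffAt.mlieBracket_vectorField (m := ⊤) (n := ⊤) h h' (by simp)

omit hD in
theorem SmoothNear.add {X Y : ∀ w, D.prolFiber J f w} {w : W} (hX : SmoothNear F X w)
    (hY : SmoothNear F Y w) : SmoothNear F (fun y => X y + Y y) w := by
  let e := trivializationAt F A (f w)
  have hw : f w ∈ e.baseSet := FiberBundle.mem_baseSet_trivializationAt' (f w)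
  refine .of_comp e hf hw
    (((hX.comp e hf.continuous hw).add (hY.comp e hf.continuous hw)).congr ?_) ?_
  · filter_upwards [hf.continuous.continuousAt.preimage_mem_nhds (e.open_baseSet.mem_nhds hw)]
      with y hy using (isLinearMap_snd e hy).map_add _ _
  · filter_upwards [hX.vectorField, hY.vectorField] with y h h'
    exact h.add_section h'

omit hD in
theorem SmoothNear.smul {X : ∀ w, D.prolFiber J f w} {g : W → ℝ} {w : W}
    (hg : ContMDiffNear J 𝓘(ℝ, ℝ) g w) (hX : SmoothNear F X w) :
    SmoothNear F (fun y => g y • X y) w := by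
  let e := trivializationAt F A (f w)
  have hw : f w ∈ e.baseSet := FiberBundle.mem_baseSet_trivializationAt' (f w)
  refine .of_comp e hf hw ((hg.smul (hX.comp e hf.continuous hw)).congr ?_) ?_
  · filter_upwards [hf.continuous.continuousAt.preimage_mem_nhds (e.open_baseSet.mem_nhds hw)]
      with y hy using (isLinearMap_snd e hy).map_smul _ _
  · filter_upwards [hg, hX.vectorField] with y h h'
    exact h.smul_section h'

/-- Smoothness of the coefficients of the bracket of smooth sections. -/
theorem contMDiffNear_frameCoeff_comp {a b : W → F} {w : W} (hw : f w ∈ e.baseSet)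
    (ha : ContMDiffNear J 𝓘(ℝ, F) a w) (hb : ContMDiffNear J 𝓘(ℝ, F) b w) :
    ContMDiffNear J 𝓘(ℝ, F) (fun y => D.frameCoeff e (f y) (a y) (b y)) w := by
  have hmem := hf.continuous.continuousAt.preimage_mem_nhds (e.open_baseSet.mem_nhds hw)
  refine ContMDiffNear.apply_of_isLinearMap (K := fun y q => D.frameCoeff e (f y) (a y) q)
    ?_ (fun c => ?_) hb
  · filter_upwards [hmem] with y hy using hD.isLinearMap_frameCoeff_right e hy _
  · refine ContMDiffNear.apply_of_isLinearMap (K := fun y p => D.frameCoeff e (f y) p c)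
      ?_ (fun d => ?_) ha
    · filter_upwards [hmem] with y hy using hD.isLinearMap_frameCoeff_left e hy _
    · exact (hD.contMDiffNear_frameCoeff e hw d c).comp (.of_contMDiff hf)

/-- A product rule with three factors, the structure functions and the two arguments, obtained by
applying the rule for families of linear maps to one slot at a time. -/
theorem dirDeriv_frameCoeff_comp {a b : W → F} {w : W} (hw : f w ∈ e.baseSet)
    (ha : ContMDiffNear J 𝓘(ℝ, F) a w) (hb : ContMDiffNear J 𝓘(ℝ, F) b w)
    (v : TangentSpace J w) :
    dirDeriv J (fun y => D.frameCoeff e (f y) (a y) (b y)) w v =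
      dirDeriv I (fun y => D.frameCoeff e y (a w) (b w)) (f w) (mfderiv J I f w v) +
        D.frameCoeff e (f w) (dirDeriv J a w v) (b w) +
        D.frameCoeff e (f w) (a w) (dirDeriv J b w v) := by
  have hmem := hf.continuous.continuousAt.preimage_mem_nhds (e.open_baseSet.mem_nhds hw)
  rw [dirDeriv_apply_of_isLinearMap (K := fun y q => D.frameCoeff e (f y) (a y) q)
    (by filter_upwards [hmem] with y hy using hD.isLinearMap_frameCoeff_right e hy _)
    (fun c => contMDiffNear_frameCoeff_comp e hD hf hw ha (.const c)) hb,
    dirDeriv_apply_of_isLinearMap (K := fun y p => D.frameCoeff e (f y) p (b w))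
    (by filter_upwards [hmem] with y hy using hD.isLinearMap_frameCoeff_left e hy _)
    (fun c => contMDiffNear_frameCoeff_comp e hD hf hw (.const c) (.const _)) ha,
    dirDeriv_comp (k := fun y => D.frameCoeff e y (a w) (b w))
      (hD.contMDiffNear_frameCoeff e hw _ _).mdifferentiableAt (hf.mdifferentiable (by simp) w)]

theorem smoothNear_prolBracket {X Y : ∀ w, D.prolFiber J f w} {w : W} (hX : SmoothNear F X w)
    (hY : SmoothNear F Y w) : SmoothNear F (D.prolBracket J f F X Y) w := by
  let e := trivializationAt F A (f w)
  have hw : f w ∈ e.baseSet := FiberBundle.mem_baseSet_trivializationAt' (f w)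
  have hmem := hf.continuous.continuousAt.preimage_mem_nhds (e.open_baseSet.mem_nhds hw)
  have ha := hX.comp e hf.continuous hw
  have hb := hY.comp e hf.continuous hw
  refine .of_comp e hf hw ?_ ?_
  · refine (((hb.dirDeriv hX.vectorField).sub (ha.dirDeriv hY.vectorField)).add
      (contMDiffNear_frameCoeff_comp e hD hf hw ha hb)).congr ?_
    filter_upwards [hmem, hX.eventually, hY.eventually] with y hy h h'
    exact comp_prolBracket e hD hf h h' hy
  · refine (hX.vectorField.mlieBracket hY.vectorField).congr ?_
    filter_upwards [hX.eventually, hY.eventually] with y h h'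
    rw [prolBracket_snd hD hf h h']

theorem prolBracket_skew {X Y : ∀ w, D.prolFiber J f w} {w : W} (hX : SmoothNear F X w)
    (hY : SmoothNear F Y w) : D.prolBracket J f F X Y w = - D.prolBracket J f F Y X w := by
  let e := trivializationAt F A (f w)
  have hw : f w ∈ e.baseSet := FiberBundle.mem_baseSet_trivializationAt' (f w)
  refine prolFiber_ext e hw ?_ ?_
  · have h1 := comp_prolBracket e hD hf hX hY hw
    have h2 := comp_prolBracket e hD hf hY hX hw
    rw [hD.frameCoeff_skew e hw] at h2
    refine h1.trans (Eq.trans ?_ ((isLinearMap_snd e hw).map_neg _).symm)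
    change _ = - comp e (D.prolBracket J f F Y X) w
    rw [h2]
    abel
  · rw [prolBracket_snd hD hf hX hY]
    refine (VectorField.mlieBracket_swap_apply).trans ?_
    rw [← prolBracket_snd hD hf hY hX]
    rfl

theorem prolBracket_add {X Y Z : ∀ w, D.prolFiber J f w} {w : W} (hX : SmoothNear F X w)
    (hY : SmoothNear F Y w) (hZ : SmoothNear F Z w) (hYZ : SmoothNear F (fun y => Y y + Z y) w) :
    D.prolBracket J f F X (fun y => Y y + Z y) w =
      D.prolBracket J f F X Y w + D.prolBracket J f F X Z w := by
  let e := trivializationAt F A (f w)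
  have hw : f w ∈ e.baseSet := FiberBundle.mem_baseSet_trivializationAt' (f w)
  have hmem := hf.continuous.continuousAt.preimage_mem_nhds (e.open_baseSet.mem_nhds hw)
  refine prolFiber_ext e hw ?_ ?_
  · refine Eq.trans ?_ ((isLinearMap_snd e hw).map_add _ _).symm
    change comp e (D.prolBracket J f F X (fun y => Y y + Z y)) w =
      comp e (D.prolBracket J f F X Y) w + comp e (D.prolBracket J f F X Z) w
    have h : comp e (fun y => Y y + Z y) =ᶠ[𝓝 w] fun y => comp e Y y + comp e Z y := by
      filter_upwards [hmem] with y hy using (isLinearMap_snd e hy).map_add _ _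
    rw [comp_prolBracket e hD hf hX hYZ hw, comp_prolBracket e hD hf hX hY hw,
      comp_prolBracket e hD hf hX hZ hw, dirDeriv_congr h, h.self_of_nhds,
      dirDeriv_add (hY.comp e hf.continuous hw).mdifferentiableAt
        (hZ.comp e hf.continuous hw).mdifferentiableAt,
      (hD.isLinearMap_frameCoeff_right e hw _).map_add]
    have h' : dirDeriv J (comp e X) w (Y w + Z w).1.2 =
        dirDeriv J (comp e X) w (Y w).1.2 + dirDeriv J (comp e X) w (Z w).1.2 :=
      dirDeriv_vadd _ _ _
    rw [h']
    abel
  · have : IsManifold J 2 W := .of_le (n := ∞) (by norm_cast)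
    have h1 := prolBracket_snd hD hf hX hYZ
    have h2 := VectorField.mlieBracket_add_right (I := J) (V := fun w' => (X w').1.2)
      hY.vectorField.mdifferentiableAt hZ.vectorField.mdifferentiableAt
    refine (h1.trans h2).trans ?_
    rw [← prolBracket_snd hD hf hX hY, ← prolBracket_snd hD hf hX hZ]
    rfl

theorem prolBracket_smul {X Y : ∀ w, D.prolFiber J f w} {g : W → ℝ} {w : W}
    (hX : SmoothNear F X w) (hY : SmoothNear F Y w) (hg : ContMDiffNear J 𝓘(ℝ, ℝ) g w)
    (hgY : SmoothNear F (fun y => g y • Y y) w) :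
    D.prolBracket J f F X (fun y => g y • Y y) w =
      g w • D.prolBracket J f F X Y w + dirDeriv J g w (X w).1.2 • Y w := by
  let e := trivializationAt F A (f w)
  have hw : f w ∈ e.baseSet := FiberBundle.mem_baseSet_trivializationAt' (f w)
  have hmem := hf.continuous.continuousAt.preimage_mem_nhds (e.open_baseSet.mem_nhds hw)
  refine prolFiber_ext e hw ?_ ?_
  · have h1 : (e ⟨f w, (g w • D.prolBracket J f F X Y w +
        dirDeriv J g w (X w).1.2 • Y w : D.prolFiber J f w).1.1⟩).2 =
        g w • comp e (D.prolBracket J f F X Y) w + dirDeriv J g w (X w).1.2 • comp e Y w := by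
      refine ((isLinearMap_snd e hw).map_add _ _).trans ?_
      exact congrArg₂ _ ((isLinearMap_snd e hw).map_smul _ _) ((isLinearMap_snd e hw).map_smul _ _)
    rw [h1]
    change comp e (D.prolBracket J f F X (fun y => g y • Y y)) w = _
    have h : comp e (fun y => g y • Y y) =ᶠ[𝓝 w] fun y => g y • comp e Y y := by
      filter_upwards [hmem] with y hy using (isLinearMap_snd e hy).map_smul _ _
    rw [comp_prolBracket e hD hf hX hgY hw, comp_prolBracket e hD hf hX hY hw, dirDeriv_congr h,
      h.self_of_nhds, dirDeriv_smul hg.mdifferentiableAt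
        (hY.comp e hf.continuous hw).mdifferentiableAt,
      (hD.isLinearMap_frameCoeff_right e hw _).map_smul]
    have h' : dirDeriv J (comp e X) w (g w • Y w).1.2 =
        g w • dirDeriv J (comp e X) w (Y w).1.2 := dirDeriv_vsmul _ _ _
    rw [h', smul_add, smul_sub]
    abel
  · have : IsManifold J 2 W := .of_le (n := ∞) (by norm_cast)
    have h1 := prolBracket_snd hD hf hX hgY
    have h2 := VectorField.mlieBracket_smul_right (I := J) (V := fun w' => (X w').1.2)
      hg.mdifferentiableAt hY.vectorField.mdifferentiableAt
    refine (h1.trans h2).trans ?_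
    rw [← prolBracket_snd hD hf hX hY, add_comm]
    rfl

/-- The component along `T W` is Jacobi for vector fields. The component along `A` is expanded in a
frame: second derivatives of the coefficients cancel cyclically, the terms pairing a first
derivative with a coefficient cancel by skew-symmetry of the structure functions, and the rest is
`frameCoeff_jacobi`. -/
theorem prolBracket_jacobi {X Y Z : ∀ w, D.prolFiber J f w} {w : W} (hX : SmoothNear F X w)
    (hY : SmoothNear F Y w) (hZ : SmoothNear F Z w) :
    D.prolBracket J f F (D.prolBracket J f F X Y) Z w +
      D.prolBracket J f F (D.prolBracket J f F Y Z) X w +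
      D.prolBracket J f F (D.prolBracket J f F Z X) Y w = 0 := by
  let e := trivializationAt F A (f w)
  have hw : f w ∈ e.baseSet := FiberBundle.mem_baseSet_trivializationAt' (f w)
  have hmem := hf.continuous.continuousAt.preimage_mem_nhds (e.open_baseSet.mem_nhds hw)
  refine prolFiber_ext e hw ?_ ?_
  · have h1 : ∀ X Y Z : D.prolFiber J f w, (e ⟨f w, (X + Y + Z).1.1⟩).2 =
        (e ⟨f w, X.1.1⟩).2 + (e ⟨f w, Y.1.1⟩).2 + (e ⟨f w, Z.1.1⟩).2 := by
      intro X Y Z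
      refine ((isLinearMap_snd e hw).map_add _ _).trans ?_
      exact congrArg (· + _) ((isLinearMap_snd e hw).map_add _ _)
    refine (h1 _ _ _).trans (Eq.trans ?_ (isLinearMap_snd e hw).map_zero.symm)
    have key : ∀ {X Y Z : ∀ w, D.prolFiber J f w}, SmoothNear F X w → SmoothNear F Y w →
        SmoothNear F Z w →
        (e ⟨f w, (D.prolBracket J f F (D.prolBracket J f F X Y) Z w).1.1⟩).2 =
        dirDeriv J (fun y => dirDeriv J (comp e Z) y (Y y).1.2) w (X w).1.2 -
          dirDeriv J (fun y => dirDeriv J (comp e Z) y (X y).1.2) w (Y w).1.2 -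
          (dirDeriv J (fun y => dirDeriv J (comp e Y) y (X y).1.2) w (Z w).1.2 -
            dirDeriv J (fun y => dirDeriv J (comp e X) y (Y y).1.2) w (Z w).1.2 +
            (dirDeriv I (fun y => D.frameCoeff e y (comp e X w) (comp e Y w)) (f w)
                (D.anchor (f w) (e.symm (f w) (comp e Z w))) -
              D.frameCoeff e (f w) (comp e Y w) (dirDeriv J (comp e X) w (Z w).1.2) +
              D.frameCoeff e (f w) (comp e X w) (dirDeriv J (comp e Y) w (Z w).1.2))) +
          (-D.frameCoeff e (f w) (comp e Z w) (dirDeriv J (comp e Y) w (X w).1.2) +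
            D.frameCoeff e (f w) (comp e Z w) (dirDeriv J (comp e X) w (Y w).1.2) +
            D.frameCoeff e (f w) (D.frameCoeff e (f w) (comp e X w) (comp e Y w))
              (comp e Z w)) := by
      intro X Y Z hX hY hZ
      have ha := hX.comp e hf.continuous hw
      have hb := hY.comp e hf.continuous hw
      have hc := hZ.comp e hf.continuous hw
      have hXY := smoothNear_prolBracket hD hf hX hY
      have hcomp : comp e (D.prolBracket J f F X Y) =ᶠ[𝓝 w] fun w =>
          (dirDeriv J (comp e Y) w (X w).1.2 - dirDeriv J (comp e X) w (Y w).1.2) +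
          D.frameCoeff e (f w) (comp e X w) (comp e Y w) := by
        filter_upwards [hmem, hX.eventually, hY.eventually] with y hy h h'
        exact comp_prolBracket e hD hf h h' hy
      have hL := hD.isLinearMap_frameCoeff_left e hw (comp e Z w)
      refine (comp_prolBracket e hD hf hXY hZ hw).trans ?_
      rw [prolBracket_snd hD hf hX hY, dirDeriv_mlieBracket hc hX.vectorField hY.vectorField,
        dirDeriv_congr hcomp, hcomp.self_of_nhds,
        dirDeriv_add ((hb.dirDeriv hX.vectorField).sub
          (ha.dirDeriv hY.vectorField)).mdifferentiableAt
          (contMDiffNear_frameCoeff_comp e hD hf hw ha hb).mdifferentiableAt,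
        dirDeriv_sub (hb.dirDeriv hX.vectorField).mdifferentiableAt
          (ha.dirDeriv hY.vectorField).mdifferentiableAt,
        dirDeriv_frameCoeff_comp e hD hf hw ha hb, hL.map_add, hL.map_sub,
        ← (D.mem_prolFiber J f _).1 (Z w).2, symm_comp e hw,
        hD.frameCoeff_skew e hw (dirDeriv J (comp e X) w (Z w).1.2),
        hD.frameCoeff_skew e hw (dirDeriv J (comp e Y) w (X w).1.2),
        hD.frameCoeff_skew e hw (dirDeriv J (comp e X) w (Y w).1.2)]
      abel
    rw [key hX hY hZ, key hY hZ hX, key hZ hX hY]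
    -- The target `0` is replaced by the structure identity, after which both sides agree term by
    -- term.
    rw [← hD.frameCoeff_jacobi e hw (comp e X w) (comp e Y w) (comp e Z w)]
    abel
  · have : IsManifold J (minSmoothness ℝ 3) W := .of_le (n := ∞) (by simp; norm_cast)
    have : IsManifold J 2 W := .of_le (n := ∞) (by norm_cast)
    have hle : minSmoothness ℝ 2 ≤ ∞ := by simp; norm_cast
    have h1 := VectorField.leibniz_identity_mlieBracket_apply (I := J) (x := w)
      (U := fun w => (X w).1.2) (V := fun w => (Y w).1.2) (W := fun w => (Z w).1.2)
      (hX.vectorField.contMDiffAt.of_le hle) (hY.vectorField.contMDiffAt.of_le hle)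
      (hZ.vectorField.contMDiffAt.of_le hle)
    have key : ∀ {X Y Z : ∀ w, D.prolFiber J f w}, SmoothNear F X w → SmoothNear F Y w →
        SmoothNear F Z w → (D.prolBracket J f F (D.prolBracket J f F X Y) Z w).1.2 =
        VectorField.mlieBracket J (VectorField.mlieBracket J (fun w => (X w).1.2)
          (fun w => (Y w).1.2)) (fun w => (Z w).1.2) w := by
      intro X Y Z hX hY hZ
      rw [prolBracket_snd hD hf (smoothNear_prolBracket hD hf hX hY) hZ]
      refine Filter.EventuallyEq.mlieBracket_vectorField_eq ?_ .rfl
      filter_upwards [hX.eventually, hY.eventually] with y h h'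
      exact prolBracket_snd hD hf h h'
    change (D.prolBracket J f F (D.prolBracket J f F X Y) Z w).1.2 +
      (D.prolBracket J f F (D.prolBracket J f F Y Z) X w).1.2 +
      (D.prolBracket J f F (D.prolBracket J f F Z X) Y w).1.2 = 0
    rw [key hX hY hZ, key hY hZ hX, key hZ hX hY]
    -- The identity for vector fields is in derivation form; swaps bring the cyclic sum to that
    -- form, and the sign inside the nested bracket is pulled out as the constant `-1`.
    rw [VectorField.mlieBracket_swap_apply (V := VectorField.mlieBracket J (fun w => (Y w).1.2)
      (fun w => (Z w).1.2)), h1, VectorField.mlieBracket_swap_apply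
      (V := VectorField.mlieBracket J (fun w => (Z w).1.2) (fun w => (X w).1.2)),
      VectorField.mlieBracket_swap (V := fun w => (Z w).1.2) (W := fun w => (X w).1.2)]
    have h2 := VectorField.mlieBracket_const_smul_right (I := J) (x := w) (c := (-1 : ℝ))
      (V := fun w => (Y w).1.2) (hX.vectorField.mlieBracket hZ.vectorField).mdifferentiableAt
    rw [neg_one_smul, neg_one_smul] at h2
    rw [h2]
    abel

/-- The prolongation of a Lie algebroid is a Lie algebroid. -/
theorem IsLie.prolongation : (D.prolongation J f F).IsLie (SmoothNear F) where
  anchor_smooth hX := hX.vectorField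
  congr hX hY := prolBracket_congr hX hY
  smooth hX hY := smoothNear_prolBracket hD hf hX hY
  skew hX hY := prolBracket_skew hD hf hX hY
  add hX hY hZ := prolBracket_add hD hf hX hY hZ (hY.add hf hZ)
  leibniz hX hY hg := prolBracket_smul hD hf hX hY hg (.smul hf hg hY)
  anchor_bracket := by
    intro X Y w g hX hY hg
    refine (congrArg (dirDeriv J g w) (prolBracket_snd hD hf hX hY)).trans ?_
    exact dirDeriv_mlieBracket hg hX.vectorField hY.vectorField
  jacobi hX hY hZ := prolBracket_jacobi hD hf hX hY hZ

end Prolongation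

end AlgebroidData

/-! ## The local laws of a Lie algebroid -/

namespace LieAlgebroid

variable {B F M : Type*} {E : M → Type*}
  [NormedAddCommGroup B] [NormedSpace ℝ B] [NormedAddCommGroup F] [NormedSpace ℝ F]
  [TopologicalSpace M] [ChartedSpace B M] [IsManifold 𝓘(ℝ, B) ∞ M]
  [TopologicalSpace (TotalSpace F E)] [∀ x, TopologicalSpace (E x)]
  [∀ x, AddCommGroup (E x)] [∀ x, Module ℝ (E x)] [FiberBundle F E] [VectorBundle ℝ F E]
  [ContMDiffVectorBundle ∞ F E 𝓘(ℝ, B)]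
  [FiniteDimensional ℝ B] [T2Space M]
  (A : LieAlgebroid B F E)

/-- The source of every passage from local to global data below; Hausdorffness and finite dimension
of `M` enter here. -/
theorem exists_bump {x : M} {s : Set M} (hs : s ∈ 𝓝 x) :
    ∃ f : C^∞⟮𝓘(ℝ, B), M; ℝ⟯, tsupport f ⊆ s ∧ ∀ᶠ y in 𝓝 x, f y = 1 := by
  obtain ⟨f, -, hf⟩ := (SmoothBumpFunction.nhds_basis_tsupport (I := 𝓘(ℝ, B)) x).mem_iff.1 hs
  exact ⟨⟨f, f.contMDiff⟩, hf, f.eventuallyEq_one⟩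

/-- The bracket of a `LieAlgebroid` accepts global sections only, so a local section is cut off by a
bump function equal to 1 near `x`. -/
theorem exists_section_eq {X : ∀ x, E x} {x : M} (hX : SmoothSec 𝓘(ℝ, B) F X x) :
    ∃ X' : Cₛ^∞⟮𝓘(ℝ, B); F, E⟯, ∀ᶠ y in 𝓝 x, X' y = X y := by
  obtain ⟨s, hs, hxs, hXs⟩ := ContMDiffNear.exists_open hX
  obtain ⟨f, hf, hf1⟩ := exists_bump (B := B) (hs.mem_nhds hxs)
  refine ⟨⟨fun y => f y • X y,
    ContMDiffOn.smul_section_of_tsupport f.contMDiff.contMDiffOn hs hf hXs⟩, ?_⟩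
  filter_upwards [hf1] with y hy
  change f y • X y = X y
  rw [hy, one_smul]

theorem exists_function_eq {g : M → ℝ} {x : M} (hg : ContMDiffNear 𝓘(ℝ, B) 𝓘(ℝ, ℝ) g x) :
    ∃ g' : C^∞⟮𝓘(ℝ, B), M; ℝ⟯, ∀ᶠ y in 𝓝 x, g' y = g y := by
  obtain ⟨s, hs, hxs, hgs⟩ := ContMDiffNear.exists_open hg
  obtain ⟨f, hf, hf1⟩ := exists_bump (B := B) (hs.mem_nhds hxs)
  refine ⟨⟨fun y => f y • g y, contMDiff_of_tsupport fun y hy => ?_⟩, ?_⟩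
  · exact f.contMDiff.contMDiffAt.smul
      (hgs.contMDiffAt (hs.mem_nhds (hf (tsupport_smul_subset_left _ _ hy))))
  · filter_upwards [hf1] with y hy
    change f y • g y = g y
    rw [hy, one_smul]

/-- The product of a function and a section. -/
noncomputable def smulSection (g : C^∞⟮𝓘(ℝ, B), M; ℝ⟯) (X : Cₛ^∞⟮𝓘(ℝ, B); F, E⟯) :
    Cₛ^∞⟮𝓘(ℝ, B); F, E⟯ :=
  ⟨fun y => g y • X y, g.contMDiff.smul_section X.contMDiff⟩

theorem bracket_smulSection (X Y : Cₛ^∞⟮𝓘(ℝ, B); F, E⟯) (g : C^∞⟮𝓘(ℝ, B), M; ℝ⟯) (x : M) :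
    A.bracket X (smulSection g Y) x =
      g x • A.bracket X Y x + dirDeriv 𝓘(ℝ, B) g x (A.anchor x (X x)) • Y x :=
  A.leibniz X Y _ g (fun _ => rfl) x

theorem bracket_skew (X Y : Cₛ^∞⟮𝓘(ℝ, B); F, E⟯) : A.bracket X Y = - A.bracket Y X := by
  have h := A.bracket_self (X + Y)
  simp only [map_add, LinearMap.add_apply, A.bracket_self, zero_add, add_zero] at h
  exact eq_neg_of_add_eq_zero_right h

/-- Locality from Leibniz: choose `f` equal to 1 near `x` and supported where `Y` vanishes. Then `f
Y = 0`, and the Leibniz expansion of its bracket at `x` is the bracket of `X` and `Y`, since `Y x =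
0`. -/
theorem bracket_eq_zero {X Y : Cₛ^∞⟮𝓘(ℝ, B); F, E⟯} {x : M} (hY : ∀ᶠ y in 𝓝 x, Y y = 0) :
    A.bracket X Y x = 0 := by
  obtain ⟨f, hf, hf1⟩ := exists_bump (B := B) hY
  have h0 : smulSection f Y = 0 := by
    ext y
    change f y • Y y = 0
    by_cases hy : y ∈ tsupport f
    · have : Y y = 0 := hf hy
      rw [this, smul_zero]
    · rw [image_eq_zero_of_notMem_tsupport hy, zero_smul]
  have h := A.bracket_smulSection X Y f x
  rw [h0, map_zero, hf1.self_of_nhds, hY.self_of_nhds, smul_zero, add_zero, one_smul] at h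
  exact h.symm

theorem bracket_congr {X X' Y Y' : Cₛ^∞⟮𝓘(ℝ, B); F, E⟯} {x : M} (hX : ∀ᶠ y in 𝓝 x, X y = X' y)
    (hY : ∀ᶠ y in 𝓝 x, Y y = Y' y) : A.bracket X Y x = A.bracket X' Y' x := by
  have h : ∀ (X : Cₛ^∞⟮𝓘(ℝ, B); F, E⟯) {Y Y' : Cₛ^∞⟮𝓘(ℝ, B); F, E⟯},
      (∀ᶠ y in 𝓝 x, Y y = Y' y) → A.bracket X Y x = A.bracket X Y' x := by
    intro X Y Y' hY
    have h1 : A.bracket X (Y - Y') x = 0 := A.bracket_eq_zero (by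
      filter_upwards [hY] with y hy
      change Y y - Y' y = 0
      rw [hy, sub_self])
    rw [map_sub] at h1
    exact sub_eq_zero.1 h1
  rw [h X hY, A.bracket_skew X, A.bracket_skew X']
  exact congrArg Neg.neg (h Y' hX)

/-- By locality all pairs of global extensions give the same value, so the choice in `toData` is
determined as soon as one pair exists. -/
theorem toData_bracket {X Y : ∀ x, E x} {X' Y' : Cₛ^∞⟮𝓘(ℝ, B); F, E⟯} {x : M}
    (hX : ∀ᶠ y in 𝓝 x, X' y = X y) (hY : ∀ᶠ y in 𝓝 x, Y' y = Y y) :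
    A.toData.bracket X Y x = A.bracket X' Y' x := by
  have h : ∃ r : E x, ∀ X' Y' : Cₛ^∞⟮𝓘(ℝ, B); F, E⟯,
      (∀ᶠ y in 𝓝 x, X' y = X y) → (∀ᶠ y in 𝓝 x, Y' y = Y y) → A.bracket X' Y' x = r := by
    refine ⟨A.bracket X' Y' x, fun X₁ Y₁ h1 h2 => A.bracket_congr ?_ ?_⟩
    · filter_upwards [h1, hX] with y hy hy' using hy.trans hy'.symm
    · filter_upwards [h2, hY] with y hy hy' using hy.trans hy'.symm
  exact (Classical.epsilon_spec h X' Y' hX hY).symm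

/-- Sections with equal germs have the same global extensions, so the choices are made from
identical predicates; this covers sections without any smooth extension. -/
theorem toData_bracket_congr {X X' Y Y' : ∀ x, E x} {x : M} (hX : ∀ᶠ y in 𝓝 x, X y = X' y)
    (hY : ∀ᶠ y in 𝓝 x, Y y = Y' y) : A.toData.bracket X Y x = A.toData.bracket X' Y' x := by
  have h : ∀ {X X' : ∀ x, E x}, (∀ᶠ y in 𝓝 x, X y = X' y) → ∀ Z : Cₛ^∞⟮𝓘(ℝ, B); F, E⟯,
      ((∀ᶠ y in 𝓝 x, Z y = X y) ↔ (∀ᶠ y in 𝓝 x, Z y = X' y)) := fun hX Z =>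
    eventually_congr (hX.mono fun y hy => by rw [hy])
  unfold toData
  simp only [h hX, h hY]

theorem contMDiff_dirDeriv_anchor (X : Cₛ^∞⟮𝓘(ℝ, B); F, E⟯) (g : C^∞⟮𝓘(ℝ, B), M; ℝ⟯) :
    ContMDiff 𝓘(ℝ, B) 𝓘(ℝ, ℝ) ∞ (fun y => dirDeriv 𝓘(ℝ, B) g y (A.anchor y (X y))) := fun _ =>
  (ContMDiffNear.dirDeriv (.of_contMDiff g.contMDiff)
    (.of_contMDiff (A.contMDiff_anchor.comp X.contMDiff))).contMDiffAt

/-- The derivative of a function along a section. -/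
noncomputable def anchorDeriv (X : Cₛ^∞⟮𝓘(ℝ, B); F, E⟯) (g : C^∞⟮𝓘(ℝ, B), M; ℝ⟯) :
    C^∞⟮𝓘(ℝ, B), M; ℝ⟯ :=
  ⟨fun y => dirDeriv 𝓘(ℝ, B) g y (A.anchor y (X y)), A.contMDiff_dirDeriv_anchor X g⟩

theorem bracket_smulSection_eq (X Y : Cₛ^∞⟮𝓘(ℝ, B); F, E⟯) (g : C^∞⟮𝓘(ℝ, B), M; ℝ⟯) :
    A.bracket X (smulSection g Y) =
      smulSection g (A.bracket X Y) + smulSection (A.anchorDeriv X g) Y := by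
  ext x
  exact A.bracket_smulSection X Y g x

/-- The anchor of a Lie algebroid is compatible with the brackets. -/
theorem anchor_bracket (X Y : Cₛ^∞⟮𝓘(ℝ, B); F, E⟯) (g : C^∞⟮𝓘(ℝ, B), M; ℝ⟯) (x : M) :
    A.anchorDeriv (A.bracket X Y) g x =
      A.anchorDeriv X (A.anchorDeriv Y g) x - A.anchorDeriv Y (A.anchorDeriv X g) x := by
  let e := trivializationAt F E x
  have hx : x ∈ e.baseSet := FiberBundle.mem_baseSet_trivializationAt' x
  -- In rank zero no nonvanishing section is available for the test below, but every anchor is zero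
  -- and both sides vanish.
  rcases subsingleton_or_nontrivial F with hF | hF
  · have h0 : ∀ u : E x, u = 0 := fun u => snd_injective e hx (Subsingleton.elim _ _)
    have h1 : ∀ (Z : Cₛ^∞⟮𝓘(ℝ, B); F, E⟯) (k : C^∞⟮𝓘(ℝ, B), M; ℝ⟯),
        A.anchorDeriv Z k x = 0 := by
      intro Z k
      change dirDeriv 𝓘(ℝ, B) k x (A.anchor x (Z x)) = 0
      rw [h0 (Z x), map_zero, dirDeriv_vzero]
    rw [h1, h1, h1, sub_zero]
  · obtain ⟨c, hc⟩ := exists_ne (0 : F)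
    obtain ⟨Z, hZ⟩ := exists_section_eq (SmoothSec.symm (I := 𝓘(ℝ, B)) e hx
      (ContMDiffNear.const c))
    have hZx : Z x ≠ 0 := by
      rw [hZ.self_of_nhds]
      intro h
      have h1 := snd_symm e hx c
      rw [h, (isLinearMap_snd e hx).map_zero] at h1
      exact hc h1.symm
    -- Jacobi in commutator form, applied to `Z` and to `g Z` with `Z x ≠ 0`. After Leibniz
    -- everything cancels except the difference of the two derivatives of `g`, as a coefficient of
    -- `Z x`.
    have hJ : ∀ Z, A.bracket (A.bracket X Y) Z =
        A.bracket X (A.bracket Y Z) - A.bracket Y (A.bracket X Z) := by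
      intro Z
      have h := A.jacobi X Y Z
      rw [A.bracket_skew Z (A.bracket X Y), A.bracket_skew Z X, map_neg] at h
      rw [eq_comm, ← sub_eq_zero, ← h]
      abel
    have h1 := congrArg (fun s : Cₛ^∞⟮𝓘(ℝ, B); F, E⟯ => s x) (hJ (smulSection g Z))
    have h2 := congrArg (fun s : Cₛ^∞⟮𝓘(ℝ, B); F, E⟯ => s x) (hJ Z)
    simp only [bracket_smulSection_eq, map_add, ContMDiffSection.coe_add, Pi.add_apply,
      ContMDiffSection.coe_sub, Pi.sub_apply] at h1 h2
    have hs : ∀ (k : C^∞⟮𝓘(ℝ, B), M; ℝ⟯) (T : Cₛ^∞⟮𝓘(ℝ, B); F, E⟯),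
      smulSection k T x = k x • T x := fun _ _ => rfl
    simp only [hs, h2] at h1
    have h3 : (A.anchorDeriv (A.bracket X Y) g x -
        (A.anchorDeriv X (A.anchorDeriv Y g) x - A.anchorDeriv Y (A.anchorDeriv X g) x)) • Z x
        = 0 := by
      simp only [sub_smul]
      rw [smul_sub] at h1
      have h4 := sub_eq_zero.2 h1
      rw [← h4]
      abel
    exact sub_eq_zero.1 ((smul_eq_zero.1 h3).resolve_right hZx)

/-- A Lie algebroid satisfies the laws of Lie algebroids for local sections. -/
theorem isLie_toData : A.toData.IsLie (SmoothSec 𝓘(ℝ, B) F) where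
  anchor_smooth hX := (ContMDiffNear.of_contMDiff A.contMDiff_anchor).comp hX
  congr hX hY := A.toData_bracket_congr hX hY
  smooth := by
    intro X Y x hX hY
    obtain ⟨X', hX'⟩ := exists_section_eq hX
    obtain ⟨Y', hY'⟩ := exists_section_eq hY
    refine SmoothSec.congr (X := A.bracket X' Y')
      (ContMDiffNear.of_contMDiff (A.bracket X' Y').contMDiff) ?_
    filter_upwards [eventually_eventually_nhds.2 hX', eventually_eventually_nhds.2 hY']
      with y h h' using A.toData_bracket h h'
  skew := by
    intro X Y x hX hY
    obtain ⟨X', hX'⟩ := exists_section_eq hX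
    obtain ⟨Y', hY'⟩ := exists_section_eq hY
    rw [A.toData_bracket hX' hY', A.toData_bracket hY' hX', A.bracket_skew]
    rfl
  add := by
    intro X Y Z x hX hY hZ
    obtain ⟨X', hX'⟩ := exists_section_eq hX
    obtain ⟨Y', hY'⟩ := exists_section_eq hY
    obtain ⟨Z', hZ'⟩ := exists_section_eq hZ
    have h : ∀ᶠ y in 𝓝 x, (Y' + Z') y = Y y + Z y := by
      filter_upwards [hY', hZ'] with y h h'
      rw [← h, ← h']
      rfl
    rw [A.toData_bracket hX' hY', A.toData_bracket hX' hZ', A.toData_bracket hX' h, map_add]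
    rfl
  leibniz := by
    intro X Y x g hX hY hg
    obtain ⟨X', hX'⟩ := exists_section_eq hX
    obtain ⟨Y', hY'⟩ := exists_section_eq hY
    obtain ⟨g', hg'⟩ := exists_function_eq hg
    have h : ∀ᶠ y in 𝓝 x, smulSection g' Y' y = g y • Y y := by
      filter_upwards [hY', hg'] with y h h'
      rw [← h, ← h']
      rfl
    rw [A.toData_bracket hX' hY', A.toData_bracket hX' h, A.bracket_smulSection,
      dirDeriv_congr hg', hg'.self_of_nhds, hX'.self_of_nhds, hY'.self_of_nhds]
    rfl
  anchor_bracket := by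
    intro X Y x g hX hY hg
    obtain ⟨X', hX'⟩ := exists_section_eq hX
    obtain ⟨Y', hY'⟩ := exists_section_eq hY
    obtain ⟨g', hg'⟩ := exists_function_eq hg
    have key : ∀ {Y : ∀ x, E x} {Y' : Cₛ^∞⟮𝓘(ℝ, B); F, E⟯}, (∀ᶠ y in 𝓝 x, Y' y = Y y) →
        (fun y => dirDeriv 𝓘(ℝ, B) g y (A.anchor y (Y y))) =ᶠ[𝓝 x] A.anchorDeriv Y' g' := by
      intro Y Y' hY'
      filter_upwards [hY', eventually_eventually_nhds.2 hg'] with y h h'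
      rw [← h, ← dirDeriv_congr h']
      rfl
    rw [A.toData_bracket hX' hY']
    change dirDeriv 𝓘(ℝ, B) g x (A.anchor x (A.bracket X' Y' x)) =
      dirDeriv 𝓘(ℝ, B) (fun y => dirDeriv 𝓘(ℝ, B) g y (A.anchor y (Y y))) x (A.anchor x (X x)) -
      dirDeriv 𝓘(ℝ, B) (fun y => dirDeriv 𝓘(ℝ, B) g y (A.anchor y (X y))) x (A.anchor x (Y x))
    rw [dirDeriv_congr (key hX'), dirDeriv_congr (key hY'), ← dirDeriv_congr hg',
      ← hX'.self_of_nhds, ← hY'.self_of_nhds]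
    exact A.anchor_bracket X' Y' g' x
  jacobi := by
    intro X Y Z x hX hY hZ
    obtain ⟨X', hX'⟩ := exists_section_eq hX
    obtain ⟨Y', hY'⟩ := exists_section_eq hY
    obtain ⟨Z', hZ'⟩ := exists_section_eq hZ
    have key : ∀ {X Y : ∀ x, E x} {X' Y' : Cₛ^∞⟮𝓘(ℝ, B); F, E⟯}, (∀ᶠ y in 𝓝 x, X' y = X y) →
        (∀ᶠ y in 𝓝 x, Y' y = Y y) →
        ∀ᶠ y in 𝓝 x, A.bracket X' Y' y = A.toData.bracket X Y y := by
      intro _ _ _ _ hX' hY'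
      filter_upwards [eventually_eventually_nhds.2 hX', eventually_eventually_nhds.2 hY']
        with y h h' using (A.toData_bracket h h').symm
    rw [A.toData_bracket (key hX' hY') hZ', A.toData_bracket (key hY' hZ') hX',
      A.toData_bracket (key hZ' hX') hY', A.bracket_skew (A.bracket X' Y') Z',
      A.bracket_skew (A.bracket Y' Z') X', A.bracket_skew (A.bracket Z' X') Y']
    have h := congrArg (fun s : Cₛ^∞⟮𝓘(ℝ, B); F, E⟯ => s x) (A.jacobi X' Y' Z')
    simp only [ContMDiffSection.coe_add, Pi.add_apply, ContMDiffSection.coe_zero,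
      Pi.zero_apply, ContMDiffSection.coe_neg, Pi.neg_apply] at h ⊢
    rw [← neg_eq_zero, ← h]
    abel

end LieAlgebroid

/-! ## Tangent vectors to the total space of a vector bundle -/

namespace Bundle.Trivialization

variable {EN HN N : Type*} [NormedAddCommGroup EN] [NormedSpace ℝ EN]
  [TopologicalSpace HN] [TopologicalSpace N] [ChartedSpace HN N] {I : ModelWithCorners ℝ EN HN}
  [IsManifold I ∞ N]
  {G : Type*} [NormedAddCommGroup G] [NormedSpace ℝ G]
  {V : N → Type*} [∀ x, AddCommGroup (V x)] [∀ x, Module ℝ (V x)]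
  [TopologicalSpace (TotalSpace G V)] [∀ x, TopologicalSpace (V x)]
  [FiberBundle G V] [VectorBundle ℝ G V] [ContMDiffVectorBundle ∞ G V I]
  (e : Trivialization G (π G V)) [MemTrivializationAtlas e]

/-- The fibre coordinate of a vector bundle in a local trivialization. -/
def fib (p : TotalSpace G V) : G := (e p).2

theorem contMDiffNear_fib {a : TotalSpace G V} (ha : a ∈ e.source) :
    ContMDiffNear (I.prod 𝓘(ℝ, G)) 𝓘(ℝ, G) e.fib a :=
  .of_contMDiffOn (contMDiff_snd.comp_contMDiffOn (e.contMDiffOn (n := ∞) (IB := I)))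
    e.open_source ha

/-- The tangent vector at `a` with base component `x` and fibre component `c`. -/
noncomputable def tanLift (a : TotalSpace G V) (x : TangentSpace I a.proj) (c : G) :
    TangentSpace (I.prod 𝓘(ℝ, G)) a :=
  (mfderiv (I.prod 𝓘(ℝ, G)) (I.prod 𝓘(ℝ, G)) e.toOpenPartialHomeomorph.symm (e a)
    ((x, c) : EN × G) : EN × G)

theorem mdifferentiableAt_proj (a : TotalSpace G V) :
    MDifferentiableAt (I.prod 𝓘(ℝ, G)) I (TotalSpace.proj : TotalSpace G V → N) a :=
  (Bundle.contMDiff_proj (n := ∞) V).mdifferentiable (by simp) a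

theorem mfderiv_apply_eq {a : TotalSpace G V} (ha : a ∈ e.source) (v : EN × G) :
    (mfderiv (I.prod 𝓘(ℝ, G)) (I.prod 𝓘(ℝ, G)) e a v : EN × G) =
      ((mfderiv (I.prod 𝓘(ℝ, G)) I (TotalSpace.proj : TotalSpace G V → N) a v : EN),
        dirDeriv (I.prod 𝓘(ℝ, G)) e.fib a v) := by
  have h1 := mdifferentiableAt_proj (I := I) a
  have h2 := (e.contMDiffNear_fib (I := I) ha).mdifferentiableAt
  have h3 : (fun p : TotalSpace G V => (p.proj, e.fib p)) =ᶠ[𝓝 a] e := by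
    filter_upwards [e.open_source.mem_nhds ha] with p hp
    exact e.mk_proj_snd hp
  rw [← h3.mfderiv_eq, mfderiv_prodMk h1 h2]
  rfl

theorem tanLift_spec {a : TotalSpace G V} (ha : a ∈ e.source) (x : TangentSpace I a.proj) (c : G) :
    mfderiv (I.prod 𝓘(ℝ, G)) I (TotalSpace.proj : TotalSpace G V → N) a (e.tanLift a x c) = x ∧
      dirDeriv (I.prod 𝓘(ℝ, G)) e.fib a (e.tanLift a x c) = c := by
  have hM := e.mdifferentiable (I := I)
  have h := (hM.mfderiv ha).apply_symm_apply ((x, c) : EN × G)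
  have h3 := (mfderiv_apply_eq (I := I) e ha (e.tanLift a x c)).symm.trans h
  exact ⟨congrArg Prod.fst h3, congrArg Prod.snd h3⟩

/-- A trivialization is a local diffeomorphism, so its derivative, whose components are the base and
fibre parts, is injective. -/
theorem tangent_ext {a : TotalSpace G V} (ha : a ∈ e.source) {u v : TangentSpace (I.prod 𝓘(ℝ, G)) a}
    (h : mfderiv (I.prod 𝓘(ℝ, G)) I (TotalSpace.proj : TotalSpace G V → N) a u =
      mfderiv (I.prod 𝓘(ℝ, G)) I (TotalSpace.proj : TotalSpace G V → N) a v)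
    (h' : dirDeriv (I.prod 𝓘(ℝ, G)) e.fib a u = dirDeriv (I.prod 𝓘(ℝ, G)) e.fib a v) : u = v := by
  have hM := e.mdifferentiable (I := I)
  apply (hM.mfderiv ha).injective
  exact (mfderiv_apply_eq (I := I) e ha u).trans
    ((Prod.ext h h').trans (mfderiv_apply_eq (I := I) e ha v).symm)

theorem tanLift_eq {a : TotalSpace G V} (ha : a ∈ e.source) (u : TangentSpace (I.prod 𝓘(ℝ, G)) a) :
    e.tanLift a (mfderiv (I.prod 𝓘(ℝ, G)) I (TotalSpace.proj : TotalSpace G V → N) a u)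
      (dirDeriv (I.prod 𝓘(ℝ, G)) e.fib a u) = u :=
  e.tangent_ext ha (e.tanLift_spec ha _ _).1 (e.tanLift_spec ha _ _).2

/-- The lift of a smooth family of tangent vectors of the base is smooth. -/
theorem contMDiffNear_tanLift {a : TotalSpace G V} (ha : a ∈ e.source)
    {X : ∀ a : TotalSpace G V, TangentSpace I a.proj} {c : TotalSpace G V → G}
    (hX : ContMDiffNear (I.prod 𝓘(ℝ, G)) I.tangent
      (fun a => (⟨a.proj, X a⟩ : TangentBundle I N)) a)
    (hc : ContMDiffNear (I.prod 𝓘(ℝ, G)) 𝓘(ℝ, G) c a) :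
    ContMDiffNear (I.prod 𝓘(ℝ, G)) (I.prod 𝓘(ℝ, G)).tangent
      (fun a => (⟨a, e.tanLift a (X a) (c a)⟩ :
        TangentBundle (I.prod 𝓘(ℝ, G)) (TotalSpace G V))) a := by
  obtain ⟨s, hs, has, hXs⟩ := hX.exists_open
  obtain ⟨t, ht, hat, hct⟩ := hc.exists_open
  let u := e.source ∩ (s ∩ t)
  have hu : IsOpen u := e.open_source.inter (hs.inter ht)
  have hS2 : ContMDiffOn (I.prod 𝓘(ℝ, G)) 𝓘(ℝ, G).tangent ∞
      (fun a : TotalSpace G V => (⟨e.fib a, c a⟩ : TangentBundle 𝓘(ℝ, G) G)) u := by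
    intro a ha
    have h1 := (e.contMDiffNear_fib (I := I) ha.1).contMDiffAt
    have h2 := hct.contMDiffAt (ht.mem_nhds ha.2.2)
    rw [contMDiffWithinAt_totalSpace]
    refine ⟨h1.contMDiffWithinAt, ?_⟩
    refine h2.contMDiffWithinAt.congr (fun y _ => ?_) ?_ <;> simp
  have hS := (contMDiff_equivTangentBundleProd_symm (n := ∞) (I := I) (M := N)
    (I' := 𝓘(ℝ, G)) (M' := G)).comp_contMDiffOn
      ((hXs.mono (fun a ha => ha.2.1 : u ⊆ s)).prodMk hS2)
  have hV := ((e.contMDiffOn_symm (n := ∞) (IB := I)).contMDiffOn_tangentMapWithin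
    (m := ∞) (by simp) (IsOpen.uniqueMDiffOn (I := I.prod 𝓘(ℝ, G)) e.open_target)).comp hS
      (fun a ha => e.mem_target.2 (e.mem_source.1 ha.1))
  refine .of_contMDiffOn (hV.congr fun a ha => ?_) hu ⟨ha, has, hat⟩
  have hea : e a = (a.proj, e.fib a) := (e.mk_proj_snd ha.1).symm
  have h1 : mfderivWithin (I.prod 𝓘(ℝ, G)) (I.prod 𝓘(ℝ, G))
      e.toOpenPartialHomeomorph.symm e.target (e a) =
      mfderiv (I.prod 𝓘(ℝ, G)) (I.prod 𝓘(ℝ, G)) e.toOpenPartialHomeomorph.symm (e a) :=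
    mfderivWithin_of_isOpen e.open_target (e.map_source ha.1)
  -- The base points agree only propositionally; generalizing them to `q` and `b` allows the tangent
  -- vectors to be transported by substitution.
  have key : ∀ (q : N × G) (b : TotalSpace G V), q = e a → b = a → ∀ v : EN × G,
      (⟨a, (mfderiv (I.prod 𝓘(ℝ, G)) (I.prod 𝓘(ℝ, G)) e.toOpenPartialHomeomorph.symm (e a) v :
        EN × G)⟩ : TangentBundle (I.prod 𝓘(ℝ, G)) (TotalSpace G V)) =
      ⟨b, (mfderivWithin (I.prod 𝓘(ℝ, G)) (I.prod 𝓘(ℝ, G))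
        e.toOpenPartialHomeomorph.symm e.target q v : EN × G)⟩ := by
    rintro _ _ rfl rfl v
    rw [h1]
  refine key (a.proj, e.fib a) (e.toOpenPartialHomeomorph.symm (a.proj, e.fib a)) hea.symm ?_
    ((X a, c a) : EN × G)
  rw [← hea]
  exact e.symm_apply_apply ha.1

end Bundle.Trivialization

/-! ## The Lie algebroid `𝒯^{τ_E} E` -/

namespace LieAlgebroid

variable {B F M : Type*} {E : M → Type*}
  [NormedAddCommGroup B] [NormedSpace ℝ B] [NormedAddCommGroup F] [NormedSpace ℝ F]
  [TopologicalSpace M] [ChartedSpace B M] [IsManifold 𝓘(ℝ, B) ∞ M]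
  [TopologicalSpace (TotalSpace F E)] [∀ x, TopologicalSpace (E x)]
  [∀ x, AddCommGroup (E x)] [∀ x, Module ℝ (E x)] [FiberBundle F E] [VectorBundle ℝ F E]
  [ContMDiffVectorBundle ∞ F E 𝓘(ℝ, B)] [FiniteDimensional ℝ B] [FiniteDimensional ℝ F]
  [∀ x, IsTopologicalAddGroup (E x)] [∀ x, ContinuousSMul ℝ (E x)]
  (A : LieAlgebroid B F E)

theorem contMDiffNear_anchor_comp {W EW HW : Type*} [NormedAddCommGroup EW] [NormedSpace ℝ EW]
    [TopologicalSpace HW] [TopologicalSpace W] [ChartedSpace HW W] {J : ModelWithCorners ℝ EW HW}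
    {f : W → M} {σ : ∀ w, E (f w)} {w : W}
    (hσ : ContMDiffNear J (𝓘(ℝ, B).prod 𝓘(ℝ, F)) (fun w => TotalSpace.mk' F (f w) (σ w)) w) :
    ContMDiffNear J 𝓘(ℝ, B).tangent
      (fun w => (⟨f w, A.anchor (f w) (σ w)⟩ : TangentBundle 𝓘(ℝ, B) M)) w :=
  (ContMDiffNear.of_contMDiff A.contMDiff_anchor).comp hσ

/-- Bridge between two notions: the laws of a prolongation are proved for sections with both
components smooth, while the next prolongation needs them for smooth sections of the vector bundle
𝒯E. In coordinates both say that z and v are smooth. -/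
theorem smoothSec_tan_iff (X : ∀ a, A.Tan a) (a : TotalSpace F E) :
    SmoothSec (𝓘(ℝ, B).prod 𝓘(ℝ, F)) (F × F) X a ↔
      AlgebroidData.SmoothNear (D := A.toData) (J := 𝓘(ℝ, B).prod 𝓘(ℝ, F))
        (f := (TotalSpace.proj : TotalSpace F E → M)) F X a := by
  let e := trivializationAt F E a.proj
  have ha : a ∈ e.source := FiberBundle.mem_trivializationAt_proj_source
  have hproj : ContMDiff (𝓘(ℝ, B).prod 𝓘(ℝ, F)) 𝓘(ℝ, B) ∞
      (TotalSpace.proj : TotalSpace F E → M) := Bundle.contMDiff_proj (n := ∞) E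
  have hmem := e.open_source.mem_nhds ha
  have hcoord : ∀ b ∈ e.source, Tan.coords A e b (X b) =
      (AlgebroidData.comp (D := A.toData) (J := 𝓘(ℝ, B).prod 𝓘(ℝ, F)) e X b,
        dirDeriv (𝓘(ℝ, B).prod 𝓘(ℝ, F)) e.fib b (X b).1.2) := by
    intro b hb
    refine Prod.ext ?_ rfl
    rw [Tan.coords_fst, Trivialization.coe_linearMapAt_of_mem _ (e.mem_source.1 hb)]
    rfl
  constructor
  · intro h
    have h1 : ContMDiffNear (𝓘(ℝ, B).prod 𝓘(ℝ, F)) 𝓘(ℝ, F × F)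
        (fun b => Tan.coords A e b (X b)) a :=
      h.snd (trivializationAt (F × F) A.Tan a) (by exact ha)
    have h2 : ContMDiffNear (𝓘(ℝ, B).prod 𝓘(ℝ, F)) 𝓘(ℝ, F × F) (fun b =>
        (AlgebroidData.comp (D := A.toData) (J := 𝓘(ℝ, B).prod 𝓘(ℝ, F)) e X b,
        dirDeriv (𝓘(ℝ, B).prod 𝓘(ℝ, F)) e.fib b (X b).1.2)) a := by
      refine h1.congr ?_
      filter_upwards [hmem] with b hb using (hcoord b hb).symm
    have h3 := h2.clm (ContinuousLinearMap.fst ℝ F F)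
    have h4 := h2.clm (ContinuousLinearMap.snd ℝ F F)
    have h5 : ContMDiffNear (𝓘(ℝ, B).prod 𝓘(ℝ, F)) (𝓘(ℝ, B).prod 𝓘(ℝ, F))
        (fun b => TotalSpace.mk' F b.proj (X b).1.1) a := by
      filter_upwards [h3, hmem] with b hb hb'
      exact (e.contMDiffAt_iff (f := fun b => TotalSpace.mk' F b.proj (X b).1.1)
        (e.mem_source.2 (show b.proj ∈ e.baseSet from e.mem_source.1 hb'))).2 ⟨hproj b, hb⟩
    -- The vector field is recovered from its fibre coordinate and its base component; the latter is
    -- the anchor of the first component of `X`, hence smooth.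
    have h6 := e.contMDiffNear_tanLift ha (A.contMDiffNear_anchor_comp h5) h4
    refine .of_comp e hproj (e.mem_source.1 ha) h3 (h6.congr ?_)
    filter_upwards [hmem] with b hb
    have h7 := e.tanLift_eq (I := 𝓘(ℝ, B)) hb (X b).1.2
    rw [← Tan.anchor_fst A (X b)] at h7
    exact congrArg (TotalSpace.mk' (B × F) b) h7.symm
  · intro h
    refine .of_snd (trivializationAt (F × F) A.Tan a) (by exact ha) ?_
    have h1 := (h.comp e hproj.continuous (e.mem_source.1 ha)).prodMk_space
      ((e.contMDiffNear_fib (I := 𝓘(ℝ, B)) ha).dirDeriv h.vectorField)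
    refine h1.congr ?_
    filter_upwards [hmem] with b hb using hcoord b hb

/-- The Lie algebroid `𝒯^{τ_E} E` satisfies the laws of Lie algebroids for local sections. -/
theorem isLie_tanData [T2Space M] :
    A.tanData.IsLie (SmoothSec (𝓘(ℝ, B).prod 𝓘(ℝ, F)) (F × F)) := by
  have h : (SmoothSec (𝓘(ℝ, B).prod 𝓘(ℝ, F)) (F × F) :
      (∀ a, A.Tan a) → TotalSpace F E → Prop) = fun X a =>
      AlgebroidData.SmoothNear (D := A.toData) (J := 𝓘(ℝ, B).prod 𝓘(ℝ, F))
        (f := (TotalSpace.proj : TotalSpace F E → M)) F X a :=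
    funext fun X => funext fun a => propext (A.smoothSec_tan_iff X a)
  rw [h]
  exact AlgebroidData.IsLie.prolongation A.isLie_toData (Bundle.contMDiff_proj (n := ∞) E)

end LieAlgebroid

/-! ## Differentials on a prolongation -/

namespace AlgebroidData

section Differential

variable {EN HN N : Type*} [NormedAddCommGroup EN] [NormedSpace ℝ EN] [FiniteDimensional ℝ EN]
  [TopologicalSpace HN] [TopologicalSpace N] [ChartedSpace HN N] {I : ModelWithCorners ℝ EN HN}
  [IsManifold I ∞ N]
  {F : Type*} [NormedAddCommGroup F] [NormedSpace ℝ F] [FiniteDimensional ℝ F]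
  {A : N → Type*} [∀ x, AddCommGroup (A x)] [∀ x, Module ℝ (A x)]
  [TopologicalSpace (TotalSpace F A)] [∀ x, TopologicalSpace (A x)]
  [FiberBundle F A] [VectorBundle ℝ F A] [ContMDiffVectorBundle ∞ F A I]
  {EW HW W : Type*} [NormedAddCommGroup EW] [NormedSpace ℝ EW] [CompleteSpace EW]
  [TopologicalSpace HW] [TopologicalSpace W] [ChartedSpace HW W]
  {J : ModelWithCorners ℝ EW HW} [J.Boundaryless] [IsManifold J ∞ W]
  {D : AlgebroidData I A} {f : W → N}
  (hD : D.IsLie (SmoothSec I F)) (hf : ContMDiff J I ∞ f)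
  {θ : ∀ w, D.prolFiber J f w → ℝ}
include hD hf

theorem contMDiffNear_d₁
    (hθ : ∀ {X w}, SmoothNear F X w → ContMDiffNear J 𝓘(ℝ, ℝ) (fun y => θ y (X y)) w)
    {X Y : ∀ w, D.prolFiber J f w} {w : W} (hX : SmoothNear F X w) (hY : SmoothNear F Y w) :
    ContMDiffNear J 𝓘(ℝ, ℝ) (D.d₁ F θ X Y) w :=
  (((hθ hY).dirDeriv hX.vectorField).sub ((hθ hX).dirDeriv hY.vectorField)).sub
    (hθ (smoothNear_prolBracket hD hf hX hY))

/-- The square of the differential vanishes. -/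
theorem d₂_eq_zero (hlin : ∀ w, IsLinearMap ℝ (θ w))
    (hθ : ∀ {X w}, SmoothNear F X w → ContMDiffNear J 𝓘(ℝ, ℝ) (fun y => θ y (X y)) w)
    {Ω : ∀ w, D.prolFiber J f w → D.prolFiber J f w → ℝ}
    (hΩ : ∀ {X Y w}, SmoothNear F X w → SmoothNear F Y w →
      Ω w (X w) (Y w) = - D.d₁ F θ X Y w)
    {X Y Z : ∀ w, D.prolFiber J f w} {w : W} (hX : SmoothNear F X w) (hY : SmoothNear F Y w)
    (hZ : SmoothNear F Z w) : D.d₂ F Ω X Y Z w = 0 := by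
  have hder : ∀ {X Y Z : ∀ w, D.prolFiber J f w}, SmoothNear F X w → SmoothNear F Y w →
      SmoothNear F Z w → lieDeriv X (fun y => Ω y (Y y) (Z y)) w =
      - (lieDeriv X (lieDeriv Y (fun y => θ y (Z y))) w -
        lieDeriv X (lieDeriv Z (fun y => θ y (Y y))) w -
        lieDeriv X (fun y => θ y (D.prolBracket J f F Y Z y)) w) := by
    intro X Y Z hX hY hZ
    have h1 : (fun y => Ω y (Y y) (Z y)) =ᶠ[𝓝 w] fun y => -(lieDeriv Y (fun y => θ y (Z y)) y -
        lieDeriv Z (fun y => θ y (Y y)) y - θ y (D.prolBracket J f F Y Z y)) := by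
      filter_upwards [hY.eventually, hZ.eventually] with y h h' using hΩ h h'
    have s1 := (hθ hZ).dirDeriv hY.vectorField
    have s2 := (hθ hY).dirDeriv hZ.vectorField
    have s3 := hθ (smoothNear_prolBracket hD hf hY hZ)
    unfold lieDeriv at h1 ⊢
    rw [dirDeriv_congr h1, dirDeriv_neg ((s1.sub s2).sub s3).mdifferentiableAt,
      dirDeriv_sub (s1.sub s2).mdifferentiableAt s3.mdifferentiableAt,
      dirDeriv_sub s1.mdifferentiableAt s2.mdifferentiableAt]
  have hbr : ∀ {X Y Z : ∀ w, D.prolFiber J f w}, SmoothNear F X w → SmoothNear F Y w →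
      SmoothNear F Z w → Ω w (D.prolBracket J f F X Y w) (Z w) =
      - (lieDeriv X (lieDeriv Y (fun y => θ y (Z y))) w -
          lieDeriv Y (lieDeriv X (fun y => θ y (Z y))) w -
        lieDeriv Z (fun y => θ y (D.prolBracket J f F X Y y)) w -
        θ w (D.prolBracket J f F (D.prolBracket J f F X Y) Z w)) := by
    intro X Y Z hX hY hZ
    rw [hΩ (smoothNear_prolBracket hD hf hX hY) hZ]
    unfold d₁
    congr 3
    unfold lieDeriv
    rw [prolBracket_snd hD hf hX hY,
      dirDeriv_mlieBracket (hθ hZ) hX.vectorField hY.vectorField]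
  have hJ := congrArg (θ w) (prolBracket_jacobi hD hf hX hY hZ)
  rw [(hlin w).map_add, (hlin w).map_add, (hlin w).map_zero] at hJ
  -- The Koszul formula contains `⟦X, Z⟧`, the cyclic Jacobi identity `⟦Z, X⟧`. The sign is moved
  -- through the outer bracket by the Leibniz rule with the constant `-1`.
  have hXZ : ∀ᶠ y in 𝓝 w, D.prolBracket J f F X Z y = - D.prolBracket J f F Z X y := by
    filter_upwards [hX.eventually, hZ.eventually] with y h h' using prolBracket_skew hD hf h h'
  have hXZY : D.prolBracket J f F (D.prolBracket J f F X Z) Y w =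
      - D.prolBracket J f F (D.prolBracket J f F Z X) Y w := by
    rw [prolBracket_skew hD hf (smoothNear_prolBracket hD hf hX hZ) hY,
      prolBracket_skew hD hf (smoothNear_prolBracket hD hf hZ hX) hY, prolBracket_congr
      (.of_forall fun _ => rfl : ∀ᶠ y in 𝓝 w, Y y = Y y) hXZ]
    have h := prolBracket_smul hD hf (g := fun _ => (-1 : ℝ)) hY
      (smoothNear_prolBracket hD hf hZ hX) (.const _)
      (.smul hf (.const _) (smoothNear_prolBracket hD hf hZ hX))
    rw [dirDeriv_const, zero_smul, add_zero] at h
    have hm : ∀ y (u : D.prolFiber J f y), (-1 : ℝ) • u = -u := fun y u => neg_one_smul ℝ u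
    simp only [hm] at h
    rw [h]
  unfold d₂
  -- The second derivatives of θ on sections and the derivatives of θ on brackets cancel in pairs; θ
  -- of the Jacobi sum remains.
  rw [hder hX hY hZ, hder hY hX hZ, hder hZ hX hY, hbr hX hY hZ, hbr hX hZ hY, hbr hY hZ hX, hXZY,
    (hlin w).map_neg]
  linarith

/-- A pointwise formula for the differential of a 1-section of `𝒯^f A` which only depends on
the component along `A`; the 1-section is given by its coefficients `K` in a local frame. -/
noncomputable def frameDiff (D : AlgebroidData I A) (J : ModelWithCorners ℝ EW HW) (f : W → N)
    (e : Trivialization F (π F A)) (K : W → F → ℝ) (w : W) (u v : D.prolFiber J f w) : ℝ :=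
  dirDeriv J (fun y => K y (e ⟨f w, v.1.1⟩).2) w u.1.2 -
    dirDeriv J (fun y => K y (e ⟨f w, u.1.1⟩).2) w v.1.2 -
    K w (D.frameCoeff e (f w) (e ⟨f w, u.1.1⟩).2 (e ⟨f w, v.1.1⟩).2)

/-- Tensoriality of the differential: the derivatives of the components of `X` and `Y` in the first
two Koszul terms cancel those in the bracket, leaving only the values at `w`. -/
theorem d₁_eq_frameDiff (e : Trivialization F (π F A)) [MemTrivializationAtlas e] {K : W → F → ℝ}
    {w : W} (hw : f w ∈ e.baseSet) (hK : ∀ᶠ y in 𝓝 w, IsLinearMap ℝ (K y))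
    (hK' : ∀ c, ContMDiffNear J 𝓘(ℝ, ℝ) (fun y => K y c) w)
    (hθ : ∀ᶠ y in 𝓝 w, ∀ u, θ y u = K y (e ⟨f y, u.1.1⟩).2)
    {X Y : ∀ w, D.prolFiber J f w} (hX : SmoothNear F X w) (hY : SmoothNear F Y w) :
    D.d₁ F θ X Y w = frameDiff D J f e K w (X w) (Y w) := by
  have key : ∀ {X Y : ∀ w, D.prolFiber J f w}, SmoothNear F Y w →
      lieDeriv X (fun y => θ y (Y y)) w =
        dirDeriv J (fun y => K y (comp e Y w)) w (X w).1.2 +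
          K w (dirDeriv J (comp e Y) w (X w).1.2) := by
    intro X Y hY
    have h1 : (fun y => θ y (Y y)) =ᶠ[𝓝 w] fun y => K y (comp e Y y) := by
      filter_upwards [hθ] with y hy using hy _
    unfold lieDeriv
    rw [dirDeriv_congr h1, dirDeriv_apply_of_isLinearMap hK hK' (hY.comp e hf.continuous hw)]
  have h2 : θ w (D.prolBracket J f F X Y w) = K w (comp e (D.prolBracket J f F X Y) w) :=
    hθ.self_of_nhds _
  unfold d₁
  rw [key hY, key hX, h2, comp_prolBracket e hD hf hX hY hw, hK.self_of_nhds.map_add,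
    hK.self_of_nhds.map_sub]
  unfold frameDiff comp
  ring

end Differential

end AlgebroidData

/-! ## Sections of the prolongation over the projection of a vector bundle -/

namespace AlgebroidData

section Lift

variable {EN HN N : Type*} [NormedAddCommGroup EN] [NormedSpace ℝ EN] [FiniteDimensional ℝ EN]
  [TopologicalSpace HN] [TopologicalSpace N] [ChartedSpace HN N] {I : ModelWithCorners ℝ EN HN}
  [IsManifold I ∞ N]
  {F : Type*} [NormedAddCommGroup F] [NormedSpace ℝ F]
  {A : N → Type*} [∀ x, AddCommGroup (A x)] [∀ x, Module ℝ (A x)]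
  [TopologicalSpace (TotalSpace F A)] [∀ x, TopologicalSpace (A x)]
  [FiberBundle F A] [VectorBundle ℝ F A] [ContMDiffVectorBundle ∞ F A I]
  {G : Type*} [NormedAddCommGroup G] [NormedSpace ℝ G]
  {V : N → Type*} [∀ x, AddCommGroup (V x)] [∀ x, Module ℝ (V x)]
  [TopologicalSpace (TotalSpace G V)] [∀ x, TopologicalSpace (V x)]
  [FiberBundle G V] [VectorBundle ℝ G V] [ContMDiffVectorBundle ∞ G V I]
  (D : AlgebroidData I A)
  (e : Trivialization F (π F A)) [MemTrivializationAtlas e]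
  (e' : Trivialization G (π G V)) [MemTrivializationAtlas e']

/-- The element of the prolongation of `A` over the projection of `V` with given coordinates in
local trivializations of `A` and `V`. -/
noncomputable def ofFrame {w : TotalSpace G V} (hw : w ∈ e'.source) (c : F) (δ : G) :
    D.prolFiber (I.prod 𝓘(ℝ, G)) (TotalSpace.proj : TotalSpace G V → N) w :=
  ⟨(e.symm w.proj c, e'.tanLift w (D.anchor w.proj (e.symm w.proj c)) δ),
    (e'.tanLift_spec hw _ _).1.symm⟩

open Classical in
/-- The local section of the prolongation of `A` over the projection of `V` with constant
coordinates in local trivializations of `A` and `V`. -/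
noncomputable def frameSection (c : F) (δ : G) (w : TotalSpace G V) :
    D.prolFiber (I.prod 𝓘(ℝ, G)) (TotalSpace.proj : TotalSpace G V → N) w :=
  if hw : w ∈ e'.source then D.ofFrame e e' hw c δ else 0

variable {D}

theorem smoothNear_frameSection (hD : D.IsLie (SmoothSec I F)) {w : TotalSpace G V}
    (hw : w.proj ∈ e.baseSet) (hw' : w ∈ e'.source) (c : F) (δ : G) :
    SmoothNear F (D.frameSection e e' c δ) w := by
  have hproj : ContMDiff (I.prod 𝓘(ℝ, G)) I ∞ (TotalSpace.proj : TotalSpace G V → N) :=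
    Bundle.contMDiff_proj V
  have hmem := hproj.continuous.continuousAt.preimage_mem_nhds (e.open_baseSet.mem_nhds hw)
  refine .of_comp e hproj hw ((ContMDiffNear.const c).congr ?_) ?_
  · filter_upwards [hmem, e'.open_source.mem_nhds hw'] with y hy hy'
    simp only [comp, frameSection, dif_pos hy']
    exact snd_symm e hy c
  · have h1 := (hD.anchor_smooth (SmoothSec.symm e hw (.const (I := I) c))).comp
      (f := (TotalSpace.proj : TotalSpace G V → N)) (x := w) (.of_contMDiff hproj)
    refine (e'.contMDiffNear_tanLift hw' h1 (.const δ)).congr ?_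
    filter_upwards [e'.open_source.mem_nhds hw'] with y hy'
    simp only [frameSection, dif_pos hy']
    rfl

theorem ofFrame_eq {w : TotalSpace G V} (hw : w.proj ∈ e.baseSet) (hw' : w ∈ e'.source)
    (u : D.prolFiber (I.prod 𝓘(ℝ, G)) (TotalSpace.proj : TotalSpace G V → N) w) :
    D.ofFrame e e' hw' (e ⟨w.proj, u.1.1⟩).2 (dirDeriv (I.prod 𝓘(ℝ, G)) e'.fib w u.1.2) = u := by
  have h1 : e.symm w.proj (e ⟨w.proj, u.1.1⟩).2 = u.1.1 := symm_snd e hw _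
  refine Subtype.ext (Prod.ext h1 ?_)
  change e'.tanLift w (D.anchor w.proj (e.symm w.proj (e ⟨w.proj, u.1.1⟩).2)) _ = u.1.2
  rw [h1]
  exact (congrArg (fun x => e'.tanLift w x _) u.2).trans (e'.tanLift_eq hw' u.1.2)

/-- Constant coefficients in a local frame extend any vector. Without such extensions the condition
defining `d₁At` could hold vacuously and would not single out a value. -/
theorem exists_smoothNear (hD : D.IsLie (SmoothSec I F)) {w : TotalSpace G V}
    (u : D.prolFiber (I.prod 𝓘(ℝ, G)) (TotalSpace.proj : TotalSpace G V → N) w) :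
    ∃ X : ∀ w, D.prolFiber (I.prod 𝓘(ℝ, G)) (TotalSpace.proj : TotalSpace G V → N) w,
      SmoothNear F X w ∧ X w = u := by
  have hw : w.proj ∈ (trivializationAt F A w.proj).baseSet :=
    FiberBundle.mem_baseSet_trivializationAt' w.proj
  have hw' : w ∈ (trivializationAt G V w.proj).source :=
    FiberBundle.mem_trivializationAt_proj_source
  refine ⟨_, smoothNear_frameSection _ _ hD hw hw' (trivializationAt F A w.proj ⟨w.proj, u.1.1⟩).2
    (dirDeriv (I.prod 𝓘(ℝ, G)) (trivializationAt G V w.proj).fib w u.1.2), ?_⟩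
  unfold frameSection
  rw [dif_pos hw', ofFrame_eq _ _ hw hw' u]

end Lift

/-! ### The canonical section and its pullback to the Pontryagin bundle. -/

section Dual

variable {EN HN N : Type*} [NormedAddCommGroup EN] [NormedSpace ℝ EN] [FiniteDimensional ℝ EN]
  [TopologicalSpace HN] [TopologicalSpace N] [ChartedSpace HN N] {I : ModelWithCorners ℝ EN HN}
  [IsManifold I ∞ N] [I.Boundaryless]
  {F : Type*} [NormedAddCommGroup F] [NormedSpace ℝ F] [FiniteDimensional ℝ F]
  {A : N → Type*} [∀ x, AddCommGroup (A x)] [∀ x, Module ℝ (A x)]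
  [TopologicalSpace (TotalSpace F A)] [∀ x, TopologicalSpace (A x)]
  [FiberBundle F A] [VectorBundle ℝ F A] [ContMDiffVectorBundle ∞ F A I]

theorem trivializationAt_dual_apply {x₀ : N} {μ : Dual F A}
    (hμ : μ.proj ∈ (trivializationAt F A x₀).baseSet) (c : F) :
    (trivializationAt (F →L[ℝ] ℝ) (DualFiber A) x₀ μ).2 c =
      μ.2 ((trivializationAt F A x₀).symm μ.proj c) := by
  rw [hom_trivializationAt_apply]
  rw [ContinuousLinearMap.inCoordinates_eq hμ (mem_univ _)]
  simp

theorem trivializationAt_pontryagin_source (x₀ : N) (w : Pontryagin F A) :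
    w ∈ (trivializationAt (F × (F →L[ℝ] ℝ)) (fun x => A x × DualFiber A x) x₀).source ↔
      w.proj ∈ (trivializationAt F A x₀).baseSet := by
  rw [Trivialization.mem_source]
  simp

theorem trivializationAt_dual_source (x₀ : N) (μ : Dual F A) :
    μ ∈ (trivializationAt (F →L[ℝ] ℝ) (DualFiber A) x₀).source ↔
      μ.proj ∈ (trivializationAt F A x₀).baseSet := by
  rw [Trivialization.mem_source]
  simp

/-- The coefficients of an element of the dual bundle in a local frame. -/
noncomputable def dualCoeff (e : Trivialization F (π F A)) (μ : Dual F A) (c : F) : ℝ :=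
  μ.2 (e.symm μ.proj c)

theorem isLinearMap_dualCoeff (e : Trivialization F (π F A)) [MemTrivializationAtlas e]
    {μ : Dual F A} (hμ : μ.proj ∈ e.baseSet) : IsLinearMap ℝ (dualCoeff e μ) :=
  (μ.2.toLinearMap.comp (isLinearMap_symm e hμ).mk').isLinear

theorem dualCoeff_snd (e : Trivialization F (π F A)) [MemTrivializationAtlas e]
    {μ : Dual F A} (hμ : μ.proj ∈ e.baseSet) (u : A μ.proj) :
    dualCoeff e μ (e ⟨μ.proj, u⟩).2 = μ.2 u := by
  unfold dualCoeff
  rw [symm_snd e hμ]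

theorem contMDiffNear_dualCoeff {x₀ : N} {μ : Dual F A}
    (hμ : μ.proj ∈ (trivializationAt F A x₀).baseSet) (c : F) :
    ContMDiffNear (dualModel I F) 𝓘(ℝ, ℝ)
      (fun μ => dualCoeff (trivializationAt F A x₀) μ c) μ := by
  have hs := (trivializationAt_dual_source x₀ μ).2 hμ
  refine ((Trivialization.contMDiffNear_fib (I := I) _ hs).clm
    (ContinuousLinearMap.apply ℝ ℝ c)).congr ?_
  filter_upwards [(trivializationAt (F →L[ℝ] ℝ) (DualFiber A) x₀).open_source.mem_nhds hs] with ν hν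
  exact (trivializationAt_dual_apply ((trivializationAt_dual_source x₀ ν).1 hν) c).symm

variable {D : AlgebroidData I A} (hD : D.IsLie (SmoothSec I F))

/-- The section `(w, u) ↦ ⟨w, u⟩` of the dual of the prolongation of `A` over the Pontryagin
bundle. -/
noncomputable def tautological (D : AlgebroidData I A) (w : Pontryagin F A)
    (u : D.pontryaginProl F A w) : ℝ :=
  w.2.2 u.1.1

theorem contMDiffNear_dualCoeff_pr₂ {x₀ : N} {w : Pontryagin F A}
    (hw : w.proj ∈ (trivializationAt F A x₀).baseSet) (c : F) :
    ContMDiffNear (pontryaginModel I F) 𝓘(ℝ, ℝ)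
      (fun w => dualCoeff (trivializationAt F A x₀) (pr₂ w) c) w :=
  (contMDiffNear_dualCoeff (I := I) (μ := pr₂ w) hw c).comp (.of_contMDiff (contMDiff_pr₂ I F A))

theorem eventually_proj_mem {G : Type*} [NormedAddCommGroup G] [NormedSpace ℝ G]
    {V : N → Type*} [TopologicalSpace (TotalSpace G V)] [∀ x, TopologicalSpace (V x)]
    [FiberBundle G V] {s : Set N} (hs : IsOpen s) {w : TotalSpace G V} (hw : w.proj ∈ s) :
    ∀ᶠ y : TotalSpace G V in 𝓝 w, y.proj ∈ s :=
  (FiberBundle.continuous_proj G V).continuousAt.preimage_mem_nhds (hs.mem_nhds hw)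

theorem contMDiffNear_tautological {X : ∀ w : Pontryagin F A, D.pontryaginProl F A w}
    {w : Pontryagin F A} (hX : SmoothNear F X w) :
    ContMDiffNear (pontryaginModel I F) 𝓘(ℝ, ℝ) (fun y => D.tautological y (X y)) w := by
  have hw : w.proj ∈ (trivializationAt F A w.proj).baseSet :=
    FiberBundle.mem_baseSet_trivializationAt' w.proj
  have hmem := eventually_proj_mem (trivializationAt F A w.proj).open_baseSet hw
  refine (ContMDiffNear.apply_of_isLinearMap
    (K := fun y c => dualCoeff (trivializationAt F A w.proj) (pr₂ y) c) ?_
    (contMDiffNear_dualCoeff_pr₂ hw)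
    (hX.comp _ (FiberBundle.continuous_proj _ _) hw)).congr ?_
  · filter_upwards [hmem] with y hy using isLinearMap_dualCoeff _ (μ := pr₂ y) hy
  · filter_upwards [hmem] with y hy
    exact (dualCoeff_snd _ (μ := pr₂ y) hy _).symm

include hD

/-- The canonical symplectic section in a local frame. -/
theorem canonicalSection_eq {x₀ : N} {μ : Dual F A}
    (hμ : μ.proj ∈ (trivializationAt F A x₀).baseSet) (u v : D.dualProl F A μ) :
    D.canonicalSection F A μ u v = - frameDiff D (dualModel I F) TotalSpace.proj
      (trivializationAt F A x₀) (dualCoeff (trivializationAt F A x₀)) μ u v := by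
  have : CompleteSpace EN := FiniteDimensional.complete ℝ EN
  have hmem := eventually_proj_mem (trivializationAt F A x₀).open_baseSet hμ
  have key : ∀ X Y : ∀ μ, D.dualProl F A μ, SmoothNear F X μ → SmoothNear F Y μ →
      X μ = u → Y μ = v → D.d₁ F (D.liouville F A) X Y μ =
      frameDiff D (dualModel I F) TotalSpace.proj
        (trivializationAt F A x₀) (dualCoeff (trivializationAt F A x₀)) μ u v := by
    rintro X Y hX hY rfl rfl
    refine d₁_eq_frameDiff hD (Bundle.contMDiff_proj _) (trivializationAt F A x₀) hμ ?_
      (contMDiffNear_dualCoeff hμ) ?_ hX hY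
    · filter_upwards [hmem] with y hy using isLinearMap_dualCoeff _ hy
    · filter_upwards [hmem] with y hy u
      exact (dualCoeff_snd _ hy _).symm
  obtain ⟨X, hX, hXu⟩ := exists_smoothNear (V := DualFiber A) hD u
  obtain ⟨Y, hY, hYv⟩ := exists_smoothNear (V := DualFiber A) hD v
  -- `key` shows that the frame expression is an admissible value; the extensions `X`, `Y` force the
  -- chosen value to equal it.
  have h := Classical.epsilon_spec (p := fun r : ℝ => ∀ X Y : ∀ μ, D.dualProl F A μ,
    SmoothNear F X μ → SmoothNear F Y μ → X μ = u → Y μ = v →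
      D.d₁ F (D.liouville F A) X Y μ = r) ⟨_, key⟩
  exact congrArg Neg.neg ((h X Y hX hY hXu hYv).symm.trans (key X Y hX hY hXu hYv))

/-- The map 𝒯pr₂ leaves the component along `A` unchanged, so pulling back the frame formula only
requires the chain rule for the dual coefficients. -/
theorem pontryaginSection_eq {x₀ : N} {w : Pontryagin F A}
    (hw : w.proj ∈ (trivializationAt F A x₀).baseSet) (u v : D.pontryaginProl F A w) :
    D.pontryaginSection F A w u v = - frameDiff D (pontryaginModel I F) TotalSpace.proj
      (trivializationAt F A x₀)
      (fun y c => dualCoeff (trivializationAt F A x₀) (pr₂ y) c) w u v := by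
  refine (canonicalSection_eq hD (μ := pr₂ w) hw _ _).trans (congrArg Neg.neg ?_)
  have h : ∀ c (u : D.pontryaginProl F A w),
      dirDeriv (pontryaginModel I F)
        (fun y => dualCoeff (trivializationAt F A x₀) (pr₂ y) c) w u.1.2 =
      dirDeriv (dualModel I F) (fun y => dualCoeff (trivializationAt F A x₀) y c) (pr₂ w)
        (D.prolPr₂ F A w u).1.2 := fun c u =>
    dirDeriv_comp (contMDiffNear_dualCoeff (I := I) (μ := pr₂ w) hw c).mdifferentiableAt
      ((contMDiff_pr₂ I F A).mdifferentiable (by simp) w) u.1.2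
  unfold frameDiff
  rw [h, h]
  rfl

/-- The pullback of λ is the tautological section, and both sides have the same frame formula:
pullback commutes with the differential in this case. Exactness on the whole Pontryagin bundle
yields closedness on every submanifold. -/
theorem pontryaginSection_eq_d₁ {X Y : ∀ w : Pontryagin F A, D.pontryaginProl F A w}
    {w : Pontryagin F A} (hX : SmoothNear F X w) (hY : SmoothNear F Y w) :
    D.pontryaginSection F A w (X w) (Y w) = - D.d₁ F D.tautological X Y w := by
  have : CompleteSpace EN := FiniteDimensional.complete ℝ EN
  have : CompleteSpace F := FiniteDimensional.complete ℝ F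
  have hw : w.proj ∈ (trivializationAt F A w.proj).baseSet :=
    FiberBundle.mem_baseSet_trivializationAt' w.proj
  have hmem := eventually_proj_mem (trivializationAt F A w.proj).open_baseSet hw
  rw [pontryaginSection_eq hD hw]
  refine congrArg Neg.neg (d₁_eq_frameDiff hD (Bundle.contMDiff_proj _)
    (trivializationAt F A w.proj) hw ?_ (contMDiffNear_dualCoeff_pr₂ hw) ?_ hX hY).symm
  · filter_upwards [hmem] with y hy using isLinearMap_dualCoeff _ (μ := pr₂ y) hy
  · filter_upwards [hmem] with y hy u
    exact (dualCoeff_snd _ (μ := pr₂ y) hy _).symm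

theorem contMDiffNear_pontryaginSection {X Y : ∀ w : Pontryagin F A, D.pontryaginProl F A w}
    {w : Pontryagin F A} (hX : SmoothNear F X w) (hY : SmoothNear F Y w) :
    ContMDiffNear (pontryaginModel I F) 𝓘(ℝ, ℝ)
      (fun y => D.pontryaginSection F A y (X y) (Y y)) w := by
  have : CompleteSpace EN := FiniteDimensional.complete ℝ EN
  have : CompleteSpace F := FiniteDimensional.complete ℝ F
  refine (contMDiffNear_d₁ hD (Bundle.contMDiff_proj _) contMDiffNear_tautological
    hX hY).neg.congr ?_
  filter_upwards [hX.eventually, hY.eventually] with y hy hy'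
    using pontryaginSection_eq_d₁ hD hy hy'

theorem d₂_pontryaginSection {X Y Z : ∀ w : Pontryagin F A, D.pontryaginProl F A w}
    {w : Pontryagin F A} (hX : SmoothNear F X w) (hY : SmoothNear F Y w) (hZ : SmoothNear F Z w) :
    D.d₂ F (D.pontryaginSection F A) X Y Z w = 0 := by
  have : CompleteSpace EN := FiniteDimensional.complete ℝ EN
  have : CompleteSpace F := FiniteDimensional.complete ℝ F
  exact d₂_eq_zero hD (Bundle.contMDiff_proj _)
    (fun w => (w.2.2.toLinearMap.comp ((LinearMap.fst ℝ _ _).comp (Submodule.subtype _))).isLinear)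
    contMDiffNear_tautological (pontryaginSection_eq_d₁ hD) hX hY hZ

end Dual

end AlgebroidData

/-! ## Tangent spaces of submanifolds -/

namespace AlgebroidData

section Curve

variable {EW HW W : Type*} [NormedAddCommGroup EW] [NormedSpace ℝ EW]
  [TopologicalSpace HW] [TopologicalSpace W] [ChartedSpace HW W] {J : ModelWithCorners ℝ EW HW}
  {G : Type*} [NormedAddCommGroup G] [NormedSpace ℝ G]

theorem dirDeriv_velocity {γ : ℝ → W} {g : W → G} (hg : MDifferentiableAt J 𝓘(ℝ, G) g (γ 0))
    (hγ : MDifferentiableAt 𝓘(ℝ, ℝ) J γ 0) :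
    dirDeriv J g (γ 0) (mfderiv 𝓘(ℝ, ℝ) J γ 0 (1 : ℝ)) = deriv (fun t => g (γ t)) 0 := by
  refine (dirDeriv_comp hg hγ (1 : ℝ)).symm.trans ?_
  unfold dirDeriv
  rw [mfderiv_eq_fderiv]
  rfl

/-- A straight line in the chart at `w`; without boundary the line stays in the chart target for
small times. -/
theorem exists_curve [J.Boundaryless] [IsManifold J ∞ W] (w : W) (U : TangentSpace J w) :
    ∃ γ : ℝ → W, ContMDiffAt 𝓘(ℝ, ℝ) J ∞ γ 0 ∧ γ 0 = w ∧
      (mfderiv 𝓘(ℝ, ℝ) J γ 0 (1 : ℝ) : EW) = U := by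
  let U' : EW := mfderiv J 𝓘(ℝ, EW) (extChartAt J w) w U
  let l : ℝ → EW := fun t => extChartAt J w w + t • U'
  have hl : ContDiff ℝ ∞ l := contDiff_const.add (contDiff_id.smul contDiff_const)
  have hl0 : l 0 = extChartAt J w w := by simp [l]
  have hl' : HasDerivAt l U' 0 := by
    have h : HasDerivAt (fun t : ℝ => t • U') U' 0 := by
      simpa using (hasDerivAt_id (0 : ℝ)).smul_const U'
    exact h.const_add _
  have hs : ContMDiffAt 𝓘(ℝ, EW) J ∞ (extChartAt J w).symm (l 0) := by
    rw [hl0]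
    exact (contMDiffOn_extChartAt_symm w).contMDiffAt (extChartAt_target_mem_nhds w)
  have hγ : ContMDiffAt 𝓘(ℝ, ℝ) J ∞ (fun t => (extChartAt J w).symm (l t)) 0 :=
    ContMDiffAt.comp (0 : ℝ) hs hl.contMDiff.contMDiffAt
  have hγ0 : (extChartAt J w).symm (l 0) = w := by rw [hl0, extChartAt_to_inv]
  refine ⟨_, hγ, hγ0, ?_⟩
  have hφ : MDifferentiableAt J 𝓘(ℝ, EW) (extChartAt J w) ((extChartAt J w).symm (l 0)) := by
    rw [hγ0]
    exact (contMDiffAt_extChartAt (n := ∞)).mdifferentiableAt (by simp)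
  have h1 := dirDeriv_velocity (γ := fun t => (extChartAt J w).symm (l t)) hφ
    (hγ.mdifferentiableAt (by simp))
  have h2 : (fun t => extChartAt J w ((extChartAt J w).symm (l t))) =ᶠ[𝓝 0] l := by
    have := hl.continuous.continuousAt.preimage_mem_nhds
      (hl0 ▸ extChartAt_target_mem_nhds w : (extChartAt J w).target ∈ 𝓝 (l 0))
    filter_upwards [this] with t ht using (extChartAt J w).right_inv ht
  rw [h2.deriv_eq, hl'.deriv] at h1
  have key : ∀ a, a = w → ∀ v : EW, dirDeriv J (extChartAt J w) a v =
      (mfderiv J 𝓘(ℝ, EW) (extChartAt J w) w v : EW) := by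
    rintro _ rfl v
    rfl
  exact (isInvertible_mfderiv_extChartAt (mem_extChartAt_source (I := J) w)).injective
    ((key _ hγ0 _).symm.trans h1)

/-- A function vanishing on `S` near `w` is constant along the generating curves; the kernel of its
derivative is a subspace, so it contains their span. -/
theorem dirDeriv_eq_zero_of_mem_tangentSubspace {S : Set W} {w : W} {U : TangentSpace J w}
    (hU : U ∈ tangentSubspace J S w) {g : W → G} (hg : MDifferentiableAt J 𝓘(ℝ, G) g w)
    (h : ∀ᶠ y in 𝓝 w, y ∈ S → g y = 0) : dirDeriv J g w U = 0 := by
  have hle : tangentSubspace J S w ≤ (mfderiv J 𝓘(ℝ, G) g w).toLinearMap.ker := by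
    refine Submodule.span_le.2 ?_
    rintro v ⟨γ, hγ, rfl, hS, rfl⟩
    change dirDeriv J g (γ 0) (mfderiv 𝓘(ℝ, ℝ) J γ 0 (1 : ℝ)) = 0
    rw [dirDeriv_velocity hg (hγ.mdifferentiableAt (by simp))]
    have h0 : (fun t => g (γ t)) =ᶠ[𝓝 0] fun _ => 0 := by
      filter_upwards [hS, hγ.continuousAt.eventually h] with t ht ht' using ht' ht
    rw [h0.deriv_eq, deriv_const]
  exact hle hU

/-- Push a curve with velocity `U` into `S` by `Φ`: the velocity is unchanged, so `U` is itself a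
generator of the span. -/
theorem mem_tangentSubspace_of_map [J.Boundaryless] [IsManifold J ∞ W] {S : Set W} {w : W}
    {U : TangentSpace J w} {Φ : W → W} (hΦ : ContMDiffAt J J ∞ Φ w) (hw : Φ w = w)
    (hS : ∀ᶠ y in 𝓝 w, Φ y ∈ S) (hU : (mfderiv J J Φ w U : EW) = U) :
    U ∈ tangentSubspace J S w := by
  obtain ⟨γ, hγ, rfl, hγU⟩ := exists_curve w U
  refine Submodule.subset_span ⟨fun t => Φ (γ t), hΦ.comp 0 hγ, hw,
    hγ.continuousAt.eventually hS, ?_⟩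
  have h := mfderiv_comp (0 : ℝ) (hΦ.mdifferentiableAt (by simp)) (hγ.mdifferentiableAt (by simp))
  refine (congrArg (fun l : ℝ →L[ℝ] EW => l 1) h).trans ?_
  exact (congrArg (fun v : EW => (mfderiv J J Φ (γ 0) v : EW)) hγU).trans hU

end Curve

end AlgebroidData

/-! ### Tangent spaces of submanifolds given by solved equations in a vector bundle. -/

namespace Bundle.Trivialization

variable {EN HN N : Type*} [NormedAddCommGroup EN] [NormedSpace ℝ EN]
  [TopologicalSpace HN] [TopologicalSpace N] [ChartedSpace HN N] {I : ModelWithCorners ℝ EN HN}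
  [IsManifold I ∞ N] [I.Boundaryless]
  {G : Type*} [NormedAddCommGroup G] [NormedSpace ℝ G]
  {V : N → Type*} [∀ x, AddCommGroup (V x)] [∀ x, Module ℝ (V x)]
  [TopologicalSpace (TotalSpace G V)] [∀ x, TopologicalSpace (V x)]
  [FiberBundle G V] [VectorBundle ℝ G V] [ContMDiffVectorBundle ∞ G V I]
  (e : Trivialization G (π G V)) [MemTrivializationAtlas e]

/-- The tangent space of a submanifold of a vector bundle which is given, in a local
trivialization, by an equation `κ = 0` such that subtracting `κ` from the fibre coordinate retracts
onto the submanifold. -/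
theorem mem_tangentSubspace_iff {κ : TotalSpace G V → G} {S : Set (TotalSpace G V)}
    {w : TotalSpace G V} (hw : w ∈ e.source) (hwS : w ∈ S)
    (hκ : ContMDiffNear (I.prod 𝓘(ℝ, G)) 𝓘(ℝ, G) κ w)
    (h1 : ∀ᶠ y in 𝓝 w, y ∈ S → κ y = 0)
    (h2 : ∀ᶠ y in 𝓝 w, ∀ z : TotalSpace G V, z.proj = y.proj → e.fib z = e.fib y - κ y → z ∈ S)
    (U : TangentSpace (I.prod 𝓘(ℝ, G)) w) :
    U ∈ AlgebroidData.tangentSubspace (I.prod 𝓘(ℝ, G)) S w ↔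
      dirDeriv (I.prod 𝓘(ℝ, G)) κ w U = 0 := by
  refine ⟨fun hU => AlgebroidData.dirDeriv_eq_zero_of_mem_tangentSubspace hU
    hκ.mdifferentiableAt h1, fun hU => ?_⟩
  -- The retraction onto `S`: keep the base point and subtract the defect `κ` from the fibre
  -- coordinate.
  let Φ : TotalSpace G V → TotalSpace G V := fun y =>
    e.toOpenPartialHomeomorph.symm (y.proj, e.fib y - κ y)
  have hκ0 : κ w = 0 := h1.self_of_nhds hwS
  have hfib := e.contMDiffNear_fib (I := I) hw
  have hΦw : Φ w = w := by
    simp only [Φ, hκ0, sub_zero]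
    have h : (w.proj, e.fib w) = e w := e.mk_proj_snd hw
    rw [h]
    exact e.left_inv hw
  have htgt : ∀ y ∈ e.source, (y.proj, e.fib y - κ y) ∈ e.target := fun y hy =>
    e.mem_target.2 (e.mem_source.1 hy)
  have hΦ : ContMDiffAt (I.prod 𝓘(ℝ, G)) (I.prod 𝓘(ℝ, G)) ∞ Φ w :=
    ContMDiffAt.comp w (((e.contMDiffOn_symm (n := ∞) (IB := I))).contMDiffAt
      (e.open_target.mem_nhds (htgt w hw)))
      ((Bundle.contMDiff_proj V).contMDiffAt.prodMk (hfib.sub hκ).contMDiffAt)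
  have hproj : ∀ᶠ y in 𝓝 w, (Φ y).proj = y.proj := by
    filter_upwards [e.open_source.mem_nhds hw] with y hy using e.proj_symm_apply (htgt y hy)
  have hfibΦ : ∀ᶠ y in 𝓝 w, e.fib (Φ y) = e.fib y - κ y := by
    filter_upwards [e.open_source.mem_nhds hw] with y hy
    exact congrArg Prod.snd (e.right_inv (htgt y hy))
  refine AlgebroidData.mem_tangentSubspace_of_map hΦ hΦw ?_ ?_
  · filter_upwards [hproj, hfibΦ, h2] with y a b c using c _ a b
  have hd := hΦ.mdifferentiableAt (by simp)
  have key : ∀ a, a = w → ∀ v : EN × G,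
      (mfderiv (I.prod 𝓘(ℝ, G)) I (TotalSpace.proj : TotalSpace G V → N) a v : EN) =
        mfderiv (I.prod 𝓘(ℝ, G)) I (TotalSpace.proj : TotalSpace G V → N) w v ∧
      dirDeriv (I.prod 𝓘(ℝ, G)) e.fib a v = dirDeriv (I.prod 𝓘(ℝ, G)) e.fib w v := by
    rintro _ rfl v
    exact ⟨rfl, rfl⟩
  -- The derivative of `Φ` preserves the base part and changes the fibre part by the derivative of
  -- `κ` along `U`, which vanishes by hypothesis.
  refine e.tangent_ext (I := I) hw ?_ ?_
  · refine (key _ hΦw _).1.symm.trans ?_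
    have h3 := mfderiv_comp w (mdifferentiableAt_proj (I := I) (Φ w)) hd
    have h4 : (TotalSpace.proj ∘ Φ) =ᶠ[𝓝 w] (TotalSpace.proj : TotalSpace G V → N) := hproj
    have h5 := h4.mfderiv_eq (I := I.prod 𝓘(ℝ, G)) (I' := I)
    exact (congrArg (fun l : EN × G →L[ℝ] EN => l U) h3).symm.trans
      (congrArg (fun l : EN × G →L[ℝ] EN => l U) h5)
  · refine (key _ hΦw _).2.symm.trans ?_
    have hd2 : MDifferentiableAt (I.prod 𝓘(ℝ, G)) 𝓘(ℝ, G) e.fib (Φ w) := by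
      rw [hΦw]
      exact hfib.mdifferentiableAt
    refine (dirDeriv_comp hd2 hd U).symm.trans ?_
    rw [dirDeriv_congr hfibΦ, dirDeriv_sub hfib.mdifferentiableAt hκ.mdifferentiableAt, hU, sub_zero]

end Bundle.Trivialization

/-! ## Fibre derivatives -/

section FibreDeriv

variable {EP HP P : Type*} [NormedAddCommGroup EP] [NormedSpace ℝ EP]
  [TopologicalSpace HP] [TopologicalSpace P] [ChartedSpace HP P] {I : ModelWithCorners ℝ EP HP}
  {F G : Type*} [NormedAddCommGroup F] [NormedSpace ℝ F] [NormedAddCommGroup G] [NormedSpace ℝ G]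

/-- The derivative of a function on `P × F` in the direction of `F`. -/
noncomputable def fibreDeriv (H : P × F → G) (q : P × F) : F →L[ℝ] G :=
  fderiv ℝ (fun v => H (q.1, v)) q.2

theorem contDiffAt_fibre {H : P × F → G} {q : P × F}
    (hH : ContMDiffAt (I.prod 𝓘(ℝ, F)) 𝓘(ℝ, G) ∞ H q) :
    ContDiffAt ℝ ∞ (fun v => H (q.1, v)) q.2 := by
  have h : ContMDiffAt 𝓘(ℝ, F) (I.prod 𝓘(ℝ, F)) ∞ (fun v : F => (q.1, v)) q.2 :=
    contMDiffAt_const.prodMk contMDiffAt_id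
  exact (ContMDiffAt.comp q.2 (f := fun v : F => (q.1, v)) (g := H) hH h).contDiffAt

/-- A derivative with parameters: the point of `P × F` serves as parameter of the map `v ↦ H (q.1,
v)` and also supplies, by its second component, the place of evaluation. Source and target are
vector spaces, so the tangent coordinates are trivial. -/
theorem contMDiffNear_fibreDeriv [IsManifold I ∞ P] {H : P × F → G} {q : P × F}
    (hH : ContMDiffNear (I.prod 𝓘(ℝ, F)) 𝓘(ℝ, G) H q) :
    ContMDiffNear (I.prod 𝓘(ℝ, F)) 𝓘(ℝ, F →L[ℝ] G) (fibreDeriv H) q := by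
  filter_upwards [hH] with q hq
  have h1 : ContMDiffAt ((I.prod 𝓘(ℝ, F)).prod 𝓘(ℝ, F)) 𝓘(ℝ, G) ∞
      (Function.uncurry fun (q : P × F) (v : F) => H (q.1, v)) (q, q.2) := by
    refine ContMDiffAt.comp (q, q.2) (g := H) (f := fun p : (P × F) × F => (p.1.1, p.2)) hq ?_
    exact (contMDiffAt_fst.fst).prodMk contMDiffAt_snd
  have h2 := ContMDiffAt.mfderiv (m := ∞) (fun (q : P × F) (v : F) => H (q.1, v)) Prod.snd h1
    contMDiffAt_snd (by norm_cast)
  refine h2.congr_of_eventuallyEq (.of_forall fun y => ?_)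
  refine Eq.trans ?_ (congrFun (inTangentCoordinates_model_space Prod.snd
    (fun y : P × F => H (y.1, y.2))
    (fun y => (mfderiv 𝓘(ℝ, F) 𝓘(ℝ, G) (fun v => H (y.1, v)) y.2 : F →L[ℝ] G)) q) y).symm
  exact (mfderiv_eq_fderiv (f := fun v => H (y.1, v)) (x := y.2)).symm

theorem dirDeriv_fibre [IsManifold I ∞ P] {H : P × F → G} {q : P × F}
    (hH : MDifferentiableAt (I.prod 𝓘(ℝ, F)) 𝓘(ℝ, G) H q) (c : F) :
    dirDeriv (I.prod 𝓘(ℝ, F)) H q ((0, c) : EP × F) = fibreDeriv H q c := by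
  have h1 : MDifferentiableAt 𝓘(ℝ, F) (I.prod 𝓘(ℝ, F)) (fun v : F => (q.1, v)) q.2 :=
    mdifferentiableAt_const.prodMk mdifferentiableAt_id
  have h2 := dirDeriv_comp (f := fun v : F => (q.1, v)) (w := q.2) hH h1 c
  have h3 : (mfderiv 𝓘(ℝ, F) (I.prod 𝓘(ℝ, F)) (fun v : F => (q.1, v)) q.2 c : EP × F) = (0, c) := by
    exact congrArg (fun l : F →L[ℝ] EP × F => l c)
      ((hasMFDerivAt_const (I := 𝓘(ℝ, F)) (I' := I) q.1 q.2).prodMk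
        (hasMFDerivAt_id (I := 𝓘(ℝ, F)) q.2)).mfderiv
  refine (congrArg (fun v : EP × F => dirDeriv (I.prod 𝓘(ℝ, F)) H q v) h3).symm.trans
    (h2.symm.trans ?_)
  unfold dirDeriv
  rw [mfderiv_eq_fderiv]
  rfl

end FibreDeriv

/-! ## The symplectic section on the Pontryagin bundle in coordinates -/

namespace AlgebroidData

section Pontryagin

variable {EN HN N : Type*} [NormedAddCommGroup EN] [NormedSpace ℝ EN] [FiniteDimensional ℝ EN]
  [TopologicalSpace HN] [TopologicalSpace N] [ChartedSpace HN N] {I : ModelWithCorners ℝ EN HN}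
  [IsManifold I ∞ N] [I.Boundaryless]
  {F : Type*} [NormedAddCommGroup F] [NormedSpace ℝ F] [FiniteDimensional ℝ F]
  {A : N → Type*} [∀ x, AddCommGroup (A x)] [∀ x, Module ℝ (A x)]
  [TopologicalSpace (TotalSpace F A)] [∀ x, TopologicalSpace (A x)]
  [FiberBundle F A] [VectorBundle ℝ F A] [ContMDiffVectorBundle ∞ F A I]

/-- The local trivialization of the Pontryagin bundle induced by that of `A` around `x₀`. -/
noncomputable abbrev pontTriv (F : Type*) [NormedAddCommGroup F] [NormedSpace ℝ F]
    (A : N → Type*) [∀ x, AddCommGroup (A x)] [∀ x, Module ℝ (A x)]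
    [TopologicalSpace (TotalSpace F A)] [∀ x, TopologicalSpace (A x)]
    [FiberBundle F A] [VectorBundle ℝ F A] (x₀ : N) :
    Trivialization (F × (F →L[ℝ] ℝ)) (π (F × (F →L[ℝ] ℝ)) (fun x => A x × DualFiber A x)) :=
  trivializationAt (F × (F →L[ℝ] ℝ)) (fun x => A x × DualFiber A x) x₀

theorem pontTriv_fib_snd {x₀ : N} {w : Pontryagin F A}
    (hw : w.proj ∈ (trivializationAt F A x₀).baseSet) (c : F) :
    ((pontTriv F A x₀).fib w).2 c = dualCoeff (trivializationAt F A x₀) (pr₂ w) c :=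
  trivializationAt_dual_apply (μ := pr₂ w) hw c

theorem dirDeriv_dualCoeff {x₀ : N} {w : Pontryagin F A}
    (hw : w.proj ∈ (trivializationAt F A x₀).baseSet) (c : F)
    (U : TangentSpace (pontryaginModel I F) w) :
    dirDeriv (pontryaginModel I F)
      (fun y => dualCoeff (trivializationAt F A x₀) (pr₂ y) c) w U =
      (dirDeriv (pontryaginModel I F) (pontTriv F A x₀).fib w U).2 c := by
  have hs := (trivializationAt_pontryagin_source x₀ w).2 hw
  have h1 := ((pontTriv F A x₀).contMDiffNear_fib (I := I) hs).mdifferentiableAt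
  have h2 : (fun y : Pontryagin F A => dualCoeff (trivializationAt F A x₀) (pr₂ y) c) =ᶠ[𝓝 w]
      fun y => ((ContinuousLinearMap.apply ℝ ℝ c).comp
        (ContinuousLinearMap.snd ℝ F (F →L[ℝ] ℝ))) ((pontTriv F A x₀).fib y) := by
    filter_upwards [eventually_proj_mem (trivializationAt F A x₀).open_baseSet hw] with y hy
    exact (pontTriv_fib_snd hy c).symm
  rw [dirDeriv_congr h2, dirDeriv_clm _ h1]
  rfl

variable {D : AlgebroidData I A} (hD : D.IsLie (SmoothSec I F))
include hD

/-- The coordinate formula behind the nondegeneracy argument. The `A`-part of the fibre coordinate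
and its derivative do not occur: they enter only through the equations of the submanifold. -/
theorem pontryaginSection_apply {x₀ : N} {w : Pontryagin F A}
    (hw : w.proj ∈ (trivializationAt F A x₀).baseSet) (u v : D.pontryaginProl F A w) :
    D.pontryaginSection F A w u v =
      (dirDeriv (pontryaginModel I F) (pontTriv F A x₀).fib w v.1.2).2
          (trivializationAt F A x₀ ⟨w.proj, u.1.1⟩).2 -
        (dirDeriv (pontryaginModel I F) (pontTriv F A x₀).fib w u.1.2).2
          (trivializationAt F A x₀ ⟨w.proj, v.1.1⟩).2 +
        ((pontTriv F A x₀).fib w).2 (D.frameCoeff (trivializationAt F A x₀) w.proj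
          (trivializationAt F A x₀ ⟨w.proj, u.1.1⟩).2
          (trivializationAt F A x₀ ⟨w.proj, v.1.1⟩).2) := by
  rw [pontryaginSection_eq hD hw, frameDiff, dirDeriv_dualCoeff hw, dirDeriv_dualCoeff hw,
    pontTriv_fib_snd hw]
  ring

theorem isLinearMap_pontryaginSection_left (w : Pontryagin F A) (v : D.pontryaginProl F A w) :
    IsLinearMap ℝ (fun u => D.pontryaginSection F A w u v) := by
  have hw : w.proj ∈ (trivializationAt F A w.proj).baseSet :=
    FiberBundle.mem_baseSet_trivializationAt' w.proj
  have h1 := isLinearMap_snd (trivializationAt F A w.proj) hw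
  have h2 := hD.isLinearMap_frameCoeff_left (trivializationAt F A w.proj) hw
    (trivializationAt F A w.proj ⟨w.proj, v.1.1⟩).2
  constructor
  · intro u u'
    have e1 := h1.map_add u.1.1 u'.1.1
    have e2 := dirDeriv_vadd (J := pontryaginModel I F) (pontTriv F A w.proj).fib u.1.2 u'.1.2
    have e3 := h2.map_add (trivializationAt F A w.proj ⟨w.proj, u.1.1⟩).2
      (trivializationAt F A w.proj ⟨w.proj, u'.1.1⟩).2
    simp only [pontryaginSection_apply hD hw]
    change _ - (dirDeriv (pontryaginModel I F) (pontTriv F A w.proj).fib w (u.1.2 + u'.1.2)).2 _ +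
      _ = _
    change (dirDeriv (pontryaginModel I F) (pontTriv F A w.proj).fib w v.1.2).2
      (trivializationAt F A w.proj ⟨w.proj, u.1.1 + u'.1.1⟩).2 - _ + ((pontTriv F A w.proj).fib w).2
        (D.frameCoeff (trivializationAt F A w.proj) w.proj
          (trivializationAt F A w.proj ⟨w.proj, u.1.1 + u'.1.1⟩).2 _) = _
    rw [e1, e2, e3]
    simp only [map_add, Prod.snd_add, add_apply]
    ring
  · intro c u
    have e1 := h1.map_smul c u.1.1
    have e2 := dirDeriv_vsmul (J := pontryaginModel I F) (pontTriv F A w.proj).fib c u.1.2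
    have e3 := h2.map_smul c (trivializationAt F A w.proj ⟨w.proj, u.1.1⟩).2
    simp only [pontryaginSection_apply hD hw]
    change (dirDeriv (pontryaginModel I F) (pontTriv F A w.proj).fib w v.1.2).2
      (trivializationAt F A w.proj ⟨w.proj, c • u.1.1⟩).2 -
        (dirDeriv (pontryaginModel I F) (pontTriv F A w.proj).fib w (c • u.1.2)).2 _ +
        ((pontTriv F A w.proj).fib w).2 (D.frameCoeff (trivializationAt F A w.proj) w.proj
          (trivializationAt F A w.proj ⟨w.proj, c • u.1.1⟩).2 _) = _
    rw [e1, e2, e3]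
    simp only [map_smul, Prod.smul_snd, smul_apply, smul_eq_mul]
    ring

theorem pontryaginSection_skew (w : Pontryagin F A) (u v : D.pontryaginProl F A w) :
    D.pontryaginSection F A w u v = - D.pontryaginSection F A w v u := by
  have hw : w.proj ∈ (trivializationAt F A w.proj).baseSet :=
    FiberBundle.mem_baseSet_trivializationAt' w.proj
  rw [pontryaginSection_apply hD hw, pontryaginSection_apply hD hw v,
    hD.frameCoeff_skew (trivializationAt F A w.proj) hw, map_neg]
  ring

theorem pontryaginSection_self (w : Pontryagin F A) (u : D.pontryaginProl F A w) :
    D.pontryaginSection F A w u u = 0 :=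
  self_eq_neg.1 (pontryaginSection_skew hD w u u)

theorem isLinearMap_pontryaginSection_right (w : Pontryagin F A) (u : D.pontryaginProl F A w) :
    IsLinearMap ℝ (D.pontryaginSection F A w u) := by
  have h := isLinearMap_pontryaginSection_left hD w u
  constructor
  · intro v v'
    rw [pontryaginSection_skew hD, h.map_add, pontryaginSection_skew hD w v,
      pontryaginSection_skew hD w v']
    ring
  · intro c v
    rw [pontryaginSection_skew hD, h.map_smul, pontryaginSection_skew hD w v, smul_neg, neg_neg]

/-- The value of the symplectic section at a point, as a bilinear form. -/
noncomputable def pontryaginForm (w : Pontryagin F A) :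
    LinearMap.BilinForm ℝ (D.pontryaginProl F A w) :=
  LinearMap.mk₂ ℝ (D.pontryaginSection F A w)
    (fun u u' v => (isLinearMap_pontryaginSection_left hD w v).map_add u u')
    (fun c u v => (isLinearMap_pontryaginSection_left hD w v).map_smul c u)
    (fun u v v' => (isLinearMap_pontryaginSection_right hD w u).map_add v v')
    (fun c u v => (isLinearMap_pontryaginSection_right hD w u).map_smul c v)

/-- Pulled back to a submanifold, the canonical section of the Pontryagin bundle is always smooth
and closed, so it is symplectic if and only if it has no kernel. -/
theorem isSymplecticOn_pontryagin_iff (S : Set (Pontryagin F A)) :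
    D.IsSymplecticOn F S (D.pontryaginSection F A) ↔
      ∀ w ∈ S, ∀ u ∈ D.restrictFiber (pontryaginModel I F) TotalSpace.proj S w,
        (∀ v ∈ D.restrictFiber (pontryaginModel I F) TotalSpace.proj S w,
          D.pontryaginSection F A w u v = 0) → u = 0 := by
  constructor
  · intro h w hw u hu huv
    obtain ⟨β, hβ, -, hn⟩ := h.nondegenerate w hw
    have h0 := hn.1 ⟨u, hu⟩ fun v => (hβ _ v).trans (huv v.1 v.2)
    exact congrArg Subtype.val h0
  · intro h
    refine ⟨fun w hw => ?_, fun w _ X Y hX hY => ?_, fun w _ X Y Z hX hY hZ =>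
      d₂_pontryaginSection hD hX.1 hY.1 hZ.1⟩
    · let R := D.restrictFiber (pontryaginModel I F) TotalSpace.proj S w
      let β : LinearMap.BilinForm ℝ R := (pontryaginForm hD w).restrict R
      have hβ : ∀ u v : R, β u v = D.pontryaginSection F A w u v := fun _ _ => rfl
      have halt : β.IsAlt := fun u => pontryaginSection_self hD w u
      refine ⟨β, hβ, halt, ?_⟩
      have hl : ∀ u : R, (∀ v, β u v = 0) → u = 0 := fun u hu =>
        Subtype.ext (h w hw u u.2 fun v hv => hu ⟨v, hv⟩)
      -- Skew-symmetry turns the right kernel into the left one.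
      refine ⟨hl, fun v hv => hl v fun u => ?_⟩
      rw [hβ, pontryaginSection_skew hD, ← hβ, hv u, neg_zero]
    · exact (contMDiffNear_pontryaginSection hD hX.1 hY.1).contMDiffAt.contMDiffWithinAt

end Pontryagin

end AlgebroidData

/-! ## The second-order constraint submanifold in coordinates -/

namespace LieAlgebroid

variable {B F M : Type*} {E : M → Type*}
  [NormedAddCommGroup B] [NormedSpace ℝ B] [NormedAddCommGroup F] [NormedSpace ℝ F]
  [TopologicalSpace M] [ChartedSpace B M] [IsManifold 𝓘(ℝ, B) ∞ M]
  [TopologicalSpace (TotalSpace F E)] [∀ x, TopologicalSpace (E x)]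
  [∀ x, AddCommGroup (E x)] [∀ x, Module ℝ (E x)] [FiberBundle F E] [VectorBundle ℝ F E]
  [ContMDiffVectorBundle ∞ F E 𝓘(ℝ, B)]

section Vertical

variable (e : Trivialization F (π F E)) [MemTrivializationAtlas e]

theorem dirDeriv_verticalLift {a : TotalSpace F E} (ha : a ∈ e.source) (b : E a.proj) :
    dirDeriv (𝓘(ℝ, B).prod 𝓘(ℝ, F)) (fibCoord e) a (verticalLift a b) = (e ⟨a.proj, b⟩).2 := by
  have hb : a.proj ∈ e.baseSet := e.mem_source.1 ha
  let γ : ℝ → TotalSpace F E := fun t => ⟨a.proj, a.2 + t • b⟩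
  have hγ0 : γ 0 = a := by simp [γ]
  have hlin := isLinearMap_snd e hb
  -- The trivialization is linear on the fibre, so the curve is affine in the fibre coordinate.
  have heq : ∀ t, fibCoord e (γ t) = fibCoord e a + t • (e ⟨a.proj, b⟩).2 := fun t => by
    have h1 := hlin.map_add a.2 (t • b)
    have h2 := hlin.map_smul t b
    rw [h2] at h1
    exact h1
  have hder : HasDerivAt (fun t : ℝ => fibCoord e a + t • (e ⟨a.proj, b⟩).2)
      (e ⟨a.proj, b⟩).2 0 := by
    have h : HasDerivAt (fun t : ℝ => t • (e ⟨a.proj, b⟩).2) (e ⟨a.proj, b⟩).2 0 := by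
      simpa using (hasDerivAt_id (0 : ℝ)).smul_const (e ⟨a.proj, b⟩).2
    exact h.const_add _
  have hγ : MDifferentiableAt 𝓘(ℝ, ℝ) (𝓘(ℝ, B).prod 𝓘(ℝ, F)) γ 0 := by
    refine ((e.contMDiffAt_iff (n := ∞) (f := γ) (x₀ := (0 : ℝ)) (e.mem_source.2 hb)).2
      ⟨contMDiffAt_const, ?_⟩).mdifferentiableAt (by simp)
    have h : ContDiff ℝ ∞ (fun t : ℝ => fibCoord e a + t • (e ⟨a.proj, b⟩).2) :=
      contDiff_const.add (contDiff_id.smul contDiff_const)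
    exact h.contMDiff.contMDiffAt.congr_of_eventuallyEq (.of_forall heq)
  have hfib : MDifferentiableAt (𝓘(ℝ, B).prod 𝓘(ℝ, F)) 𝓘(ℝ, F) (fibCoord e) (γ 0) := by
    rw [hγ0]
    exact (e.contMDiffNear_fib (I := 𝓘(ℝ, B)) ha).mdifferentiableAt
  have h := AlgebroidData.dirDeriv_velocity hfib hγ
  rw [funext heq, hder.deriv] at h
  have key : ∀ a', a' = a → ∀ v : B × F, dirDeriv (𝓘(ℝ, B).prod 𝓘(ℝ, F)) (fibCoord e) a' v =
      dirDeriv (𝓘(ℝ, B).prod 𝓘(ℝ, F)) (fibCoord e) a v := by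
    rintro _ rfl v
    rfl
  exact (key _ hγ0 _).symm.trans h

theorem Tan.coords_vert (A : LieAlgebroid B F E) {a : TotalSpace F E} (ha : a ∈ e.source)
    (b : E a.proj) : Tan.coords A e a (A.vert a b) = (0, (e ⟨a.proj, b⟩).2) :=
  Prod.ext (map_zero (e.linearMapAt ℝ a.proj)) (dirDeriv_verticalLift e ha b)

end Vertical

variable [FiniteDimensional ℝ B] [FiniteDimensional ℝ F]
  [∀ x, IsTopologicalAddGroup (E x)] [∀ x, ContinuousSMul ℝ (E x)]
  (A : LieAlgebroid B F E)

/-- The local trivialization of `𝒯^{τ_E} E` around `a`. -/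
noncomputable abbrev tanTriv (a : TotalSpace F E) :
    Trivialization (F × F) (π (F × F) A.Tan) := trivializationAt (F × F) A.Tan a

/-- The equation z = y, read off by comparing `b` and `e` in one trivialization of `E`. -/
theorem mem_E2_iff {a : TotalSpace F E} {p : A.TanTotal}
    (hp : p.proj ∈ (trivializationAt F E a.proj).source) :
    p ∈ A.E2 ↔ (A.tanTriv a p).2.1 = fibCoord (trivializationAt F E a.proj) p.proj := by
  have hb : p.proj.proj ∈ (trivializationAt F E a.proj).baseSet :=
    (Trivialization.mem_source _).1 hp
  have h : (A.tanTriv a p).2.1 = (trivializationAt F E a.proj ⟨p.proj.proj, p.2.1.1⟩).2 := by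
    refine (Tan.coords_fst A (trivializationAt F E a.proj) p.proj p.2).trans ?_
    rw [Trivialization.coe_linearMapAt_of_mem _ hb]
  rw [h]
  exact ⟨fun h => congrArg (fun u => (trivializationAt F E a.proj ⟨p.proj.proj, u⟩).2) h,
    fun h => snd_injective _ hb h⟩

/-- The function `L` on `E^{(2)}`, in the coordinates `(a, v)` on `E^{(2)}` given by a local
trivialization of `E`. -/
noncomputable def localL (L : A.TanTotal → ℝ) (a : TotalSpace F E) (q : TotalSpace F E × F) : ℝ :=
  L ((A.tanTriv a).toOpenPartialHomeomorph.symm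
    (q.1, (fibCoord (trivializationAt F E a.proj) q.1, q.2)))

variable {A} {L : A.TanTotal → ℝ} {a : TotalSpace F E}

theorem eq_localL {p : A.TanTotal} (hp : p.proj ∈ (trivializationAt F E a.proj).source)
    (hp2 : p ∈ A.E2) : L p = A.localL L a (p.proj, (A.tanTriv a p).2.2) := by
  have hs : p ∈ (A.tanTriv a).source := (A.tanTriv a).mem_source.2 hp
  unfold localL
  rw [← (A.mem_E2_iff hp).1 hp2]
  have h : (p.proj, ((A.tanTriv a p).2.1, (A.tanTriv a p).2.2)) = A.tanTriv a p :=
    (A.tanTriv a).mk_proj_snd hs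
  exact congrArg L (((A.tanTriv a).left_inv hs).symm.trans (congrArg _ h.symm))

/-- Smoothness of `L` is assumed only within `E2`, which need not be open. The coordinate
parametrization takes values in `E2`, so the composite is smooth on an honest open set and can be
differentiated there. -/
theorem contMDiffNear_localL
    (hL : ContMDiffOn ((𝓘(ℝ, B).prod 𝓘(ℝ, F)).prod 𝓘(ℝ, F × F)) 𝓘(ℝ, ℝ) ∞ L A.E2)
    {q : TotalSpace F E × F} (hq : q.1 ∈ (trivializationAt F E a.proj).source) :
    ContMDiffNear ((𝓘(ℝ, B).prod 𝓘(ℝ, F)).prod 𝓘(ℝ, F)) 𝓘(ℝ, ℝ) (A.localL L a) q := by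
  have hopen : IsOpen ((trivializationAt F E a.proj).source ×ˢ (univ : Set F)) :=
    (trivializationAt F E a.proj).open_source.prod isOpen_univ
  refine .of_contMDiffOn (s := (trivializationAt F E a.proj).source ×ˢ (univ : Set F)) ?_
    hopen ⟨hq, mem_univ _⟩
  have htgt : ∀ q ∈ (trivializationAt F E a.proj).source ×ˢ (univ : Set F),
      ((q.1, (fibCoord (trivializationAt F E a.proj) q.1, q.2)) :
        TotalSpace F E × (F × F)) ∈ (A.tanTriv a).target := fun q hq =>
    (A.tanTriv a).mem_target.2 hq.1
  have h1 : ContMDiffOn ((𝓘(ℝ, B).prod 𝓘(ℝ, F)).prod 𝓘(ℝ, F))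
      ((𝓘(ℝ, B).prod 𝓘(ℝ, F)).prod 𝓘(ℝ, F × F)) ∞
      (fun q : TotalSpace F E × F =>
        ((q.1, (fibCoord (trivializationAt F E a.proj) q.1, q.2)) : TotalSpace F E × (F × F)))
      ((trivializationAt F E a.proj).source ×ˢ (univ : Set F)) :=
    contMDiffOn_fst.prodMk (((contMDiffOn_fibCoord (B := B) _).comp contMDiffOn_fst
      fun q hq => hq.1).prodMk_space contMDiffOn_snd)
  have h2 := ((A.tanTriv a).contMDiffOn_symm (n := ∞) (IB := 𝓘(ℝ, B).prod 𝓘(ℝ, F))).comp h1 htgt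
  refine hL.comp h2 fun q hq => ?_
  have hp : ((A.tanTriv a).toOpenPartialHomeomorph.symm
      (q.1, (fibCoord (trivializationAt F E a.proj) q.1, q.2))).proj = q.1 :=
    (A.tanTriv a).proj_symm_apply (htgt q hq)
  have hmem := A.mem_E2_iff (a := a) (p := (A.tanTriv a).toOpenPartialHomeomorph.symm
      (q.1, (fibCoord (trivializationAt F E a.proj) q.1, q.2))) (by rw [hp]; exact hq.1)
  refine hmem.2 ?_
  rw [hp]
  have h := (A.tanTriv a).right_inv (htgt q hq)
  exact congrArg (fun r => r.2.1) h

/-- Vertical elements have coordinates (0, b): z is fixed and v moves along a line. -/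
theorem tanTriv_add_smul_vert {p : A.TanTotal}
    (hp : p.proj ∈ (trivializationAt F E a.proj).source) (b : E p.proj.proj) (t : ℝ) :
    (A.tanTriv a ⟨p.proj, p.2 + t • A.vert p.proj b⟩).2 = ((A.tanTriv a p).2.1,
      (A.tanTriv a p).2.2 + t • (trivializationAt F E a.proj ⟨p.proj.proj, b⟩).2) := by
  have h : (A.tanTriv a ⟨p.proj, p.2 + t • A.vert p.proj b⟩).2 =
      Tan.coords A (trivializationAt F E a.proj) p.proj (p.2 + t • A.vert p.proj b) := rfl
  rw [h, map_add, map_smul, Tan.coords_vert _ A hp]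
  refine Prod.ext ?_ rfl
  change _ + t • (0 : F) = _
  rw [smul_zero, add_zero]
  rfl

theorem add_smul_vert_mem_E2 {p : A.TanTotal}
    (hp2 : p ∈ A.E2) (b : E p.proj.proj) (t : ℝ) :
    (⟨p.proj, p.2 + t • A.vert p.proj b⟩ : A.TanTotal) ∈ A.E2 := by
  change p.2.1.1 + t • (0 : E p.proj.proj) = p.1.2
  rw [smul_zero, add_zero]
  exact hp2

theorem differentiable_localL
    (hL : ContMDiffOn ((𝓘(ℝ, B).prod 𝓘(ℝ, F)).prod 𝓘(ℝ, F × F)) 𝓘(ℝ, ℝ) ∞ L A.E2)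
    {c : TotalSpace F E} (hc : c ∈ (trivializationAt F E a.proj).source) :
    Differentiable ℝ (fun v => A.localL L a (c, v)) := fun v =>
  (contDiffAt_fibre (q := (c, v)) (contMDiffNear_localL hL hc).contMDiffAt).differentiableAt
    (by simp)

theorem differentiable_fibreDeriv_localL
    (hL : ContMDiffOn ((𝓘(ℝ, B).prod 𝓘(ℝ, F)).prod 𝓘(ℝ, F × F)) 𝓘(ℝ, ℝ) ∞ L A.E2)
    {c : TotalSpace F E} (hc : c ∈ (trivializationAt F E a.proj).source) :
    Differentiable ℝ (fun v => fibreDeriv (A.localL L a) (c, v)) := fun v =>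
  (contDiffAt_fibre (q := (c, v))
    (contMDiffNear_fibreDeriv (contMDiffNear_localL hL hc)).contMDiffAt).differentiableAt
    (by simp)

theorem dz_eq (hL : ContMDiffOn ((𝓘(ℝ, B).prod 𝓘(ℝ, F)).prod 𝓘(ℝ, F × F)) 𝓘(ℝ, ℝ) ∞ L A.E2)
    {p : A.TanTotal} (hp : p.proj ∈ (trivializationAt F E a.proj).source) (hp2 : p ∈ A.E2)
    (b : E p.proj.proj) :
    A.dz L p b = fibreDeriv (A.localL L a) (p.proj, (A.tanTriv a p).2.2)
      (trivializationAt F E a.proj ⟨p.proj.proj, b⟩).2 := by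
  have h : ∀ t : ℝ, L ⟨p.proj, p.2 + t • A.vert p.proj b⟩ = A.localL L a (p.proj,
      (A.tanTriv a p).2.2 + t • (trivializationAt F E a.proj ⟨p.proj.proj, b⟩).2) := by
    intro t
    refine (eq_localL (L := L) (a := a) (p := ⟨p.proj, p.2 + t • A.vert p.proj b⟩) hp
      (add_smul_vert_mem_E2 hp2 b t)).trans ?_
    rw [tanTriv_add_smul_vert hp]
  unfold dz
  rw [funext h]
  -- After the rewriting, the derivative at time 0 along the line is a `lineDeriv` by definition.
  exact (differentiable_localL hL hp _).lineDeriv_eq_fderiv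

theorem hess_eq (hL : ContMDiffOn ((𝓘(ℝ, B).prod 𝓘(ℝ, F)).prod 𝓘(ℝ, F × F)) 𝓘(ℝ, ℝ) ∞ L A.E2)
    {p : A.TanTotal} (hp : p.proj ∈ (trivializationAt F E a.proj).source) (hp2 : p ∈ A.E2)
    (b b' : E p.proj.proj) :
    A.hess L p b b' = fibreDeriv (fibreDeriv (A.localL L a)) (p.proj, (A.tanTriv a p).2.2)
      (trivializationAt F E a.proj ⟨p.proj.proj, b⟩).2
      (trivializationAt F E a.proj ⟨p.proj.proj, b'⟩).2 := by
  have h : ∀ t : ℝ, A.dz L ⟨p.proj, p.2 + t • A.vert p.proj b⟩ b' =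
      fibreDeriv (A.localL L a) (p.proj, (A.tanTriv a p).2.2 +
        t • (trivializationAt F E a.proj ⟨p.proj.proj, b⟩).2)
        (trivializationAt F E a.proj ⟨p.proj.proj, b'⟩).2 := by
    intro t
    rw [dz_eq (a := a) hL (p := ⟨p.proj, p.2 + t • A.vert p.proj b⟩) hp
      (add_smul_vert_mem_E2 hp2 b t), tanTriv_add_smul_vert hp]
  have hd := differentiable_fibreDeriv_localL hL hp (A.tanTriv a p).2.2
  unfold hess
  rw [funext h]
  refine ((hd.clm_apply (differentiableAt_const _)).lineDeriv_eq_fderiv).trans ?_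
  rw [fderiv_clm_apply hd (differentiableAt_const _)]
  simp [fibreDeriv]

/-- The equations z = y and p̄ = ∂L/∂v: pairing with vertical elements isolates p̄, and every `c` is
the coordinate of some `b` in the fibre of `E`. -/
theorem mem_W1_iff (hL : ContMDiffOn ((𝓘(ℝ, B).prod 𝓘(ℝ, F)).prod 𝓘(ℝ, F × F)) 𝓘(ℝ, ℝ) ∞ L A.E2)
    {w : A.Pont} (hw : w.proj ∈ (trivializationAt F E a.proj).source) :
    w ∈ A.W1 L ↔ ((AlgebroidData.pontTriv (F × F) A.Tan a).fib w).1.1 =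
        fibCoord (trivializationAt F E a.proj) w.proj ∧
      ∀ c, ((AlgebroidData.pontTriv (F × F) A.Tan a).fib w).2 (0, c) =
        fibreDeriv (A.localL L a)
          (w.proj, ((AlgebroidData.pontTriv (F × F) A.Tan a).fib w).1.2) c := by
  have hb : w.proj.proj ∈ (trivializationAt F E a.proj).baseSet :=
    (Trivialization.mem_source _).1 hw
  have hE2 : w ∈ A.W0 ↔ ((AlgebroidData.pontTriv (F × F) A.Tan a).fib w).1.1 =
      fibCoord (trivializationAt F E a.proj) w.proj :=
    A.mem_E2_iff (a := a) (p := AlgebroidData.pr₁ w) hw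
  have hvert : ∀ b, w.2.2 (A.vert w.proj b) =
      ((AlgebroidData.pontTriv (F × F) A.Tan a).fib w).2
        (0, (trivializationAt F E a.proj ⟨w.proj.proj, b⟩).2) := by
    intro b
    have h : (A.tanTriv a ⟨w.proj, A.vert w.proj b⟩).2 =
        (0, (trivializationAt F E a.proj ⟨w.proj.proj, b⟩).2) := Tan.coords_vert _ A hw b
    rw [← h, AlgebroidData.pontTriv_fib_snd (show w.proj ∈ (A.tanTriv a).baseSet from hw)]
    exact (AlgebroidData.dualCoeff_snd (A.tanTriv a) (μ := AlgebroidData.pr₂ w) hw _).symm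
  have hdz : ∀ h : w ∈ A.W0, ∀ b, A.dz L (AlgebroidData.pr₁ w) b =
      fibreDeriv (A.localL L a)
        (w.proj, ((AlgebroidData.pontTriv (F × F) A.Tan a).fib w).1.2)
        (trivializationAt F E a.proj ⟨w.proj.proj, b⟩).2 := fun h b =>
    dz_eq hL (p := AlgebroidData.pr₁ w) hw h b
  constructor
  · rintro ⟨h0, h⟩
    refine ⟨hE2.1 h0, fun c => ?_⟩
    have h1 := (hvert ((trivializationAt F E a.proj).symm w.proj.proj c)).symm.trans
      ((h _).trans (hdz h0 _))
    rwa [snd_symm _ hb] at h1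
  · rintro ⟨h0, h⟩
    refine ⟨hE2.2 h0, fun b => ?_⟩
    exact (hvert b).trans ((h _).trans (hdz (hE2.2 h0) b).symm)

end LieAlgebroid

/-! ## Nondegeneracy on the second-order constraint submanifold -/

namespace LieAlgebroid

variable {B F M : Type*} {E : M → Type*}
  [NormedAddCommGroup B] [NormedSpace ℝ B] [NormedAddCommGroup F] [NormedSpace ℝ F]
  [TopologicalSpace M] [ChartedSpace B M] [IsManifold 𝓘(ℝ, B) ∞ M]
  [TopologicalSpace (TotalSpace F E)] [∀ x, TopologicalSpace (E x)]
  [∀ x, AddCommGroup (E x)] [∀ x, Module ℝ (E x)] [FiberBundle F E] [VectorBundle ℝ F E]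
  [ContMDiffVectorBundle ∞ F E 𝓘(ℝ, B)] [FiniteDimensional ℝ B] [FiniteDimensional ℝ F]
  [∀ x, IsTopologicalAddGroup (E x)] [∀ x, ContinuousSMul ℝ (E x)]
  {A : LieAlgebroid B F E}

/-- The model with corners of the total space of the Pontryagin bundle of `𝒯^{τ_E} E`. -/
noncomputable abbrev pontModel (B F : Type*) [NormedAddCommGroup B] [NormedSpace ℝ B]
    [NormedAddCommGroup F] [NormedSpace ℝ F] :=
  AlgebroidData.pontryaginModel (𝓘(ℝ, B).prod 𝓘(ℝ, F)) (F × F)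

variable (A) in
/-- The fibre coordinates on the Pontryagin bundle. -/
noncomputable abbrev pontFib (a : TotalSpace F E) (w : A.Pont) :
    (F × F) × ((F × F) →L[ℝ] ℝ) :=
  (AlgebroidData.pontTriv (F × F) A.Tan a).fib w

/-- The components of the equation of `W₁` in local coordinates. -/
noncomputable def constraint (L : A.TanTotal → ℝ) (a : TotalSpace F E) (w : A.Pont) :
    (F × F) × ((F × F) →L[ℝ] ℝ) :=
  (((A.pontFib a w).1.1 - fibCoord (trivializationAt F E a.proj) w.proj, 0),
    ((A.pontFib a w).2.comp (ContinuousLinearMap.inr ℝ F F) -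
      fibreDeriv (A.localL L a) (w.proj, (A.pontFib a w).1.2)).comp
      (ContinuousLinearMap.snd ℝ F F))

/-- The linear map that extracts `(z, p̄)` from the fibre coordinates `(z, v, p, p̄)`. -/
noncomputable def constraintPart (F : Type*) [NormedAddCommGroup F] [NormedSpace ℝ F] :
    (F × F) × ((F × F) →L[ℝ] ℝ) →L[ℝ] F × (F →L[ℝ] ℝ) :=
  ((ContinuousLinearMap.fst ℝ F F).comp (ContinuousLinearMap.fst ℝ _ _)).prod
    (((ContinuousLinearMap.compL ℝ F (F × F) ℝ).flip (ContinuousLinearMap.inr ℝ F F)).comp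
      (ContinuousLinearMap.snd ℝ _ _))

/-- The inclusion of the coordinates `(z, p̄)` in the fibre coordinates `(z, v, p, p̄)`. -/
noncomputable def constraintIncl (F : Type*) [NormedAddCommGroup F] [NormedSpace ℝ F] :
    F × (F →L[ℝ] ℝ) →L[ℝ] (F × F) × ((F × F) →L[ℝ] ℝ) :=
  (((ContinuousLinearMap.inl ℝ F F).comp (ContinuousLinearMap.fst ℝ _ _))).prod
    (((ContinuousLinearMap.compL ℝ (F × F) F ℝ).flip (ContinuousLinearMap.snd ℝ F F)).comp
      (ContinuousLinearMap.snd ℝ _ _))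

theorem constraintIncl_injective : Function.Injective (constraintIncl F) := by
  intro x y h
  have h1 := congrArg (fun z => z.1.1) h
  have h2 := congrArg (fun z => z.2) h
  refine Prod.ext h1 ?_
  ext c
  exact congrArg (fun l : F × F →L[ℝ] ℝ => l (0, c)) h2

theorem constraint_eq (L : A.TanTotal → ℝ) (a : TotalSpace F E) (w : A.Pont) :
    constraint L a w = constraintIncl F (constraintPart F (A.pontFib a w) -
      (fibCoord (trivializationAt F E a.proj) w.proj,
        fibreDeriv (A.localL L a) (w.proj, (A.pontFib a w).1.2))) := rfl

variable {L : A.TanTotal → ℝ} {a : TotalSpace F E} {w : A.Pont}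
  (hL : ContMDiffOn ((𝓘(ℝ, B).prod 𝓘(ℝ, F)).prod 𝓘(ℝ, F × F)) 𝓘(ℝ, ℝ) ∞ L A.E2)
  (hw : w.proj ∈ (trivializationAt F E a.proj).source)

include hw in
theorem contMDiffNear_pontFib :
    ContMDiffNear (pontModel B F) 𝓘(ℝ, (F × F) × ((F × F) →L[ℝ] ℝ)) (A.pontFib a) w :=
  Trivialization.contMDiffNear_fib _
    ((AlgebroidData.trivializationAt_pontryagin_source (F := F × F) (A := A.Tan) a w).2 hw)

include hw in
theorem contMDiffNear_fibCoord_proj : ContMDiffNear (pontModel B F) 𝓘(ℝ, F)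
    (fun w : A.Pont => fibCoord (trivializationAt F E a.proj) w.proj) w :=
  (Trivialization.contMDiffNear_fib (I := 𝓘(ℝ, B)) _ hw).comp
    (.of_contMDiff (Bundle.contMDiff_proj _))

include hw in
theorem contMDiffNear_proj_pontFib : ContMDiffNear (pontModel B F)
    ((𝓘(ℝ, B).prod 𝓘(ℝ, F)).prod 𝓘(ℝ, F))
    (fun w : A.Pont => (w.proj, (A.pontFib a w).1.2)) w :=
  (ContMDiffNear.of_contMDiff (Bundle.contMDiff_proj _)).prodMk
    ((contMDiffNear_pontFib hw).clm ((ContinuousLinearMap.snd ℝ F F).comp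
      (ContinuousLinearMap.fst ℝ (F × F) ((F × F) →L[ℝ] ℝ))) :)

include hL hw in
theorem contMDiffNear_momentum : ContMDiffNear (pontModel B F) 𝓘(ℝ, F →L[ℝ] ℝ)
    (fun w : A.Pont => fibreDeriv (A.localL L a) (w.proj, (A.pontFib a w).1.2)) w :=
  ContMDiffNear.comp (f := fun w : A.Pont => (w.proj, (A.pontFib a w).1.2))
    (contMDiffNear_fibreDeriv (contMDiffNear_localL hL (q := (w.proj, (A.pontFib a w).1.2)) hw))
    (contMDiffNear_proj_pontFib hw)

include hL hw in
theorem contMDiffNear_constraint :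
    ContMDiffNear (pontModel B F) 𝓘(ℝ, (F × F) × ((F × F) →L[ℝ] ℝ)) (constraint L a) w :=
  (((contMDiffNear_pontFib hw).clm (constraintPart F)).sub
    ((contMDiffNear_fibCoord_proj hw).prodMk_space (contMDiffNear_momentum hL hw))).clm
      (constraintIncl F)

include hL hw in
-- The equations are solved for z and p̄ in terms of x, y, v. Padding the defect with zeros in the v
-- and p slots gives it values in the whole fibre, and subtracting it is then a retraction onto W₁,
-- so the tangent space is cut out by the linearized equations.
theorem mem_tangentSubspace_W1_iff (hW : w ∈ A.W1 L) (U : TangentSpace (pontModel B F) w) :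
    U ∈ AlgebroidData.tangentSubspace (pontModel B F) (A.W1 L) w ↔
      (dirDeriv (pontModel B F) (A.pontFib a) w U).1.1 = dirDeriv (pontModel B F)
          (fun w : A.Pont => fibCoord (trivializationAt F E a.proj) w.proj) w U ∧
        ∀ c, (dirDeriv (pontModel B F) (A.pontFib a) w U).2 (0, c) = dirDeriv (pontModel B F)
          (fun w : A.Pont => fibreDeriv (A.localL L a) (w.proj, (A.pontFib a w).1.2)) w U c := by
  have hs := (AlgebroidData.trivializationAt_pontryagin_source (F := F × F) (A := A.Tan) a w).2 hw
  have hmem := AlgebroidData.eventually_proj_mem (trivializationAt F E a.proj).open_source hw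
  have h0 : ∀ {y : A.Pont}, y.proj ∈ (trivializationAt F E a.proj).source → y ∈ A.W1 L →
      constraint L a y = 0 := by
    intro y hy hyW
    have h := (mem_W1_iff hL hy).1 hyW
    rw [constraint_eq, show constraintPart F (A.pontFib a y) -
      (fibCoord (trivializationAt F E a.proj) y.proj,
        fibreDeriv (A.localL L a) (y.proj, (A.pontFib a y).1.2)) = 0 from
        sub_eq_zero.2 (Prod.ext h.1 (ContinuousLinearMap.ext h.2)), map_zero]
  rw [(AlgebroidData.pontTriv (F × F) A.Tan a).mem_tangentSubspace_iff hs hW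
    (contMDiffNear_constraint hL hw)]
  · rw [funext (constraint_eq L a), dirDeriv_clm _
      (((contMDiffNear_pontFib hw).clm (constraintPart F)).sub
        ((contMDiffNear_fibCoord_proj hw).prodMk_space
          (contMDiffNear_momentum hL hw))).mdifferentiableAt,
      map_eq_zero_iff _ constraintIncl_injective, dirDeriv_sub
        ((contMDiffNear_pontFib hw).clm (constraintPart F)).mdifferentiableAt
        ((contMDiffNear_fibCoord_proj hw).prodMk_space
          (contMDiffNear_momentum hL hw)).mdifferentiableAt,
      dirDeriv_clm _ (contMDiffNear_pontFib hw).mdifferentiableAt, sub_eq_zero]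
    have hd := ((contMDiffNear_fibCoord_proj hw).prodMk_space
      (contMDiffNear_momentum hL hw)).mdifferentiableAt
    have h1 := dirDeriv_clm (ContinuousLinearMap.fst ℝ F (F →L[ℝ] ℝ)) hd U
    have h2 := dirDeriv_clm (ContinuousLinearMap.snd ℝ F (F →L[ℝ] ℝ)) hd U
    refine Prod.ext_iff.trans (and_congr ?_ (ContinuousLinearMap.ext_iff.trans
      (forall_congr' fun c => ?_)))
    · exact (Eq.congr_right h1).symm
    · exact (Eq.congr_right (congrArg (fun l : F →L[ℝ] ℝ => l c) h2)).symm
  · filter_upwards [hmem] with y hy using h0 hy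
  -- The correction alters neither the base point nor v, so the quantities y and ∂L/∂v to which z
  -- and p̄ are reset stay the same.
  · filter_upwards [hmem] with y hy z hz hzf
    have hz' : z.proj ∈ (trivializationAt F E a.proj).source := hz ▸ hy
    refine (mem_W1_iff hL hz').2 ?_
    rw [hzf, hz]
    refine ⟨?_, fun c => ?_⟩
    · exact sub_sub_cancel _ _
    · change (A.pontFib a y).2 (0, c) - ((A.pontFib a y).2 (0, c) -
        fibreDeriv (A.localL L a) (y.proj, (A.pontFib a y).1.2) c) =
          fibreDeriv (A.localL L a) (y.proj, (A.pontFib a y).1.2 - 0) c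
      rw [sub_zero]
      exact sub_sub_cancel _ _

end LieAlgebroid

/-! ### The constraint algebroid over W₁ and the kernel of the symplectic section. -/

namespace LieAlgebroid

variable {B F M : Type*} {E : M → Type*}
  [NormedAddCommGroup B] [NormedSpace ℝ B] [NormedAddCommGroup F] [NormedSpace ℝ F]
  [TopologicalSpace M] [ChartedSpace B M] [IsManifold 𝓘(ℝ, B) ∞ M]
  [TopologicalSpace (TotalSpace F E)] [∀ x, TopologicalSpace (E x)]
  [∀ x, AddCommGroup (E x)] [∀ x, Module ℝ (E x)] [FiberBundle F E] [VectorBundle ℝ F E]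
  [ContMDiffVectorBundle ∞ F E 𝓘(ℝ, B)] [FiniteDimensional ℝ B] [FiniteDimensional ℝ F]
  [∀ x, IsTopologicalAddGroup (E x)] [∀ x, ContinuousSMul ℝ (E x)]
  {A : LieAlgebroid B F E}
  {L : A.TanTotal → ℝ} {a : TotalSpace F E} {w : A.Pont}
  (hL : ContMDiffOn ((𝓘(ℝ, B).prod 𝓘(ℝ, F)).prod 𝓘(ℝ, F × F)) 𝓘(ℝ, ℝ) ∞ L A.E2)
  (hw : w.proj ∈ (trivializationAt F E a.proj).source)

include hw in
-- By the prolongation condition, the image of the velocity in `T E` is the anchor of the element of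
-- 𝒯E, and the v-coordinate of that element is by definition the rate of change of y.
theorem dirDeriv_fibCoord_proj (u : A.tanData.pontryaginProl (F × F) A.Tan w) :
    dirDeriv (pontModel B F) (fun w : A.Pont => fibCoord (trivializationAt F E a.proj) w.proj) w
      u.1.2 = (A.tanTriv a ⟨w.proj, u.1.1⟩).2.2 := by
  refine (dirDeriv_comp (I := 𝓘(ℝ, B).prod 𝓘(ℝ, F)) (f := fun w : A.Pont => w.proj)
    (Trivialization.contMDiffNear_fib (I := 𝓘(ℝ, B)) _ hw).mdifferentiableAt
    (Trivialization.mdifferentiableAt_proj w) u.1.2).trans ?_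
  exact congrArg (fun v => dirDeriv (𝓘(ℝ, B).prod 𝓘(ℝ, F))
    (fibCoord (trivializationAt F E a.proj)) w.proj v) u.2.symm

include hL hw in
-- Chain rule through (base point, v); the base velocity is again replaced by the anchor, so only
-- the 𝒯E-component and δv enter.
theorem dirDeriv_momentum (u : A.tanData.pontryaginProl (F × F) A.Tan w) :
    dirDeriv (pontModel B F)
      (fun w : A.Pont => fibreDeriv (A.localL L a) (w.proj, (A.pontFib a w).1.2)) w u.1.2 =
    dirDeriv ((𝓘(ℝ, B).prod 𝓘(ℝ, F)).prod 𝓘(ℝ, F)) (fibreDeriv (A.localL L a))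
      (w.proj, (A.pontFib a w).1.2)
      ((u.1.1.1.2, (dirDeriv (pontModel B F) (A.pontFib a) w u.1.2).1.2) : (B × F) × F) := by
  have hv : MDifferentiableAt (pontModel B F) 𝓘(ℝ, F) (fun w : A.Pont => (A.pontFib a w).1.2) w :=
    ((contMDiffNear_pontFib hw).clm ((ContinuousLinearMap.snd ℝ F F).comp
      (ContinuousLinearMap.fst ℝ (F × F) ((F × F) →L[ℝ] ℝ)))).mdifferentiableAt
  have hp : MDifferentiableAt (pontModel B F) (𝓘(ℝ, B).prod 𝓘(ℝ, F))
    (TotalSpace.proj : A.Pont → TotalSpace F E) w := Trivialization.mdifferentiableAt_proj w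
  refine (dirDeriv_comp (f := fun w : A.Pont => (w.proj, (A.pontFib a w).1.2))
    (contMDiffNear_fibreDeriv (contMDiffNear_localL hL (q := (w.proj, (A.pontFib a w).1.2))
      hw)).mdifferentiableAt (contMDiffNear_proj_pontFib hw).mdifferentiableAt u.1.2).trans ?_
  have h1 := (hp.hasMFDerivAt.prodMk hv.hasMFDerivAt).mfderiv
  have h2 := dirDeriv_clm ((ContinuousLinearMap.snd ℝ F F).comp
      (ContinuousLinearMap.fst ℝ (F × F) ((F × F) →L[ℝ] ℝ)))
      (contMDiffNear_pontFib hw).mdifferentiableAt u.1.2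
  refine congrArg (fun v : (B × F) × F => dirDeriv ((𝓘(ℝ, B).prod 𝓘(ℝ, F)).prod 𝓘(ℝ, F))
    (fibreDeriv (A.localL L a)) (w.proj, (A.pontFib a w).1.2) v) ?_
  refine (congrArg (fun l : (B × F) × ((F × F) × ((F × F) →L[ℝ] ℝ)) →L[ℝ] (B × F) × F => l u.1.2)
    h1).trans ?_
  exact Prod.ext u.2.symm h2

/-- The fibre of the second-order constraint algebroid. -/
noncomputable abbrev constraintFiber (L : A.TanTotal → ℝ) (w : A.Pont) :
    Submodule ℝ (A.tanData.pontryaginProl (F × F) A.Tan w) :=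
  A.tanData.restrictFiber (pontModel B F) TotalSpace.proj (A.W1 L) w

include hL hw in
theorem mem_constraintFiber_iff (hW : w ∈ A.W1 L)
    (u : A.tanData.pontryaginProl (F × F) A.Tan w) :
    u ∈ constraintFiber L w ↔
      (dirDeriv (pontModel B F) (A.pontFib a) w u.1.2).1.1 =
          (A.tanTriv a ⟨w.proj, u.1.1⟩).2.2 ∧
        ∀ c, (dirDeriv (pontModel B F) (A.pontFib a) w u.1.2).2 (0, c) =
          dirDeriv ((𝓘(ℝ, B).prod 𝓘(ℝ, F)).prod 𝓘(ℝ, F)) (fibreDeriv (A.localL L a))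
            (w.proj, (A.pontFib a w).1.2)
            ((u.1.1.1.2, (dirDeriv (pontModel B F) (A.pontFib a) w u.1.2).1.2) :
              (B × F) × F) c := by
  refine (mem_tangentSubspace_W1_iff hL hw hW u.1.2).trans ?_
  rw [dirDeriv_fibCoord_proj hw, dirDeriv_momentum hL hw]

/-- The Hessian of `L` along the fibres, in local coordinates. -/
noncomputable def localHess (L : A.TanTotal → ℝ) (a : TotalSpace F E) (w : A.Pont) :
    F →L[ℝ] F →L[ℝ] ℝ :=
  fibreDeriv (fibreDeriv (A.localL L a)) (w.proj, (A.pontFib a w).1.2)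

include hL hw in
-- With zero component along 𝒯E the base point does not move, so the derivative of ∂L/∂v reduces to
-- the Hessian applied to δv.
theorem vertical_mem_constraintFiber (hW : w ∈ A.W1 L)
    {u : A.tanData.pontryaginProl (F × F) A.Tan w} (hu : u ∈ constraintFiber L w)
    (h0 : u.1.1 = 0) : (dirDeriv (pontModel B F) (A.pontFib a) w u.1.2).1.1 = 0 ∧
      ∀ c, (dirDeriv (pontModel B F) (A.pontFib a) w u.1.2).2 (0, c) =
        localHess L a w (dirDeriv (pontModel B F) (A.pontFib a) w u.1.2).1.2 c := by
  obtain ⟨h1, h2⟩ := (mem_constraintFiber_iff hL hw hW u).1 hu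
  rw [h0] at h1 h2
  refine ⟨h1.trans ?_, fun c => (h2 c).trans (congrArg (fun l : F →L[ℝ] ℝ => l c) ?_)⟩
  · exact congrArg Prod.snd ((isLinearMap_snd (A.tanTriv a) hw).map_zero)
  · exact dirDeriv_fibre (contMDiffNear_fibreDeriv
      (contMDiffNear_localL hL (q := (w.proj, (A.pontFib a w).1.2)) hw)).mdifferentiableAt _

include hL hw in
-- The free parameters of the fibre: the linearized equations prescribe δz and δp̄ and nothing else.
theorem exists_mem_constraintFiber (hW : w ∈ A.W1 L) (c : F × F) (δv : F) (δp : F →L[ℝ] ℝ) :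
    ∃ u ∈ constraintFiber L w, (A.tanTriv a ⟨w.proj, u.1.1⟩).2 = c ∧
      (dirDeriv (pontModel B F) (A.pontFib a) w u.1.2).1.2 = δv ∧
      ∀ d, (dirDeriv (pontModel B F) (A.pontFib a) w u.1.2).2 (d, 0) = δp d := by
  have hs := (AlgebroidData.trivializationAt_pontryagin_source (F := F × F) (A := A.Tan) a w).2 hw
  let X : A.Tan w.proj := (A.tanTriv a).symm w.proj c
  let k : F →L[ℝ] ℝ := dirDeriv ((𝓘(ℝ, B).prod 𝓘(ℝ, F)).prod 𝓘(ℝ, F)) (fibreDeriv (A.localL L a))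
    (w.proj, (A.pontFib a w).1.2) ((X.1.2, δv) : (B × F) × F)
  -- The entries `c.2` and `k` are the values of δz and δp̄ forced by tangency.
  let δ : (F × F) × ((F × F) →L[ℝ] ℝ) := ((c.2, δv), δp.comp (ContinuousLinearMap.fst ℝ F F) +
    k.comp (ContinuousLinearMap.snd ℝ F F))
  let u : A.tanData.pontryaginProl (F × F) A.Tan w :=
    A.tanData.ofFrame (A.tanTriv a) (AlgebroidData.pontTriv (F × F) A.Tan a) hs c δ
  have hu : dirDeriv (pontModel B F) (A.pontFib a) w u.1.2 = δ :=
    (Trivialization.tanLift_spec _ hs _ _).2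
  have hc : (A.tanTriv a ⟨w.proj, u.1.1⟩).2 = c := snd_symm (A.tanTriv a) hw c
  refine ⟨u, (mem_constraintFiber_iff hL hw hW u).2 ⟨?_, fun d => ?_⟩, hc, ?_, fun d => ?_⟩
  · rw [hu, hc]
  · rw [hu]
    change δp 0 + k d = k d
    rw [map_zero, zero_add]
  · rw [hu]
  · rw [hu]
    change δp d + k 0 = δp d
    rw [map_zero, add_zero]

theorem Omega_apply [T2Space M] (hw : w.proj ∈ (trivializationAt F E a.proj).source)
    (u v : A.tanData.pontryaginProl (F × F) A.Tan w) :
    A.Omega w u v =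
      (dirDeriv (pontModel B F) (A.pontFib a) w v.1.2).2 (A.tanTriv a ⟨w.proj, u.1.1⟩).2 -
        (dirDeriv (pontModel B F) (A.pontFib a) w u.1.2).2 (A.tanTriv a ⟨w.proj, v.1.1⟩).2 +
        (A.pontFib a w).2 (A.tanData.frameCoeff (A.tanTriv a) w.proj
          (A.tanTriv a ⟨w.proj, u.1.1⟩).2 (A.tanTriv a ⟨w.proj, v.1.1⟩).2) :=
  AlgebroidData.pontryaginSection_apply A.isLie_tanData hw u v

include hL hw in
-- Elements with zero component along 𝒯E kill the structure term and pair with the others through δ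
-- = (δp, Hδv) alone. They detect the component along 𝒯E of a kernel element when the Hessian is
-- nondegenerate, and supply a nonzero kernel element when it is not.
theorem kernel_Omega_iff [T2Space M] (hW : w ∈ A.W1 L) :
    (∀ u ∈ constraintFiber L w, (∀ v ∈ constraintFiber L w, A.Omega w u v = 0) → u = 0) ↔
      (localHess L a w).toBilinForm.Nondegenerate := by
  have hfr := A.isLie_tanData.isLinearMap_frameCoeff_right (A.tanTriv a) hw
  have hfl := A.isLie_tanData.isLinearMap_frameCoeff_left (A.tanTriv a) hw
  have hpair : ∀ (l : (F × F) →L[ℝ] ℝ) (x : F × F), l x = l (x.1, 0) + l (0, x.2) := fun l x => by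
    rw [← map_add]
    simp
  constructor
  · refine fun h => .ofSeparatingLeft fun δv hδ => ?_
    -- With `δv` in the kernel of the Hessian, this choice also has δp̄ = 0, so it pairs to zero
    -- with everything.
    obtain ⟨u, hu, hc, hv, hp⟩ := exists_mem_constraintFiber hL hw hW 0 δv 0
    have h0 : u.1.1 = 0 := snd_injective (A.tanTriv a) hw
      (hc.trans (isLinearMap_snd (A.tanTriv a) hw).map_zero.symm)
    obtain ⟨-, h2⟩ := vertical_mem_constraintFiber hL hw hW hu h0
    have hu0 : u = 0 := h u hu fun v _ => by
      rw [Omega_apply hw, hc, (hfl _).map_zero, map_zero, map_zero, hpair _ (A.tanTriv a _).2, hp,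
        h2, hv, show localHess L a w δv _ = 0 from hδ _]
      simp
    rw [hu0] at hv
    exact hv.symm.trans (congrArg (fun z : (F × F) × ((F × F) →L[ℝ] ℝ) => z.1.2)
      (dirDeriv_vzero (J := pontModel B F) (A.pontFib a)))
  · rintro ⟨hsep, hnd⟩ u hu huv
    have hc : (A.tanTriv a ⟨w.proj, u.1.1⟩).2 = 0 := by
      -- Pairing `u` with the elements having zero component along 𝒯E; `δp` and `δv` are independent
      -- and test the two halves of that component separately.
      have key : ∀ (δv : F) (δp : F →L[ℝ] ℝ), δp (A.tanTriv a ⟨w.proj, u.1.1⟩).2.1 +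
          localHess L a w δv (A.tanTriv a ⟨w.proj, u.1.1⟩).2.2 = 0 := by
        intro δv δp
        obtain ⟨v, hv, hc', hv', hp'⟩ := exists_mem_constraintFiber hL hw hW 0 δv δp
        have h0 : v.1.1 = 0 := snd_injective (A.tanTriv a) hw
          (hc'.trans (isLinearMap_snd (A.tanTriv a) hw).map_zero.symm)
        obtain ⟨-, h2⟩ := vertical_mem_constraintFiber hL hw hW hv h0
        have h := huv v hv
        rwa [Omega_apply hw, hc', (hfr _).map_zero, map_zero, map_zero, sub_zero, add_zero,
          hpair, hp', h2, hv'] at h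
      refine Prod.ext ?_ ?_
      · by_contra hne
        obtain ⟨δp, -, hδp⟩ := exists_dual_vector ℝ _ (norm_ne_zero_iff.2 hne)
        have h := key 0 δp
        simp only [map_zero, zero_apply, add_zero] at h
        rw [hδp] at h
        exact hne (norm_eq_zero.1 (by exact_mod_cast h))
      · refine hnd _ fun δv => ?_
        simpa using key δv 0
    have h0 : u.1.1 = 0 := snd_injective (A.tanTriv a) hw
      (hc.trans (isLinearMap_snd (A.tanTriv a) hw).map_zero.symm)
    obtain ⟨h1, h2⟩ := vertical_mem_constraintFiber hL hw hW hu h0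
    -- Now only minus the variation of (p, p̄), evaluated on the 𝒯E-component of the other element,
    -- survives, and that component is arbitrary.
    have hν : (dirDeriv (pontModel B F) (A.pontFib a) w u.1.2).2 = 0 := by
      refine ContinuousLinearMap.ext fun x => ?_
      obtain ⟨v, hv, hc', -⟩ := exists_mem_constraintFiber hL hw hW x 0 0
      have h := huv v hv
      rw [Omega_apply hw, hc, hc', (hfl _).map_zero, map_zero, map_zero, zero_sub, add_zero,
        neg_eq_zero] at h
      exact h
    have hv : (dirDeriv (pontModel B F) (A.pontFib a) w u.1.2).1.2 = 0 := by
      refine hsep _ fun c => (h2 c).symm.trans ?_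
      rw [hν]
      rfl
    have hU : dirDeriv (pontModel B F) (A.pontFib a) w u.1.2 = 0 :=
      Prod.ext (Prod.ext h1 hv) hν
    have hs := (AlgebroidData.trivializationAt_pontryagin_source (F := F × F) (A := A.Tan) a w).2 hw
    refine Subtype.ext (Prod.ext h0 ((AlgebroidData.pontTriv (F × F) A.Tan a).tangent_ext
      (I := 𝓘(ℝ, B).prod 𝓘(ℝ, F)) hs ?_ (hU.trans (dirDeriv_vzero _).symm)))
    -- The base part of the velocity is the anchor of the vanishing 𝒯E-component.
    exact u.2.symm.trans ((congrArg (A.tanData.anchor w.proj) h0).trans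
      (0 : A.tanData.pontryaginProl (F × F) A.Tan w).2)

include hL in
theorem hess_eq_localHess (hw : w.proj ∈ (trivializationAt F E a.proj).source) (hW : w ∈ A.W1 L)
    (b b' : E w.proj.proj) :
    A.hess L (AlgebroidData.pr₁ w) b b' =
      localHess L a w (trivializationAt F E a.proj ⟨w.proj.proj, b⟩).2
        (trivializationAt F E a.proj ⟨w.proj.proj, b'⟩).2 :=
  hess_eq hL (p := AlgebroidData.pr₁ w) hw hW.1 b b'

include hL hw in
-- The trivialization carries the basis of the fibre of `E` to a basis of `F`, and the matrix is the
-- Gram matrix of the local Hessian there. The right side does not involve the basis.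
theorem det_hess_ne_zero_iff (hW : w ∈ A.W1 L)
    (b : Module.Basis (Fin (Module.finrank ℝ F)) ℝ (E w.proj.proj)) :
    (Matrix.of fun i j => A.hess L (AlgebroidData.pr₁ w) (b i) (b j)).det ≠ 0 ↔
      (localHess L a w).toBilinForm.Nondegenerate := by
  have hb : w.proj.proj ∈ (trivializationAt F E a.proj).baseSet :=
    (Trivialization.mem_source _).1 hw
  rw [LinearMap.BilinForm.nondegenerate_iff_det_ne_zero
    (b.map ((trivializationAt F E a.proj).linearEquivAt ℝ _ hb))]
  have h : (Matrix.of fun i j => A.hess L (AlgebroidData.pr₁ w) (b i) (b j)) =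
      LinearMap.BilinForm.toMatrix (b.map ((trivializationAt F E a.proj).linearEquivAt ℝ _ hb))
        (localHess L a w).toBilinForm := by
    ext i j
    rw [LinearMap.BilinForm.toMatrix_apply]
    exact hess_eq_localHess hL hw hW (b i) (b j)
  rw [h]

/-- Ensures that the quantification over bases in the final statement is not vacuous. -/
theorem nonempty_basis (x : M) : Nonempty (Module.Basis (Fin (Module.finrank ℝ F)) ℝ (E x)) :=
  ⟨(Module.finBasis ℝ F).map ((trivializationAt F E x).linearEquivAt ℝ x
    (FiberBundle.mem_baseSet_trivializationAt' x)).symm⟩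

end LieAlgebroid

theorem mainTheorem1 {B F M : Type*} {E : M → Type*}
    [NormedAddCommGroup B] [NormedSpace ℝ B] [FiniteDimensional ℝ B]
    [NormedAddCommGroup F] [NormedSpace ℝ F] [FiniteDimensional ℝ F]
    [TopologicalSpace M] [T2Space M] [ChartedSpace B M] [IsManifold 𝓘(ℝ, B) ∞ M]
    [TopologicalSpace (TotalSpace F E)] [∀ x, TopologicalSpace (E x)]
    [∀ x, AddCommGroup (E x)] [∀ x, Module ℝ (E x)]
    [∀ x, IsTopologicalAddGroup (E x)] [∀ x, ContinuousSMul ℝ (E x)]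
    [FiberBundle F E] [VectorBundle ℝ F E] [ContMDiffVectorBundle ∞ F E 𝓘(ℝ, B)]
    (A : LieAlgebroid B F E) (L : A.TanTotal → ℝ)
    (hL : ContMDiffOn ((𝓘(ℝ, B).prod 𝓘(ℝ, F)).prod 𝓘(ℝ, F × F)) 𝓘(ℝ, ℝ) ∞ L A.E2) :
    A.tanData.IsSymplecticOn (F × F) (A.W1 L) A.Omega ↔
      ∀ w ∈ A.W1 L, ∀ e : Module.Basis (Fin (Module.finrank ℝ F)) ℝ (E w.proj.proj),
        (Matrix.of fun i j => A.hess L (AlgebroidData.pr₁ w) (e i) (e j)).det ≠ 0 := by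
  refine (AlgebroidData.isSymplecticOn_pontryagin_iff A.isLie_tanData (A.W1 L)).trans
    (forall₂_congr fun w hW => ?_)
  have hw : w.proj ∈ (trivializationAt F E w.proj.proj).source :=
    FiberBundle.mem_trivializationAt_proj_source
  have hb := LieAlgebroid.nonempty_basis (F := F) (E := E) w.proj.proj
  refine (LieAlgebroid.kernel_Omega_iff (a := w.proj) hL hw hW).trans ?_
  -- The determinant condition is the same for all bases, and `hb` provides one, so the quantifier
  -- can be dropped.
  simp only [LieAlgebroid.det_hess_ne_zero_iff (a := w.proj) hL hw hW, forall_const]
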